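/- Let $k$ be a commutative ring and let $A$ be a quasitriangular Hopf algebra over $k$ with antipode $s$ and invertible Yang--Baxter element $\rho=\sum e\otimes e'\in A\otimes A$; that is, $\rho\,\Delta(x)=\Delta'(x)\,\rho$ for all $x\in A$ (with $\Delta'$ the opposite coproduct), $(1\otimes\Delta)\rho=\rho_{13}\rho_{12}$ and $(\Delta\otimes 1)\rho=\rho_{13}\rho_{23}$. Diagrams are read from bottom to top, and composites are written in this order. Let $\mathrm{Tang}$ be the category of unoriented tangle diagrams, in general position with respect to the vertical direction, up to regular isotopy. Its objects are the tensor powers $V^{\otimes n}$ ($n\ge 0$, $V^{\otimes 0}=k$). Its morphisms are generated under composition and tensor product by $Cup: k\to V\otimes V$, $Cap: V\otimes V\to k$ and the two crossings $R,L: V\otimes V\to V\otimes V$ (in $R$ the overcrossing line goes upward from right to left, in $L$ from left to right). The relations are: exchange of the heights of distant pieces, $(Cup\otimes 1)(1\otimes Cap)=1=(1\otimes Cup)(Cap\otimes 1)$, the second Reidemeister move $RL=1=LR$, the third Reidemeister move, and the switchback moves, in which a line passes from one leg of a maximum or minimum to the other leg. Let $\mathrm{Cat}(A)$ be the $k$-linear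 tensor category with the same objects, generated by morphisms $a:V\to V$ for $a\in A$ (``beads'', $k$-linear in $a$, with the unit of $A$ as identity and the product $ab$ as the bead $a$ followed above it by the bead $b$), $Cup$, $Cap$ and a permutation $P:V\otimes V\to V\otimes V$. The relations are the two cancellations of $Cup$ and $Cap$ above, $(a\otimes 1)\circ Cup=(1\otimes s(a))\circ Cup$, $Cap\circ(1\otimes a)=Cap\circ(s(a)\otimes 1)$, $P\circ(a\otimes b)=(b\otimes a)\circ P$, $P^2=1$, the braid relation for $P$, and the switchback relations for $P$ with $Cup$ and $Cap$ (here $\circ$ is the usual composition of maps, right factor first). Put $G=(1\otimes Cup)(P\otimes 1)(1\otimes Cap)$ and $G^{-1}=(Cup\otimes 1)(1\otimes P)(Cap\otimes 1)$; these are mutually inverse morphisms $V\to V$. Let $F$ be the assignment on tangle diagrams, compatible with composition and tensor product, such that $F(Cup)=Cup$, $F(Cap)=Cap$, $F(R)=P\rho$ (the flat crossing with $\rho$ above it) and $F(L)=\rho^{-1}P$ (the flat crossing with $\rho^{-1}=\sum s(e)\otimes e'$ below it). For a $1$-$1$ tangle diagram $T:V\to V$ that consists of a single strand, let $d(T)\in\mathbb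 Z$ be the Whitney degree of the underlying plane curve, travelled from bottom to top: half of the difference between the number of its clockwise extrema and the number of its counterclockwise extrema (so that $G$ has degree $1$). Let $w[T]\in A$ be the element obtained by sliding all beads of $F(T)$ along the strand to its lower end: it is the sum, over all choices of a term of $\rho=\sum e\otimes e'$ at every crossing, of the products, in the order in which the beads are met, of the elements $s^{q}(a)$, where $a$ runs over the beads on the strand and $q\in\mathbb Z$ is the number of clockwise minus the number of counterclockwise extrema passed before the bead $a$. Then: 1. Regularly isotopic tangle diagrams have the same image under $F$, so that $F$ is a functor $\mathrm{Tang}\to\mathrm{Cat}(A)$. In particular, $F(T)$ is a regular isotopy invariant. 2. For every single-stranded $1$-$1$ tangle $T$ one has $F(T)=w[T]\,G^{d(T)}$. The element $w[T]$ depends only on the morphism $F(T)$: if $F(T)=a\,G^{n}$ with $a\in A$ and $n\in\mathbb Z$, then $a=w[T]$. 3. $w[T]\in A$ and $d(T)\in\mathbb Z$ are each regular isotopy invariants of the single-stranded $1$-$1$ tangle $T$. -/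

import Mathlib

open scoped TensorProduct

namespace KnotOnString

/-! ### Planar diagrams in general position with respect to the vertical direction -/

/-- Generating morphisms `g : V^{⊗ inn g} ⟶ V^{⊗ out g}`. -/
class Signature (G : Type*) where
  inn : G → ℕ
  out : G → ℕ

open Signature

/-- A layer `(i, g)`: the elementary piece `g` with `i` vertical strands on its left. -/
abbrev Layer (G : Type*) := ℕ × G

/-- Diagrams `V^{⊗ m} ⟶ V^{⊗ n}`, read from bottom to top, one elementary piece at a time.
`cons i j g _ _ D` is `1_{V^{⊗ i}} ⊗ g ⊗ 1_{V^{⊗ j}}` with `D` stacked on top of it. -/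
inductive Diagram (G : Type*) [Signature G] : ℕ → ℕ → Type _
  | nil (n : ℕ) : Diagram G n n
  | cons {m m' n : ℕ} (i j : ℕ) (g : G) (hm : m = i + inn g + j) (hm' : m' = i + out g + j)
      (D : Diagram G m' n) : Diagram G m n

namespace Diagram

variable {G : Type*} [Signature G]

/-- The list of layers of a diagram, from bottom to top. -/
def layers : {m n : ℕ} → Diagram G m n → List (Layer G)
  | _, _, nil _ => []
  | _, _, cons i _ g _ _ D => (i, g) :: D.layers

/-- `D.append E` is `E` stacked on top of `D`. -/
def append : {m n p : ℕ} → Diagram G m n → Diagram G n p → Diagram G m p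
  | _, _, _, nil _, E => E
  | _, _, _, cons i j g hm hm' D, E => cons i j g hm hm' (D.append E)

theorem layers_append : ∀ {m n p : ℕ} (D : Diagram G m n) (E : Diagram G n p),
    (D.append E).layers = D.layers ++ E.layers
  | _, _, _, nil _, _ => rfl
  | _, _, _, cons _ _ _ _ _ D, E => by simp [append, layers, layers_append D E]

theorem append_nil : ∀ {m n : ℕ} (D : Diagram G m n), D.append (nil n) = D
  | _, _, nil _ => rfl
  | _, _, cons _ _ _ _ _ D => by simp [append, append_nil D]

theorem append_assoc : ∀ {m n p q : ℕ} (D : Diagram G m n) (E : Diagram G n p)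
    (H : Diagram G p q), (D.append E).append H = D.append (E.append H)
  | _, _, _, _, nil _, _, _ => rfl
  | _, _, _, _, cons _ _ _ _ _ D, E, H => by simp [append, append_assoc D E H]

end Diagram

/-- Stacking of formal linear combinations of diagrams. -/
noncomputable def stack (k : Type*) [CommRing k] {G : Type*} [Signature G] (m n p : ℕ) :
    (Diagram G m n →₀ k) →ₗ[k] (Diagram G n p →₀ k) →ₗ[k] (Diagram G m p →₀ k) :=
  Finsupp.linearCombination k fun D => Finsupp.lmapDomain k k D.append

theorem stack_single (k : Type*) [CommRing k] {G : Type*} [Signature G] {m n p : ℕ} (D : Diagram G m n) (E : Diagram G n p) (r s : k) :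
    stack k m n p (Finsupp.single D r) (Finsupp.single E s) =
      Finsupp.single (D.append E) (r * s) := by
  simp [stack, Finsupp.linearCombination_single]

/-- Given a family of local moves, `LocalStep move D D'` says that `D'` arises from `D` by
replacing one block of consecutive layers by another one according to a move. -/
def LocalStep {G : Type*} [Signature G] (move : List (Layer G) → List (Layer G) → Prop)
    {m n : ℕ} (D D' : Diagram G m n) : Prop :=
  ∃ u v x y : List (Layer G), move x y ∧ D.layers = u ++ x ++ v ∧ D'.layers = u ++ y ++ v

/-! ### The tangle category -/

/-- In `R` the overcrossing line goes upward from right to left, in `L` from left to right. -/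
inductive TangGen
  | cup | cap | R | L

instance : Signature TangGen where
  inn | .cup => 0 | .cap => 2 | .R => 2 | .L => 2
  out | .cup => 2 | .cap => 0 | .R => 2 | .L => 2

/-- (Unoriented) tangle diagrams with `m` bottom ends and `n` top ends. -/
abbrev TangDiagram (m n : ℕ) := Diagram TangGen m n

/-- The elementary regular isotopies. -/
inductive TangMove : List (Layer TangGen) → List (Layer TangGen) → Prop
  /-- two pieces, one to the left of the other, may exchange their heights -/
  | exchange (i j : ℕ) (g h : TangGen) :
      TangMove [(i, g), (i + out g + j, h)] [(i + inn g + j, h), (i, g)]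
  /-- cancellation of a maximum and a minimum -/
  | zigzag_left (i : ℕ) : TangMove [(i, .cup), (i + 1, .cap)] []
  | zigzag_right (i : ℕ) : TangMove [(i + 1, .cup), (i, .cap)] []
  /-- second Reidemeister move -/
  | RL (i : ℕ) : TangMove [(i, .R), (i, .L)] []
  | LR (i : ℕ) : TangMove [(i, .L), (i, .R)] []
  /-- third Reidemeister move -/
  | braid (i : ℕ) :
      TangMove [(i, .R), (i + 1, .R), (i, .R)] [(i + 1, .R), (i, .R), (i + 1, .R)]
  /-- switchbacks: a line passes from one leg of a maximum or minimum to the other leg -/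
  | cap_over (i : ℕ) : TangMove [(i, .R), (i + 1, .cap)] [(i + 1, .L), (i, .cap)]
  | cap_under (i : ℕ) : TangMove [(i, .L), (i + 1, .cap)] [(i + 1, .R), (i, .cap)]
  | cup_over (i : ℕ) : TangMove [(i + 1, .cup), (i, .L)] [(i, .cup), (i + 1, .R)]
  | cup_under (i : ℕ) : TangMove [(i + 1, .cup), (i, .R)] [(i, .cup), (i + 1, .L)]

/-- Regular isotopy of tangle diagrams. -/
def RegularIsotopic {m n : ℕ} (T T' : TangDiagram m n) : Prop :=
  Relation.EqvGen (LocalStep TangMove) T T'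

/-! ### Quasitriangular Hopf algebras -/

section Quasitriangular

variable (k : Type*) {A : Type*} [CommRing k] [Ring A] [HopfAlgebra k A]

/-- `e ⊗ e' ↦ e ⊗ e' ⊗ 1` -/
noncomputable def leg12 : A ⊗[k] A →ₐ[k] A ⊗[k] (A ⊗[k] A) :=
  Algebra.TensorProduct.map (AlgHom.id k A) Algebra.TensorProduct.includeLeft

/-- `e ⊗ e' ↦ e ⊗ 1 ⊗ e'` -/
noncomputable def leg13 : A ⊗[k] A →ₐ[k] A ⊗[k] (A ⊗[k] A) :=
  Algebra.TensorProduct.map (AlgHom.id k A) Algebra.TensorProduct.includeRight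

/-- `e ⊗ e' ↦ 1 ⊗ e ⊗ e'` -/
noncomputable def leg23 : A ⊗[k] A →ₐ[k] A ⊗[k] (A ⊗[k] A) :=
  Algebra.TensorProduct.includeRight

/-- The invertible element `ρ ∈ A ⊗ A` is a quasitriangular structure on the Hopf algebra `A`. -/
structure IsQuasitriangular (ρ : (A ⊗[k] A)ˣ) : Prop where
  mul_comul : ∀ x : A, (ρ : A ⊗[k] A) * Coalgebra.comul (R := k) x =
    TensorProduct.comm k A A (Coalgebra.comul (R := k) x) * (ρ : A ⊗[k] A)
  id_tensor_comul : (Coalgebra.comul (R := k) (A := A)).lTensor A (ρ : A ⊗[k] A) =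
    leg13 k (ρ : A ⊗[k] A) * leg12 k (ρ : A ⊗[k] A)
  comul_tensor_id : TensorProduct.assoc k A A A
      ((Coalgebra.comul (R := k) (A := A)).rTensor A (ρ : A ⊗[k] A)) =
    leg13 k (ρ : A ⊗[k] A) * leg23 k (ρ : A ⊗[k] A)

end Quasitriangular

/-! ### The category `Cat(A)` -/

/-- Generators of `Cat(A)`; `bead a` is the morphism `a : V ⟶ V` and `P` the permutation. -/
inductive CatGen (A : Type*)
  | bead (a : A) | cup | cap | P

instance (A : Type*) : Signature (CatGen A) where
  inn | .bead _ => 1 | .cup => 0 | .cap => 2 | .P => 2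
  out | .bead _ => 1 | .cup => 2 | .cap => 0 | .P => 2

/-- Immersed curves with beads, in general position with respect to the vertical direction. -/
abbrev BeadDiagram (A : Type*) (m n : ℕ) := Diagram (CatGen A) m n

section CatA

variable (k : Type*) {A : Type*} [CommRing k] [Ring A] [HopfAlgebra k A]

/-- The antipode. -/
abbrev antip (a : A) : A := HopfAlgebra.antipode k a

/-- The defining relations of `Cat(A)` that do not involve sums.  A product `a * b` is the bead
`a` followed by the bead `b` on top of it. -/
inductive CatMove : List (Layer (CatGen A)) → List (Layer (CatGen A)) → Prop
  | exchange (i j : ℕ) (g h : CatGen A) :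
      CatMove [(i, g), (i + out g + j, h)] [(i + inn g + j, h), (i, g)]
  | bead_mul (i : ℕ) (a b : A) : CatMove [(i, .bead a), (i, .bead b)] [(i, .bead (a * b))]
  | bead_one (i : ℕ) : CatMove [(i, .bead 1)] []
  /-- `(a ⊗ 1) ∘ Cup = (1 ⊗ s(a)) ∘ Cup` -/
  | cup_bead (i : ℕ) (a : A) :
      CatMove [(i, .cup), (i, .bead a)] [(i, .cup), (i + 1, .bead (antip k a))]
  /-- `Cap ∘ (1 ⊗ a) = Cap ∘ (s(a) ⊗ 1)` -/
  | cap_bead (i : ℕ) (a : A) :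
      CatMove [(i + 1, .bead a), (i, .cap)] [(i, .bead (antip k a)), (i, .cap)]
  | zigzag_left (i : ℕ) : CatMove [(i, .cup), (i + 1, .cap)] []
  | zigzag_right (i : ℕ) : CatMove [(i + 1, .cup), (i, .cap)] []
  /-- `P ∘ (a ⊗ b) = (b ⊗ a) ∘ P` -/
  | P_bead (i : ℕ) (a b : A) :
      CatMove [(i, .bead a), (i + 1, .bead b), (i, .P)] [(i, .P), (i, .bead b), (i + 1, .bead a)]
  | P_sq (i : ℕ) : CatMove [(i, .P), (i, .P)] []
  | P_braid (i : ℕ) :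
      CatMove [(i, .P), (i + 1, .P), (i, .P)] [(i + 1, .P), (i, .P), (i + 1, .P)]
  | cap_switchback (i : ℕ) : CatMove [(i, .P), (i + 1, .cap)] [(i + 1, .P), (i, .cap)]
  | cup_switchback (i : ℕ) : CatMove [(i + 1, .cup), (i, .P)] [(i, .cup), (i + 1, .P)]

/-- All defining relations of `Cat(A)`: the local ones, and `k`-linearity in every bead. -/
inductive CatRel {m n : ℕ} : (BeadDiagram A m n →₀ k) → (BeadDiagram A m n →₀ k) → Prop
  | move (D D' : BeadDiagram A m n) (h : LocalStep (CatMove k) D D') :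
      CatRel (Finsupp.single D 1) (Finsupp.single D' 1)
  | add (D D₁ D₂ : BeadDiagram A m n) (u v : List (Layer (CatGen A))) (i : ℕ) (a b : A)
      (h : D.layers = u ++ [(i, .bead (a + b))] ++ v)
      (h₁ : D₁.layers = u ++ [(i, .bead a)] ++ v)
      (h₂ : D₂.layers = u ++ [(i, .bead b)] ++ v) :
      CatRel (Finsupp.single D 1) (Finsupp.single D₁ 1 + Finsupp.single D₂ 1)
  | smul (D D₁ : BeadDiagram A m n) (u v : List (Layer (CatGen A))) (i : ℕ) (c : k) (a : A)
      (h : D.layers = u ++ [(i, .bead (c • a))] ++ v)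
      (h₁ : D₁.layers = u ++ [(i, .bead a)] ++ v) :
      CatRel (Finsupp.single D 1) (c • Finsupp.single D₁ 1)

variable (A)

/-- The submodule of formal linear combinations of bead diagrams that vanish in `Cat(A)`. -/
noncomputable def catRelSpan (m n : ℕ) : Submodule k (BeadDiagram A m n →₀ k) :=
  Submodule.span k {x | ∃ f g, CatRel k f g ∧ x = f - g}

/-- Morphisms `V^{⊗ m} ⟶ V^{⊗ n}` of `Cat(A)`. -/
abbrev CatHom (m n : ℕ) := (BeadDiagram A m n →₀ k) ⧸ catRelSpan k A m n

variable {A}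

/-- The morphism of `Cat(A)` given by a bead diagram. -/
noncomputable def CatHom.of {m n : ℕ} (D : BeadDiagram A m n) : CatHom k A m n :=
  (catRelSpan k A m n).mkQ (Finsupp.single D 1)

theorem CatHom.rel {m n : ℕ} {f g : BeadDiagram A m n →₀ k} (h : CatRel k f g) :
    (catRelSpan k A m n).mkQ f = (catRelSpan k A m n).mkQ g := by
  rw [← sub_eq_zero, ← map_sub]
  exact (Submodule.Quotient.mk_eq_zero _).2 (Submodule.subset_span ⟨f, g, h, rfl⟩)

theorem CatRel.stack_right {m n p : ℕ} {f g : BeadDiagram A m n →₀ k} (h : CatRel k f g)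
    (E : BeadDiagram A n p) :
    CatRel k (stack k m n p f (Finsupp.single E 1)) (stack k m n p g (Finsupp.single E 1)) := by
  cases h with
  | move D D' h =>
    obtain ⟨u, v, x, y, hm, h1, h2⟩ := h
    rw [stack_single, stack_single, mul_one]
    exact .move _ _ ⟨u, v ++ E.layers, x, y, hm, by simp [Diagram.layers_append, h1],
      by simp [Diagram.layers_append, h2]⟩
  | add D D₁ D₂ u v i a b h h₁ h₂ =>
    rw [map_add, LinearMap.add_apply, stack_single, stack_single, stack_single, mul_one]
    exact .add _ _ _ u (v ++ E.layers) i a b (by simp [Diagram.layers_append, h])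
      (by simp [Diagram.layers_append, h₁]) (by simp [Diagram.layers_append, h₂])
  | smul D D₁ u v i c a h h₁ =>
    rw [map_smul, LinearMap.smul_apply, stack_single, stack_single, mul_one]
    exact .smul _ _ u (v ++ E.layers) i c a (by simp [Diagram.layers_append, h])
      (by simp [Diagram.layers_append, h₁])

theorem CatRel.stack_left {m n p : ℕ} {f g : BeadDiagram A n p →₀ k} (h : CatRel k f g)
    (E : BeadDiagram A m n) :
    CatRel k (stack k m n p (Finsupp.single E 1) f) (stack k m n p (Finsupp.single E 1) g) := by
  cases h with
  | move D D' h =>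
    obtain ⟨u, v, x, y, hm, h1, h2⟩ := h
    rw [stack_single, stack_single, mul_one]
    exact .move _ _ ⟨E.layers ++ u, v, x, y, hm, by simp [Diagram.layers_append, h1],
      by simp [Diagram.layers_append, h2]⟩
  | add D D₁ D₂ u v i a b h h₁ h₂ =>
    rw [map_add, stack_single, stack_single, stack_single, mul_one]
    exact .add _ _ _ (E.layers ++ u) v i a b (by simp [Diagram.layers_append, h])
      (by simp [Diagram.layers_append, h₁]) (by simp [Diagram.layers_append, h₂])
  | smul D D₁ u v i c a h h₁ =>
    rw [map_smul, stack_single, stack_single, mul_one]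
    exact .smul _ _ (E.layers ++ u) v i c a (by simp [Diagram.layers_append, h])
      (by simp [Diagram.layers_append, h₁])

/-- Composition in `Cat(A)`, in diagrammatic order (the first argument is below the second), as a
bilinear map. -/
noncomputable def CatHom.compₗ (m n p : ℕ) :
    CatHom k A m n →ₗ[k] CatHom k A n p →ₗ[k] CatHom k A m p :=
  (catRelSpan k A m n).liftQ
    (LinearMap.flip ((catRelSpan k A n p).liftQ
      (LinearMap.flip ((stack k m n p).compr₂ (catRelSpan k A m p).mkQ))
      (by
        rw [catRelSpan, Submodule.span_le]
        rintro _ ⟨f, g, h, rfl⟩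
        rw [SetLike.mem_coe, LinearMap.mem_ker, map_sub, sub_eq_zero]
        refine Finsupp.lhom_ext' fun E => LinearMap.ext_ring ?_
        exact CatHom.rel k (h.stack_left k E))))
    (by
      rw [catRelSpan, Submodule.span_le]
      rintro _ ⟨f, g, h, rfl⟩
      rw [SetLike.mem_coe, LinearMap.mem_ker, map_sub, sub_eq_zero]
      refine Submodule.linearMap_qext _ (Finsupp.lhom_ext' fun E => LinearMap.ext_ring ?_)
      exact CatHom.rel k (h.stack_right k E))

/-- Composition in `Cat(A)`, in diagrammatic order. -/
noncomputable def CatHom.comp {m n p : ℕ} (f : CatHom k A m n) (g : CatHom k A n p) :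
    CatHom k A m p :=
  CatHom.compₗ k m n p f g

theorem CatHom.of_comp_of {m n p : ℕ} (D : BeadDiagram A m n) (E : BeadDiagram A n p) :
    CatHom.comp k (CatHom.of k D) (CatHom.of k E) = CatHom.of k (D.append E) := by
  have : CatHom.comp k (CatHom.of k D) (CatHom.of k E) = (catRelSpan k A m p).mkQ
      (stack k m n p (Finsupp.single D 1) (Finsupp.single E 1)) := rfl
  rw [this, stack_single, mul_one]; rfl

theorem CatHom.hom_ext {m n : ℕ} {M : Type*} [AddCommGroup M] [Module k M]
    {f g : CatHom k A m n →ₗ[k] M} (h : ∀ D, f (CatHom.of k D) = g (CatHom.of k D)) : f = g :=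
  Submodule.linearMap_qext _ (Finsupp.lhom_ext' fun D => LinearMap.ext_ring (h D))

theorem CatHom.induction {m n : ℕ} {motive : CatHom k A m n → Prop} (zero : motive 0)
    (of : ∀ D, motive (CatHom.of k D)) (add : ∀ x y, motive x → motive y → motive (x + y))
    (smul : ∀ (r : k) x, motive x → motive (r • x)) (x : CatHom k A m n) : motive x := by
  have h1 : ∀ (D : BeadDiagram A m n) (r : k),
      (catRelSpan k A m n).mkQ (Finsupp.single D r) = r • CatHom.of k D := fun D r => by
    rw [CatHom.of, ← map_smul, Finsupp.smul_single, smul_eq_mul, mul_one]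
  obtain ⟨f, rfl⟩ := (catRelSpan k A m n).mkQ_surjective x
  induction f using Finsupp.induction_linear with
  | zero => rw [map_zero]; exact zero
  | add f g hf hg => rw [map_add]; exact add _ _ hf hg
  | single E r => rw [h1]; exact smul _ _ (of E)

/-- The identity of `V^{⊗ n}`. -/
noncomputable def CatHom.id (n : ℕ) : CatHom k A n n := CatHom.of k (.nil n)

theorem CatHom.id_comp {m n : ℕ} (f : CatHom k A m n) :
    CatHom.comp k (CatHom.id k m) f = f := by
  have : CatHom.compₗ k m m n (CatHom.id k m) = LinearMap.id (M := CatHom k A m n) :=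
    CatHom.hom_ext k fun D => CatHom.of_comp_of k (.nil m) D
  exact LinearMap.congr_fun this f

theorem CatHom.comp_id {m n : ℕ} (f : CatHom k A m n) :
    CatHom.comp k f (CatHom.id k n) = f := by
  have : (CatHom.compₗ k m n n).flip (CatHom.id k n) = LinearMap.id (M := CatHom k A m n) :=
    CatHom.hom_ext k fun D => by
      have h := CatHom.of_comp_of k D (.nil n)
      rw [Diagram.append_nil] at h
      exact h
  exact LinearMap.congr_fun this f

theorem CatHom.assoc {m n p q : ℕ} (f : CatHom k A m n) (g : CatHom k A n p)
    (h : CatHom k A p q) :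
    CatHom.comp k (CatHom.comp k f g) h = CatHom.comp k f (CatHom.comp k g h) := by
  have add₁ : ∀ {a b c : ℕ} (x y : CatHom k A a b) (z : CatHom k A b c),
      CatHom.comp k (x + y) z = CatHom.comp k x z + CatHom.comp k y z :=
    fun x y z => LinearMap.map_add₂ _ x y z
  have add₂ : ∀ {a b c : ℕ} (x : CatHom k A a b) (y z : CatHom k A b c),
      CatHom.comp k x (y + z) = CatHom.comp k x y + CatHom.comp k x z :=
    fun x y z => map_add _ y z
  have smul₁ : ∀ {a b c : ℕ} (r : k) (x : CatHom k A a b) (z : CatHom k A b c),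
      CatHom.comp k (r • x) z = r • CatHom.comp k x z :=
    fun r x z => LinearMap.map_smul₂ _ r x z
  have smul₂ : ∀ {a b c : ℕ} (r : k) (x : CatHom k A a b) (z : CatHom k A b c),
      CatHom.comp k x (r • z) = r • CatHom.comp k x z :=
    fun r x z => map_smul _ r z
  have zero₁ : ∀ {a b c : ℕ} (z : CatHom k A b c),
      CatHom.comp k (0 : CatHom k A a b) z = 0 := fun z => LinearMap.map_zero₂ _ z
  have zero₂ : ∀ {a b c : ℕ} (x : CatHom k A a b),
      CatHom.comp k x (0 : CatHom k A b c) = 0 := fun x => map_zero _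
  induction f using CatHom.induction with
  | zero => simp only [zero₁]
  | add x y hx hy => simp only [add₁, hx, hy]
  | smul r x hx => simp only [smul₁, hx]
  | of D =>
    induction g using CatHom.induction with
    | zero => simp only [zero₁, zero₂]
    | add x y hx hy => simp only [add₁, add₂, hx, hy]
    | smul r x hx => simp only [smul₁, smul₂, hx]
    | of E =>
      induction h using CatHom.induction with
      | zero => simp only [zero₂]
      | add x y hx hy => simp only [add₂, hx, hy]
      | smul r x hx => simp only [smul₂, hx]
      | of H => simp only [CatHom.of_comp_of, Diagram.append_assoc]

/-- `Cat(A)`: the object `⟨n⟩` is `V^{⊗ n}`, and `⟨0⟩` is `k`. -/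
structure CatObj (k A : Type*) where
  width : ℕ

noncomputable instance : CategoryTheory.Category (CatObj k A) where
  Hom X Y := CatHom k A X.width Y.width
  id X := CatHom.id k X.width
  comp f g := CatHom.comp k f g
  id_comp f := CatHom.id_comp k f
  comp_id f := CatHom.comp_id k f
  assoc f g h := CatHom.assoc k f g h

/-- The morphism `1_{V^{⊗ i}} ⊗ g ⊗ 1_{V^{⊗ j}}` for a generator `g`. -/
noncomputable def CatHom.gen {m n : ℕ} (i j : ℕ) (g : CatGen A) (hm : m = i + inn g + j)
    (hn : n = i + out g + j) : CatHom k A m n :=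
  CatHom.of k (.cons i j g hm hn (.nil n))

/-- `1_{V^{⊗ i}} ⊗ a ⊗ 1_{V^{⊗ j}}`, linear in `a`. -/
noncomputable def CatHom.beadₗ {m : ℕ} (i j : ℕ) (hm : m = i + 1 + j) :
    A →ₗ[k] CatHom k A m m where
  toFun a := CatHom.gen k i j (.bead a) hm hm
  map_add' a b := by
    have h := CatHom.rel k (CatRel.add (k := k)
      (.cons i j (.bead (a + b)) hm hm (.nil m)) (.cons i j (.bead a) hm hm (.nil m))
      (.cons i j (.bead b) hm hm (.nil m)) [] [] i a b rfl rfl rfl)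
    rw [map_add] at h
    exact h
  map_smul' c a := by
    have h := CatHom.rel k (CatRel.smul (k := k)
      (.cons i j (.bead (c • a)) hm hm (.nil m)) (.cons i j (.bead a) hm hm (.nil m))
      [] [] i c a rfl rfl)
    rw [map_smul] at h
    exact h

/-- `1_{V^{⊗ i}} ⊗ x ⊗ 1_{V^{⊗ j}}` for `x ∈ A ⊗ A`, as a morphism of `Cat(A)`. -/
noncomputable def CatHom.tensorBead {m : ℕ} (i j : ℕ) (hm : m = i + 2 + j) :
    A ⊗[k] A →ₗ[k] CatHom k A m m :=
  TensorProduct.lift ((CatHom.compₗ k m m m).compl₁₂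
    (CatHom.beadₗ k i (1 + j) (by omega)) (CatHom.beadₗ k (i + 1) j (by omega)))

/-! ### The functor `F` -/

/-- `F` on an elementary tangle with `i` strands on its left and `j` strands on its right:
`F(R)` is `P` with `ρ` on top of it, `F(L)` is `ρ⁻¹` with `P` on top of it. -/
noncomputable def tangGenF (ρ : (A ⊗[k] A)ˣ) {m n : ℕ} (i j : ℕ) : (g : TangGen) →
    (hm : m = i + inn g + j) → (hn : n = i + out g + j) → CatHom k A m n
  | .cup, hm, hn => CatHom.gen k i j .cup hm hn
  | .cap, hm, hn => CatHom.gen k i j .cap hm hn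
  | .R, hm, hn => CatHom.comp k (CatHom.gen k i j .P hm hn)
      (CatHom.tensorBead k i j hn (ρ : A ⊗[k] A))
  | .L, hm, hn => CatHom.comp k (CatHom.tensorBead k i j hm ((ρ⁻¹ : (A ⊗[k] A)ˣ) : A ⊗[k] A))
      (CatHom.gen k i j .P hm hn)

/-- `F` on tangle diagrams: the composition of the images of the elementary pieces. -/
noncomputable def tangF (ρ : (A ⊗[k] A)ˣ) : {m n : ℕ} → TangDiagram m n → CatHom k A m n
  | _, _, .nil n => CatHom.id k n
  | _, _, .cons i j g hm hm' T => CatHom.comp k (tangGenF k ρ i j g hm hm') (tangF ρ T)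

theorem tangF_append (ρ : (A ⊗[k] A)ˣ) : ∀ {m n p : ℕ} (T : TangDiagram m n)
    (U : TangDiagram n p), tangF k ρ (T.append U) = CatHom.comp k (tangF k ρ T) (tangF k ρ U)
  | _, _, _, .nil _, U => (CatHom.id_comp k _).symm
  | _, _, _, .cons _ _ _ _ _ T, U => by
    simp only [Diagram.append, tangF, tangF_append ρ T U, CatHom.assoc]

/-- The bead `a : V ⟶ V`. -/
noncomputable def bead (a : A) : CatHom k A 1 1 := CatHom.beadₗ k 0 0 rfl a

variable (A) in
/-- The curl `G = (1 ⊗ Cup) (P ⊗ 1) (1 ⊗ Cap)`, in diagrammatic order. -/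
noncomputable def curl : CatHom k A 1 1 :=
  CatHom.of k (.cons (m' := 3) 1 0 .cup rfl rfl
    (.cons (m' := 3) 0 1 .P rfl rfl (.cons 1 0 .cap rfl rfl (.nil 1))))

variable (A) in
/-- The opposite curl `G⁻¹ = (Cup ⊗ 1) (1 ⊗ P) (Cap ⊗ 1)`, in diagrammatic order. -/
noncomputable def curlInv : CatHom k A 1 1 :=
  CatHom.of k (.cons (m' := 3) 0 1 .cup rfl rfl
    (.cons (m' := 3) 1 0 .P rfl rfl (.cons 0 1 .cap rfl rfl (.nil 1))))

/-- Powers with natural exponent in `Cat(A)(V, V)`. -/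
noncomputable def CatHom.npow (f : CatHom k A 1 1) : ℕ → CatHom k A 1 1
  | 0 => CatHom.id k 1
  | n + 1 => CatHom.comp k (CatHom.npow f n) f

variable (A) in
/-- Integer powers of the curl `G`. -/
noncomputable def curlPow : ℤ → CatHom k A 1 1
  | .ofNat n => CatHom.npow k (curl k A) n
  | .negSucc n => CatHom.npow k (curlInv k A) (n + 1)

/-- The integer powers of the antipode (which is bijective if `A` is quasitriangular). -/
noncomputable def antipPow : ℤ → A → A
  | .ofNat n => (antip k)^[n]
  | .negSucc n => (Function.invFun (antip k (A := A)))^[n + 1]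

end CatA

/-! ### Travelling along the strand of a diagram -/

/-- What one meets on a strand: a bead, or an extremum, which is a half turn
(`turn 1` if it is clockwise, `turn (-1)` if it is counterclockwise). -/
inductive StrandEvent (A : Type*)
  | bead (a : A) | turn (δ : ℤ)

/-- A traveller on a strand.  `below` are the layers below it (the nearest one first), `above`
the layers above it (the nearest one first), `pos` is the number of strands on its left at this
height, and `up` says whether it travels upwards. -/
structure Traveller (A : Type*) where
  below : List (Layer (CatGen A))
  above : List (Layer (CatGen A))
  pos : ℕ
  up : Bool

/-- One step of the journey, through the next layer, with the events that are met in it.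
At the top and at the bottom end of the diagram the traveller stops. -/
def Traveller.advance {A : Type*} : Traveller A → List (StrandEvent A) × Traveller A
  | ⟨be, [], p, true⟩ => ([], ⟨be, [], p, true⟩)
  | ⟨[], ab, p, false⟩ => ([], ⟨[], ab, p, false⟩)
  | ⟨be, (i, g) :: ab, p, true⟩ =>
    if p < i then ([], ⟨(i, g) :: be, ab, p, true⟩)
    else if i + inn g ≤ p then ([], ⟨(i, g) :: be, ab, p - inn g + out g, true⟩)
    else match g with
      | .bead a => ([.bead a], ⟨(i, .bead a) :: be, ab, p, true⟩)
      | .P => ([], ⟨(i, .P) :: be, ab, if p = i then i + 1 else i, true⟩)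
      | .cap =>
        if p = i then ([.turn 1], ⟨be, (i, .cap) :: ab, i + 1, false⟩)
        else ([.turn (-1)], ⟨be, (i, .cap) :: ab, i, false⟩)
      | .cup => ([], ⟨(i, .cup) :: be, ab, p, true⟩)
  | ⟨(i, g) :: be, ab, p, false⟩ =>
    if p < i then ([], ⟨be, (i, g) :: ab, p, false⟩)
    else if i + out g ≤ p then ([], ⟨be, (i, g) :: ab, p - out g + inn g, false⟩)
    else match g with
      | .bead a => ([.bead a], ⟨be, (i, .bead a) :: ab, p, false⟩)
      | .P => ([], ⟨be, (i, .P) :: ab, if p = i then i + 1 else i, false⟩)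
      | .cup =>
        if p = i then ([.turn (-1)], ⟨(i, .cup) :: be, ab, i + 1, true⟩)
        else ([.turn 1], ⟨(i, .cup) :: be, ab, i, true⟩)
      | .cap => ([], ⟨be, (i, .cap) :: ab, p, false⟩)

/-- The position after `t` steps of the traveller that enters a `1`-`1` diagram at its bottom. -/
def journey {A : Type*} (w : List (Layer (CatGen A))) (t : ℕ) : Traveller A :=
  (fun c => (Traveller.advance c).2)^[t] ⟨[], w, 0, true⟩

/-- The numbers of strands at the successive heights between the layers, for a diagram with `n`
bottom ends. -/
def widths {G : Type*} [Signature G] : ℕ → List (Layer G) → List ℕ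
  | n, [] => [n]
  | n, (_, g) :: w => n :: widths (n - inn g + out g) w

/-- The events met on the strand that enters a `1`-`1` diagram at the bottom, in the order in
which they are met.  (The journey visits every point between the layers at most once, so that
the total number of these points bounds its length.) -/
def strandEvents {A : Type*} (w : List (Layer (CatGen A))) : List (StrandEvent A) :=
  (List.range (widths 1 w).sum).flatMap fun t => (journey w t).advance.1

/-- Twice the Whitney degree of a strand: its number of clockwise half turns minus its number
of counterclockwise half turns. -/
def halfTurns {A : Type*} : List (StrandEvent A) → ℤ
  | [] => 0
  | .bead _ :: l => halfTurns l
  | .turn δ :: l => δ + halfTurns l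

/-- The product of all beads of a strand after they have been slid back to its lower end; a bead
`a` then arrives there as `s^q(a)`, where `q` is the signed number of clockwise half turns that
the strand makes before it reaches this bead.  (The first argument is the number of half turns
made so far.) -/
noncomputable def concentrate (k : Type*) {A : Type*} [CommRing k] [Ring A] [HopfAlgebra k A] :
    ℤ → List (StrandEvent A) → A
  | _, [] => 1
  | q, .bead a :: l => antipPow k q a * concentrate k q l
  | q, .turn δ :: l => concentrate k (q + δ) l

/-! ### The invariants of a knot on a string -/

/-- The immersed plane curve underlying a tangle diagram. -/
def flatten : List (Layer TangGen) → List (Layer (CatGen Empty))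
  | [] => []
  | (i, .cup) :: w => (i, .cup) :: flatten w
  | (i, .cap) :: w => (i, .cap) :: flatten w
  | (i, .R) :: w => (i, .P) :: flatten w
  | (i, .L) :: w => (i, .P) :: flatten w

/-- The `1`-`1` tangle diagram `T` has just one component: the strand that enters at the bottom
passes through every point of the underlying curve. -/
def SingleStranded (T : TangDiagram 1 1) : Prop :=
  ∀ h n p : ℕ, (widths 1 T.layers)[h]? = some n → p < n →
    ∃ t, (journey (flatten T.layers) t).below.length = h ∧ (journey (flatten T.layers) t).pos = p

/-- The Whitney degree `d(T)` of the plane curve underlying a `1`-`1` tangle diagram, normalised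
so that the curl `G` has degree `1`. -/
def whitneyDegree (T : TangDiagram 1 1) : ℤ :=
  halfTurns (strandEvents (flatten T.layers)) / 2

/-- The bead diagrams in the expansion of `F(T)`, where `ρ = ∑ x, e x ⊗ e' x`: every `R` is
replaced by a flat crossing with the beads `e x`, `e' x` above it, and every `L` by a flat crossing
with the beads `s (e x)`, `e' x` below it. -/
def resolutions (k : Type*) {A ι : Type*} [CommRing k] [Ring A] [HopfAlgebra k A] [Fintype ι]
    (e e' : ι → A) : List (Layer TangGen) → Multiset (List (Layer (CatGen A)))
  | [] => {[]}
  | (i, .cup) :: w => (resolutions k e e' w).map fun v => (i, .cup) :: v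
  | (i, .cap) :: w => (resolutions k e e' w).map fun v => (i, .cap) :: v
  | (i, .R) :: w => (Finset.univ : Finset ι).val.bind fun x => (resolutions k e e' w).map fun v =>
      (i, .P) :: (i, .bead (e x)) :: (i + 1, .bead (e' x)) :: v
  | (i, .L) :: w => (Finset.univ : Finset ι).val.bind fun x => (resolutions k e e' w).map fun v =>
      (i, .bead (antip k (e x))) :: (i + 1, .bead (e' x)) :: (i, .P) :: v

/-- `w[T]`: all the algebra in `F(T)`, concentrated in the lower part of the tangle. -/
noncomputable def concentratedElement (k : Type*) {A ι : Type*} [CommRing k] [Ring A]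
    [HopfAlgebra k A] [Fintype ι] (e e' : ι → A) (T : TangDiagram 1 1) : A :=
  ((resolutions k e e' T.layers).map fun v => concentrate k 0 (strandEvents v)).sum

end KnotOnString

set_option linter.unusedSimpArgs false
set_option linter.unreachableTactic false
set_option linter.unusedTactic false
set_option linter.unnecessarySeqFocus false

/-! Expanding `ρ` at every crossing turns `F(T)` into a finite sum of immersed curves with beads,
the resolutions of `T` (`tangF_eq_resolutionSum`). The rest is a study of bead diagrams up to the
local moves, handled as lists of layers (`Word`).

Invariance of `F`. A functional on words that is linear in every bead factors through `A ⊗ A` or `A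
⊗ A ⊗ A`, so identities in these algebras become identities between sums of resolutions. After
sliding the beads together, the second Reidemeister move amounts to `ρ⁻¹ = (s ⊗ 1) ρ`, the third to
the Yang-Baxter equation, two of the switchbacks to `(s ⊗ s) ρ = ρ`, and the other two hold term by
term (`TangMove.resolutionSum_eq`).

Normal form. Maxima are eliminated from bottom to top (`Word.reduced_mk`). Both legs of a maximum
are pulled to the far left, and the maximum sinks through the word below it until it cancels against
a minimum, possibly leaving labels (beads and curls), or closes up to a circle. A word without
maxima and with one strand at the top has no minima and no crossings, so it is a column of labels. A
bead slides down through `G` at the cost of `s ^ 2`, so the column becomes a bead followed by a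
power of `G`. Some of these slides need preimages under `s`; the antipode is bijective because its
square is conjugation by the Drinfeld element (`IsQuasitriangular.bijective_antipode`).

Identification of the normal form. The bead and the exponent are not tracked through the
elimination. A traveller on the strand records beads and half turns. The number of half turns and
the concentrated product do not change under a move, because both sides of a move look alike to a
traveller outside (`CatMove.simulates`, `Simulates.strandEvents`). The parity of the half turns made
so far is the direction of travel, and it decides whether `s ^ q` preserves or reverses products. On
a bead `a` followed by `G ^ n` the two invariants are `2 * n` and `a`.

Single strands. Having a single strand is a global property. It is replaced by `Rigid`: a coloring
that is constant along strands and plain at both ends is plain. Rigidity can be compared block by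
block, fails for a word with a circle, and is equivalent to visiting every point (`Visits.rigid`,
`Rigid.visits`).

Uniqueness. In a rigid diagram every bead is met exactly once, so the concentrated product is linear
in it. Extended by zero to the other diagrams, the product descends to a linear map on the
endomorphisms of `V` in `Cat(A)` (`CatHom.element`) that sends a bead `a` followed by `G ^ n` to
`a`. Hence `w[T]` is a function of `F(T)`, and so invariant. The invariance of `d(T)` is seen on the
underlying flat curve. -/

namespace KnotOnString

open Signature

/-! ### Words of layers up to the local moves -/

section Words

/-- The number of strands above a list of layers with `n` strands below it. -/
def wout {G : Type*} [Signature G] : ℕ → List (Layer G) → ℕ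
  | n, [] => n
  | n, (_, g) :: w => wout (n - inn g + out g) w

/-- A list of layers can be placed on top of `n` strands. -/
def Fits {G : Type*} [Signature G] : ℕ → List (Layer G) → Prop
  | _, [] => True
  | n, (i, g) :: w => i + inn g ≤ n ∧ Fits (n - inn g + out g) w

theorem wout_append {G : Type*} [Signature G] (n : ℕ) (u v : List (Layer G)) :
    wout n (u ++ v) = wout (wout n u) v := by
  induction u generalizing n with
  | nil => rfl
  | cons l u ih => exact ih _

theorem fits_append {G : Type*} [Signature G] (n : ℕ) (u v : List (Layer G)) :
    Fits n (u ++ v) ↔ Fits n u ∧ Fits (wout n u) v := by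
  induction u generalizing n with
  | nil => simp [Fits, wout]
  | cons l u ih => simp only [List.cons_append, Fits, wout, ih, and_assoc]

theorem Diagram.fits_layers {G : Type*} [Signature G] : ∀ {m n : ℕ} (D : Diagram G m n),
    Fits m D.layers ∧ wout m D.layers = n
  | _, _, .nil _ => ⟨trivial, rfl⟩
  | _, _, .cons i j g hm hm' D => by
    have h := D.fits_layers
    subst hm hm'
    have e : i + inn g + j - inn g + out g = i + out g + j := by omega
    simp only [layers, Fits, wout, e]
    exact ⟨⟨by omega, h.1⟩, h.2⟩

/-- The number of strands to the right of a layer is forced by the total width, so a list that fits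
determines a diagram. Together with `Diagram.layers_injective` this permits computing with plain
lists instead of the dependent type. -/
theorem Diagram.exists_layers {G : Type*} [Signature G] : ∀ (w : List (Layer G)) (m n : ℕ),
    Fits m w → wout m w = n → ∃ D : Diagram G m n, D.layers = w
  | [], m, n, _, h => by subst h; exact ⟨.nil m, rfl⟩
  | (i, g) :: w, m, n, hf, h => by
    obtain ⟨D, hD⟩ := Diagram.exists_layers w _ n hf.2 h
    have h1 : i + inn g ≤ m := hf.1
    exact ⟨.cons i (m - inn g - i) g (by omega) (by omega) D, by rw [layers, hD]⟩

theorem Diagram.layers_injective {G : Type*} [Signature G] : ∀ {m n : ℕ} (D E : Diagram G m n),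
    D.layers = E.layers → D = E
  | _, _, .nil _, E, h => by
    cases E with
    | nil => rfl
    | cons => simp [layers] at h
  | _, _, .cons i j g hm hm' D, E, h => by
    cases E with
    | nil => simp [layers] at h
    | cons i' j' g' hm₁ hm₁' E =>
      simp only [layers, List.cons.injEq, Prod.mk.injEq] at h
      obtain ⟨⟨rfl, rfl⟩, h⟩ := h
      obtain rfl : j = j' := by omega
      cases hm'.trans hm₁'.symm
      rw [Diagram.layers_injective D E h]

section

variable {A : Type*}

@[simp] theorem inn_bead (a : A) : inn (CatGen.bead a) = 1 := rfl
@[simp] theorem inn_cup : inn (CatGen.cup : CatGen A) = 0 := rfl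
@[simp] theorem inn_cap : inn (CatGen.cap : CatGen A) = 2 := rfl
@[simp] theorem inn_P : inn (CatGen.P : CatGen A) = 2 := rfl
@[simp] theorem out_bead (a : A) : out (CatGen.bead a) = 1 := rfl
@[simp] theorem out_cup : out (CatGen.cup : CatGen A) = 2 := rfl
@[simp] theorem out_cap : out (CatGen.cap : CatGen A) = 0 := rfl
@[simp] theorem out_P : out (CatGen.P : CatGen A) = 2 := rfl

end

variable (k : Type*) {A : Type*} [CommRing k] [Ring A] [HopfAlgebra k A]

/-- Only this direction holds: a right hand side such as `[]` fits where the left hand side does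
not. This is why `WordStep` demands that the left hand side fits; width and fitting are then
invariants of words. -/
theorem CatMove.fits {x y : List (Layer (CatGen A))} (h : CatMove k x y) {n : ℕ}
    (hx : Fits n x) : Fits n y ∧ wout n y = wout n x := by
  cases h with
  | exchange i j g h =>
    simp only [Fits, wout, and_true] at hx ⊢
    generalize inn g = a at *
    generalize out g = b at *
    generalize inn h = c at *
    generalize out h = d at *
    omega
  | _ =>
    simp only [Fits, wout, inn_bead, inn_cup, inn_cap, inn_P, out_bead, out_cup, out_cap, out_P,
      and_true, true_and] at hx ⊢
    omega

/-- One application of a local move, at a height where its left hand side fits. -/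
def WordStep (m : ℕ) (x y : List (Layer (CatGen A))) : Prop :=
  ∃ u v a b : List (Layer (CatGen A)), CatMove k a b ∧ Fits (wout m u) a ∧
    x = u ++ a ++ v ∧ y = u ++ b ++ v

variable {k} in
theorem WordStep.wout_eq {m : ℕ} {x y : List (Layer (CatGen A))} (h : WordStep k m x y) :
    wout m x = wout m y := by
  obtain ⟨u, v, a, b, hm, hf, rfl, rfl⟩ := h
  simp only [wout_append, (hm.fits k hf).2]

variable {k} in
theorem WordStep.fits_iff {m : ℕ} {x y : List (Layer (CatGen A))} (h : WordStep k m x y) :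
    Fits m x ↔ Fits m y := by
  obtain ⟨u, v, a, b, hm, hf, rfl, rfl⟩ := h
  simp only [fits_append, wout_append, (hm.fits k hf).2, hf, (hm.fits k hf).1]

variable {k} in
theorem WordStep.append {m : ℕ} {x y : List (Layer (CatGen A))} (h : WordStep k m x y)
    (w : List (Layer (CatGen A))) : WordStep k m (x ++ w) (y ++ w) := by
  obtain ⟨u, v, a, b, hm, hf, rfl, rfl⟩ := h
  exact ⟨u, v ++ w, a, b, hm, hf, by simp, by simp⟩

variable (A) in
/-- Lists of layers on `m` strands, up to the local moves of `Cat(A)`. -/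
def Word (m : ℕ) := Quot (WordStep (A := A) k m)

namespace Word

variable {m : ℕ}

/-- The class of a list of layers. -/
def mk (m : ℕ) (w : List (Layer (CatGen A))) : Word k A m := Quot.mk _ w

variable {k}

/-- The number of strands at the top. -/
def wd (x : Word k A m) : ℕ := Quot.lift (wout m) (fun _ _ h => h.wout_eq) x

/-- Stacking a list of layers on top of a word. -/
def app (x : Word k A m) (w : List (Layer (CatGen A))) : Word k A m :=
  Quot.map (· ++ w) (fun _ _ h => h.append w) x

theorem app_app (x : Word k A m) (u v : List (Layer (CatGen A))) :
    (x.app u).app v = x.app (u ++ v) := by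
  induction x using Quot.ind with
  | mk w => exact congrArg (Quot.mk _) (List.append_assoc w u v)

theorem app_nil (x : Word k A m) : x.app [] = x := by
  induction x using Quot.ind with
  | mk w => exact congrArg (Quot.mk _) (List.append_nil w)

theorem mk_app (u v : List (Layer (CatGen A))) : (mk k m u).app v = mk k m (u ++ v) := rfl

theorem wd_app (x : Word k A m) (w : List (Layer (CatGen A))) : (x.app w).wd = wout x.wd w := by
  induction x using Quot.ind with
  | mk u => exact wout_append m u w

theorem app_eq_of_move (x : Word k A m) {a b : List (Layer (CatGen A))} (h : CatMove k a b)
    (hf : Fits x.wd a) : x.app a = x.app b := by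
  induction x using Quot.ind with
  | mk u => exact Quot.sound ⟨u, [], a, b, h, hf, by simp, by simp⟩

/-- A minimum whose left leg is in position `i`. -/
def cup (x : Word k A m) (i : ℕ) : Word k A m := x.app [(i, .cup)]
/-- A maximum whose left leg is in position `i`. -/
def cap (x : Word k A m) (i : ℕ) : Word k A m := x.app [(i, .cap)]
/-- A crossing of the strands in positions `i` and `i + 1`. -/
def P (x : Word k A m) (i : ℕ) : Word k A m := x.app [(i, .P)]
/-- A bead on the strand in position `i`. -/
def bead (x : Word k A m) (i : ℕ) (a : A) : Word k A m := x.app [(i, .bead a)]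

variable (x : Word k A m)

@[simp] theorem wd_cup (i : ℕ) : (x.cup i).wd = x.wd + 2 := wd_app x _
@[simp] theorem wd_cap (i : ℕ) : (x.cap i).wd = x.wd - 2 := wd_app x _
@[simp] theorem wd_P (i : ℕ) : (x.P i).wd = x.wd - 2 + 2 := wd_app x _
@[simp] theorem wd_bead (i : ℕ) (a : A) : (x.bead i a).wd = x.wd - 1 + 1 := wd_app x _

variable {x}

/-- The gap between the two pieces is `j' - (i + inn g)`. The positions of the right piece before
and after are independent variables, so that each special case below has a clean form. -/
theorem exchange_app {i j j' : ℕ} (g h : CatGen A) (hj : j = i + out g + (j' - (i + inn g)))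
    (hi : i + inn g ≤ j') (hw : j' + inn h ≤ x.wd) :
    (x.app [(i, g)]).app [(j, h)] = (x.app [(j', h)]).app [(i, g)] := by
  have e : i + inn g + (j' - (i + inn g)) = j' := by omega
  have := x.app_eq_of_move (.exchange (k := k) i (j' - (i + inn g)) g h)
    (by simp only [Fits, and_true]; omega)
  rw [app_app, app_app, List.singleton_append, List.singleton_append, hj]
  rw [e] at this
  exact this

/-! Distant pieces exchange their heights. The first name is the left piece. -/

theorem P_P_comm {i j : ℕ} (h : i + 2 ≤ j) (hw : j + 2 ≤ x.wd) :
    (x.P i).P j = (x.P j).P i :=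
  exchange_app .P .P (by simp; omega) h hw

theorem P_cup {i j : ℕ} (h : i + 2 ≤ j) (hw : j ≤ x.wd) :
    (x.P i).cup j = (x.cup j).P i :=
  exchange_app .P .cup (by simp; omega) h hw

theorem P_cap {i j : ℕ} (h : i + 2 ≤ j) (hw : j + 2 ≤ x.wd) :
    (x.P i).cap j = (x.cap j).P i :=
  exchange_app .P .cap (by simp; omega) h hw

theorem cup_P {i j : ℕ} (h : i ≤ j) (hw : j + 2 ≤ x.wd) :
    (x.cup i).P (j + 2) = (x.P j).cup i :=
  exchange_app .cup .P (by simp; omega) h hw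

theorem cap_P {i j : ℕ} (h : i ≤ j) (hw : j + 4 ≤ x.wd) :
    (x.cap i).P j = (x.P (j + 2)).cap i :=
  exchange_app .cap .P (by simp; omega) (by simpa) hw

theorem cup_cup {i j : ℕ} (h : i ≤ j) (hw : j ≤ x.wd) :
    (x.cup i).cup (j + 2) = (x.cup j).cup i :=
  exchange_app .cup .cup (by simp; omega) h hw

theorem cup_cap {i j : ℕ} (h : i ≤ j) (hw : j + 2 ≤ x.wd) :
    (x.cup i).cap (j + 2) = (x.cap j).cup i :=
  exchange_app .cup .cap (by simp; omega) h hw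

theorem cap_cup {i j : ℕ} (h : i ≤ j) (hw : j + 2 ≤ x.wd) :
    (x.cap i).cup j = (x.cup (j + 2)).cap i :=
  exchange_app .cap .cup (by simp; omega) (by simpa) hw

theorem cap_cap {i j : ℕ} (h : i ≤ j) (hw : j + 4 ≤ x.wd) :
    (x.cap i).cap j = (x.cap (j + 2)).cap i :=
  exchange_app .cap .cap (by simp; omega) (by simpa) hw

theorem bead_bead_comm {i j : ℕ} (h : i < j) (hw : j < x.wd) (a b : A) :
    (x.bead i a).bead j b = (x.bead j b).bead i a :=
  exchange_app (.bead a) (.bead b) (by simp; omega) h hw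

theorem bead_P {i j : ℕ} (h : i < j) (hw : j + 2 ≤ x.wd) (a : A) :
    (x.bead i a).P j = (x.P j).bead i a :=
  exchange_app (.bead a) .P (by simp; omega) h hw

theorem bead_cup {i j : ℕ} (h : i < j) (hw : j ≤ x.wd) (a : A) :
    (x.bead i a).cup j = (x.cup j).bead i a :=
  exchange_app (.bead a) .cup (by simp; omega) h hw

theorem bead_cap {i j : ℕ} (h : i < j) (hw : j + 2 ≤ x.wd) (a : A) :
    (x.bead i a).cap j = (x.cap j).bead i a :=
  exchange_app (.bead a) .cap (by simp; omega) h hw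

theorem P_bead {i j : ℕ} (h : i + 2 ≤ j) (hw : j < x.wd) (a : A) :
    (x.P i).bead j a = (x.bead j a).P i :=
  exchange_app .P (.bead a) (by simp; omega) h hw

theorem cup_bead_right {i j : ℕ} (h : i ≤ j) (hw : j < x.wd) (a : A) :
    (x.cup i).bead (j + 2) a = (x.bead j a).cup i :=
  exchange_app .cup (.bead a) (by simp; omega) h hw

theorem cap_bead_right {i j : ℕ} (h : i ≤ j) (hw : j + 2 < x.wd) (a : A) :
    (x.cap i).bead j a = (x.bead (j + 2) a).cap i :=
  exchange_app .cap (.bead a) (by simp; omega) (by simpa) hw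

/-! The other moves. -/

theorem bead_mul {i : ℕ} (hw : i < x.wd) (a b : A) :
    (x.bead i a).bead i b = x.bead i (a * b) := by
  rw [bead, bead, app_app, List.cons_append, List.nil_append]
  exact x.app_eq_of_move (.bead_mul i a b) (by simp [Fits]; omega)

theorem bead_one {i : ℕ} (hw : i < x.wd) : x.bead i 1 = x := by
  conv_rhs => rw [← x.app_nil]
  exact x.app_eq_of_move (.bead_one i) (by simp [Fits]; omega)

theorem cup_bead {i : ℕ} (hw : i ≤ x.wd) (a : A) :
    (x.cup i).bead i a = (x.cup i).bead (i + 1) (antip k a) := by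
  simp only [bead, cup, app_app, List.cons_append, List.nil_append]
  exact x.app_eq_of_move (.cup_bead i a) (by simp [Fits]; omega)

theorem cap_bead {i : ℕ} (hw : i + 2 ≤ x.wd) (a : A) :
    (x.bead (i + 1) a).cap i = (x.bead i (antip k a)).cap i := by
  simp only [bead, cap, app_app, List.cons_append, List.nil_append]
  exact x.app_eq_of_move (.cap_bead i a) (by simp [Fits]; omega)

theorem zigzag_left {i : ℕ} (hw : i < x.wd) : (x.cup i).cap (i + 1) = x := by
  conv_rhs => rw [← x.app_nil]
  simp only [cup, cap, app_app, List.cons_append, List.nil_append]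
  exact x.app_eq_of_move (.zigzag_left i) (by simp [Fits]; omega)

theorem zigzag_right {i : ℕ} (hw : i < x.wd) : (x.cup (i + 1)).cap i = x := by
  conv_rhs => rw [← x.app_nil]
  simp only [cup, cap, app_app, List.cons_append, List.nil_append]
  exact x.app_eq_of_move (.zigzag_right i) (by simp [Fits]; omega)

theorem bead_bead_P {i : ℕ} (hw : i + 2 ≤ x.wd) (a b : A) :
    ((x.bead i a).bead (i + 1) b).P i = ((x.P i).bead i b).bead (i + 1) a := by
  simp only [bead, P, app_app, List.cons_append, List.nil_append]
  exact x.app_eq_of_move (.P_bead i a b) (by simp [Fits]; omega)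

theorem P_P {i : ℕ} (hw : i + 2 ≤ x.wd) : (x.P i).P i = x := by
  conv_rhs => rw [← x.app_nil]
  simp only [P, app_app, List.cons_append, List.nil_append]
  exact x.app_eq_of_move (.P_sq i) (by simp [Fits]; omega)

theorem braid {i : ℕ} (hw : i + 3 ≤ x.wd) :
    ((x.P i).P (i + 1)).P i = ((x.P (i + 1)).P i).P (i + 1) := by
  simp only [P, app_app, List.cons_append, List.nil_append]
  exact x.app_eq_of_move (.P_braid i) (by simp [Fits]; omega)

theorem cap_switchback {i : ℕ} (hw : i + 3 ≤ x.wd) :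
    (x.P i).cap (i + 1) = (x.P (i + 1)).cap i := by
  simp only [P, cap, app_app, List.cons_append, List.nil_append]
  exact x.app_eq_of_move (.cap_switchback i) (by simp [Fits]; omega)

theorem cup_switchback {i : ℕ} (hw : i < x.wd) :
    (x.cup (i + 1)).P i = (x.cup i).P (i + 1) := by
  simp only [P, cup, app_app, List.cons_append, List.nil_append]
  exact x.app_eq_of_move (.cup_switchback i) (by simp [Fits]; omega)

/-- The relation for `P` moves two beads at once; a unit bead on the other strand isolates one of
them. -/
theorem bead_P_self {i : ℕ} (hw : i + 2 ≤ x.wd) (a : A) :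
    (x.bead i a).P i = (x.P i).bead (i + 1) a := by
  have h := bead_bead_P hw a (1 : A)
  rwa [bead_one (by simp; omega), bead_one (by simp; omega)] at h

theorem bead_succ_P {i : ℕ} (hw : i + 2 ≤ x.wd) (a : A) :
    (x.bead (i + 1) a).P i = (x.P i).bead i a := by
  have h := bead_bead_P hw (1 : A) a
  rwa [bead_one (by omega), bead_one (by simp; omega)] at h

end Word

end Words

/-! ### Labels on a strand: beads and curls -/

section Labels

/-- What may be put on a single strand: a bead, the curl `G`, or the curl `G⁻¹`. -/
inductive Lab (A : Type*)
  | bead (a : A) | pos | neg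

namespace Word

variable {k : Type*} {A : Type*} [CommRing k] [Ring A] [HopfAlgebra k A] {m : ℕ}

/-- Put a label on the strand in position `i`. -/
def lab (x : Word k A m) (i : ℕ) : Lab A → Word k A m
  | .bead a => x.bead i a
  | .pos => ((x.cup (i + 1)).P i).cap (i + 1)
  | .neg => ((x.cup i).P (i + 1)).cap i

variable {x : Word k A m}

theorem wd_lab {i : ℕ} (h : 0 < x.wd) (o : Lab A) : (x.lab i o).wd = x.wd := by
  cases o <;> simp [lab]; omega

/-- The Whitney trick. The extrema of the two curls are exchanged in height until a minimum of one
cancels against a maximum. -/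
theorem lab_pos_neg {i : ℕ} (h : i < x.wd) : (x.lab i .pos).lab i .neg = x := by
  simp only [lab]
  rw [← cup_cap (i := i) (j := i + 1) (by omega) (by simp; omega),
    ← cup_P (i := i) (j := i) (by omega) (by simp; omega),
    ← P_cap (i := i + 1) (j := i + 1 + 2) (by omega) (by simp; omega),
    ← cap_cap (i := i) (j := i + 1) (by omega) (by simp; omega),
    ← cap_switchback (by simp; omega),
    ← P_P_comm (i := i) (j := i + 2) (by omega) (by simp; omega),
    ← cap_switchback (i := i + 1) (by simp; omega),
    ← cup_cup (i := i) (j := i + 1) (by omega) (by simp; omega),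
    ← P_cup (i := i) (j := i + 1 + 2) (by omega) (by simp; omega),
    ← P_cup (i := i + 1) (j := i + 1 + 2) (by omega) (by simp; omega),
    zigzag_right (i := i + 2) (by simp; omega)]
  -- What remains is a minimum at `i`, crossings at `i` and `i + 1`, and a maximum at `i + 1`.
  -- Writing the minimum with two extra crossings makes the braid relation applicable, after which
  -- all crossings cancel in pairs.
  have e : x.cup i = ((x.cup (i + 1)).P i).P (i + 1) := by
    rw [cup_switchback h, P_P (by simp; omega)]
  rw [e, ← braid (by simp; omega), P_P (by simp; omega), cap_switchback (by simp; omega),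
    P_P (by simp; omega), zigzag_right h]

theorem lab_neg_pos {i : ℕ} (h : i < x.wd) : (x.lab i .neg).lab i .pos = x := by
  simp only [lab]
  rw [cap_cup (i := i) (j := i + 1) (by omega) (by simp; omega),
    P_cup (i := i + 1) (j := i + 1 + 2) (by omega) (by simp; omega),
    cap_P (i := i) (j := i) (by omega) (by simp; omega),
    cap_cap (i := i) (j := i + 1) (by omega) (by simp; omega),
    cap_switchback (i := i + 2) (by simp; omega),
    P_P_comm (i := i + 1) (j := i + 3) (by omega) (by simp; omega),
    cap_switchback (i := i + 1) (by simp; omega),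
    cup_cup (i := i) (j := i + 1) (by omega) (by simp; omega),
    cup_P (i := i) (j := i + 1) (by omega) (by simp; omega),
    cup_P (i := i) (j := i) (by omega) (by simp; omega),
    zigzag_left (i := i) (by simp; omega)]
  have e : x.cup (i + 1) = ((x.cup i).P (i + 1)).P i := by
    rw [← cup_switchback h, P_P (by simp; omega)]
  rw [e, braid (by simp; omega), P_P (by simp; omega), ← cap_switchback (by simp; omega),
    P_P (by simp; omega), zigzag_left h]

/-! Labels and distant pieces. -/

theorem lab_P {i j : ℕ} (h : i < j) (hw : j + 2 ≤ x.wd) (o : Lab A) :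
    (x.lab i o).P j = (x.P j).lab i o := by
  cases o with
  | bead a => exact bead_P h hw a
  | pos =>
    simp only [lab]
    rw [cap_P (by omega) (by simp; omega), P_P_comm (by omega) (by simp; omega),
      cup_P (by omega) (by omega)]
  | neg =>
    simp only [lab]
    rw [cap_P (by omega) (by simp; omega), P_P_comm (by omega) (by simp; omega),
      cup_P (by omega) (by omega)]

theorem P_lab {i j : ℕ} (h : i + 2 ≤ j) (hw : j < x.wd) (o : Lab A) :
    (x.P i).lab j o = (x.lab j o).P i := by
  cases o with
  | bead a => exact P_bead h hw a
  | pos =>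
    simp only [lab]
    rw [P_cup (by omega) (by simp; omega), P_P_comm (by omega) (by simp; omega),
      P_cap (by omega) (by simp; omega)]
  | neg =>
    simp only [lab]
    rw [P_cup (by omega) (by omega), P_P_comm (by omega) (by simp; omega),
      P_cap (by omega) (by simp; omega)]

theorem lab_cup {i j : ℕ} (h : i < j) (hw : j ≤ x.wd) (o : Lab A) :
    (x.lab i o).cup j = (x.cup j).lab i o := by
  cases o with
  | bead a => exact bead_cup h hw a
  | pos =>
    simp only [lab]
    rw [cap_cup (by omega) (by simp; omega), P_cup (by omega) (by simp; omega),
      cup_cup (by omega) (by omega)]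
  | neg =>
    simp only [lab]
    rw [cap_cup (by omega) (by simp; omega), P_cup (by omega) (by simp; omega),
      cup_cup (by omega) (by omega)]

theorem cup_lab {i j : ℕ} (h : i ≤ j) (hw : j < x.wd) (o : Lab A) :
    (x.cup i).lab (j + 2) o = (x.lab j o).cup i := by
  cases o with
  | bead a => exact cup_bead_right h hw a
  | pos =>
    simp only [lab]
    rw [show j + 2 + 1 = j + 1 + 2 from rfl, cup_cup (by omega) (by omega),
      cup_P (by omega) (by simp; omega), cup_cap (by omega) (by simp; omega)]
  | neg =>
    simp only [lab]
    rw [show j + 2 + 1 = j + 1 + 2 from rfl, cup_cup (by omega) (by omega),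
      cup_P (by omega) (by simp; omega), cup_cap (by omega) (by simp; omega)]

theorem lab_cap {i j : ℕ} (h : i < j) (hw : j + 2 ≤ x.wd) (o : Lab A) :
    (x.lab i o).cap j = (x.cap j).lab i o := by
  cases o with
  | bead a => exact bead_cap h hw a
  | pos =>
    simp only [lab]
    rw [cap_cap (by omega) (by simp; omega), P_cap (by omega) (by simp; omega),
      cup_cap (by omega) (by omega)]
  | neg =>
    simp only [lab]
    rw [cap_cap (by omega) (by simp; omega), P_cap (by omega) (by simp; omega),
      cup_cap (by omega) (by omega)]

theorem cap_lab {i j : ℕ} (h : i ≤ j) (hw : j + 2 < x.wd) (o : Lab A) :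
    (x.cap i).lab j o = (x.lab (j + 2) o).cap i := by
  cases o with
  | bead a => exact cap_bead_right h hw a
  | pos =>
    simp only [lab]
    rw [cap_cup (by omega) (by omega), cap_P (by omega) (by simp; omega),
      cap_cap (by omega) (by simp; omega), show j + 2 + 1 = j + 1 + 2 from rfl]
  | neg =>
    simp only [lab]
    rw [cap_cup (by omega) (by omega), cap_P (by omega) (by simp; omega),
      cap_cap (by omega) (by simp; omega), show j + 2 + 1 = j + 1 + 2 from rfl]

theorem lab_lab_comm {i j : ℕ} (h : i < j) (hw : j < x.wd) (o o' : Lab A) :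
    (x.lab i o).lab j o' = (x.lab j o').lab i o := by
  cases o' with
  | bead a =>
    cases o with
    | bead b => exact bead_bead_comm h hw b a
    | pos =>
      simp only [lab]
      rw [cap_bead_right (by omega) (by simp; omega), P_bead (by omega) (by simp; omega),
        cup_bead_right (by omega) (by omega)]
    | neg =>
      simp only [lab]
      rw [cap_bead_right (by omega) (by simp; omega), P_bead (by omega) (by simp; omega),
        cup_bead_right (by omega) (by omega)]
  | pos =>
    change (((x.lab i o).cup (j + 1)).P j).cap (j + 1) = (((x.cup (j + 1)).P j).cap (j + 1)).lab i o
    rw [lab_cup (by omega) (by omega), lab_P h (by simp; omega),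
      lab_cap (by omega) (by simp; omega)]
  | neg =>
    change (((x.lab i o).cup j).P (j + 1)).cap j = (((x.cup j).P (j + 1)).cap j).lab i o
    rw [lab_cup (by omega) (by omega), lab_P (by omega) (by simp; omega),
      lab_cap (by omega) (by simp; omega)]

/-! Labels pass through crossings and from one leg of a maximum to the other one. -/

/-- A crossing above a maximum is brought below it by first letting one of its strands pass across
both legs. -/
theorem cap_P_below {i : ℕ} (h : i + 4 ≤ x.wd) :
    (x.cap (i + 1)).P i = (((x.P (i + 2)).P (i + 1)).P i).cap (i + 2) := by
  rw [P_cap (by omega) (by simp; omega), cap_switchback (i := i + 1) (by simp; omega),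
    P_P (by omega)]

/-- For `G` the crossing strand is swept over the whole curl, by one braid relation and switchbacks
at its two extrema. -/
theorem lab_P_self {i : ℕ} (h : i + 2 ≤ x.wd) (o : Lab A) :
    (x.lab i o).P i = (x.P i).lab (i + 1) o := by
  have key : ∀ y : Word k A m, i + 2 ≤ y.wd →
      (y.lab i .pos).P i = (y.P i).lab (i + 1) .pos := by
    intro y hy
    simp only [lab]
    rw [cap_P_below (by simp; omega), P_P_comm (i := i) (j := i + 2) (by omega) (by simp; omega),
      braid (by simp; omega), ← cup_switchback (i := i + 1) (by omega), P_P (by simp; omega),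
      ← P_cup (i := i) (j := i + 2) (by omega) (by omega)]
  cases o with
  | bead a => exact bead_P_self h a
  | pos => exact key x h
  | neg =>
    -- No separate diagram is needed for `G⁻¹`: what commutes with an invertible morphism commutes
    -- with its inverse.
    have h1 := key (x.lab i .neg) (by rw [wd_lab (by omega)]; omega)
    rw [lab_neg_pos (by omega)] at h1
    rw [h1, lab_pos_neg (by rw [wd_P, wd_lab (by omega)]; omega)]

theorem lab_succ_P {i : ℕ} (h : i + 2 ≤ x.wd) (o : Lab A) :
    (x.lab (i + 1) o).P i = (x.P i).lab i o := by
  have h1 := lab_P_self (x := x.P i) (i := i) (by simp; omega) o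
  rw [P_P h] at h1
  rw [← h1, P_P (by rw [wd_lab (by simp)]; simp; omega)]

/-- A kink next to a maximum is a crossing of its two legs. Comparing the kinks on the left and on
the right leg shows that `G` on one leg is `G⁻¹` on the other, the analogue for curls of sliding a
bead over a maximum. -/
theorem cap_flip {i : ℕ} (h : i + 2 ≤ x.wd) : (x.lab i .neg).cap i = (x.P i).cap i := by
  simp only [lab]
  rw [cap_cap (i := i) (j := i) (by omega) (by simp; omega),
    cap_switchback (i := i + 1) (by simp; omega), cup_P (i := i) (j := i) (by omega) (by omega),
    zigzag_left (by simp; omega)]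

theorem cap_flip_right {i : ℕ} (h : i + 2 ≤ x.wd) :
    (x.lab (i + 1) .pos).cap i = (x.P i).cap i := by
  simp only [lab]
  rw [← cap_cap (i := i) (j := i) (by omega) (by simp; omega),
    ← cap_switchback (i := i) (by simp; omega), ← P_cup (i := i) (by omega) (by omega),
    zigzag_right (by simp; omega)]

theorem cup_flip {i : ℕ} (h : i ≤ x.wd) : (x.cup i).P i = (x.cup i).lab (i + 1) .pos := by
  simp only [lab]
  rw [cup_cup (i := i) (j := i) (by omega) (by omega), ← cup_switchback (by simp; omega),
    P_cap (by omega) (by simp; omega), zigzag_left (by simp; omega)]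

/-- By the two forms of the kink, curls `G` on both legs cancel; this is applied after adding `G⁻¹`
to the right leg. -/
theorem lab_neg_succ_cap {i : ℕ} (h : i + 2 ≤ x.wd) :
    (x.lab (i + 1) .neg).cap i = (x.lab i .pos).cap i := by
  have h1 : ∀ y : Word k A m, i + 2 ≤ y.wd → ((y.lab i .pos).lab (i + 1) .pos).cap i = y.cap i := by
    intro y hy
    rw [cap_flip_right (by rw [wd_lab (by omega)]; omega), ← cap_flip
      (by rw [wd_lab (by omega)]; omega), lab_pos_neg (by omega)]
  rw [← h1 (x.lab (i + 1) .neg) (by rw [wd_lab (by omega)]; omega), ← lab_lab_comm (x := x) (i := i) (j := i + 1) (by omega) (by omega),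
    lab_neg_pos (by rw [wd_lab (by omega)]; omega)]

end Word

end Labels

/-! ### Eliminating the maxima of a word -/

section Reduction

namespace Word

variable {k : Type*} {A : Type*} [CommRing k] [Ring A] [HopfAlgebra k A] {m : ℕ}

/-- Several labels on the strand in position `i`, the first one at the bottom. -/
def labs (x : Word k A m) (i : ℕ) (l : List (Lab A)) : Word k A m :=
  l.foldl (fun y o => y.lab i o) x

/-- The strand in position `t + r` is moved to position `t`. -/
def pullTo (t : ℕ) (x : Word k A m) : ℕ → Word k A m
  | 0 => x
  | r + 1 => pullTo t (x.P (t + r)) r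

variable {x : Word k A m}

theorem labs_cons (x : Word k A m) (i : ℕ) (o : Lab A) (l : List (Lab A)) :
    x.labs i (o :: l) = (x.lab i o).labs i l := rfl

theorem wd_labs {i : ℕ} (h : 0 < x.wd) (l : List (Lab A)) : (x.labs i l).wd = x.wd := by
  induction l generalizing x with
  | nil => rfl
  | cons o l ih => rw [labs_cons, ih (by rwa [wd_lab h]), wd_lab h]

theorem wd_pullTo {t r : ℕ} (h : t + r < x.wd) : (pullTo t x r).wd = x.wd := by
  induction r generalizing x with
  | zero => rfl
  | succ r ih => rw [pullTo, ih (by simp; omega)]; simp; omega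

theorem labs_P {i j : ℕ} (h : i < j) (hw : j + 2 ≤ x.wd) (l : List (Lab A)) :
    (x.labs i l).P j = (x.P j).labs i l := by
  induction l generalizing x with
  | nil => rfl
  | cons o l ih => rw [labs_cons, labs_cons, ih (by rwa [wd_lab (by omega)]), lab_P h hw]

theorem labs_cup {i j : ℕ} (h : i < j) (hw : j ≤ x.wd) (l : List (Lab A)) :
    (x.labs i l).cup j = (x.cup j).labs i l := by
  induction l generalizing x with
  | nil => rfl
  | cons o l ih => rw [labs_cons, labs_cons, ih (by rwa [wd_lab (by omega)]), lab_cup h hw]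

theorem labs_lab_comm {i j : ℕ} (h : i < j) (hw : j < x.wd) (l : List (Lab A)) (o : Lab A) :
    (x.labs i l).lab j o = (x.lab j o).labs i l := by
  induction l generalizing x with
  | nil => rfl
  | cons o' l ih => rw [labs_cons, labs_cons, ih (by rwa [wd_lab (by omega)]), lab_lab_comm h hw]

theorem labs_succ_P {i : ℕ} (h : i + 2 ≤ x.wd) (l : List (Lab A)) :
    (x.labs (i + 1) l).P i = (x.P i).labs i l := by
  induction l generalizing x with
  | nil => rfl
  | cons o l ih => rw [labs_cons, labs_cons, ih (by rwa [wd_lab (by omega)]), lab_succ_P h]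

theorem cup_labs {i j : ℕ} (h : i ≤ j) (hw : j < x.wd) (l : List (Lab A)) :
    (x.cup i).labs (j + 2) l = (x.labs j l).cup i := by
  induction l generalizing x with
  | nil => rfl
  | cons o l ih => rw [labs_cons, labs_cons, cup_lab h hw, ih (by rwa [wd_lab (by omega)])]

variable (k) in
/-- A label on the right leg of a maximum may be moved to the left leg. -/
theorem exists_lab_succ_cap (o : Lab A) : ∃ o' : Lab A, ∀ (m : ℕ) (x : Word k A m) (i : ℕ),
    i + 2 ≤ x.wd → (x.lab (i + 1) o).cap i = (x.lab i o').cap i := by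
  cases o with
  | bead a => exact ⟨.bead (antip k a), fun m x i h => cap_bead h a⟩
  | pos => exact ⟨.neg, fun m x i h => by rw [cap_flip h, cap_flip_right h]⟩
  | neg => exact ⟨.pos, fun m x i h => lab_neg_succ_cap h⟩

/-- A label on the left leg of a maximum may be moved to the right leg. -/
theorem exists_lab_cap (hs : Function.Surjective (antip k (A := A))) (o : Lab A) :
    ∃ o' : Lab A, ∀ (m : ℕ) (x : Word k A m) (i : ℕ),
      i + 2 ≤ x.wd → (x.lab i o).cap i = (x.lab (i + 1) o').cap i := by
  cases o with
  | bead a =>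
    obtain ⟨b, rfl⟩ := hs a
    exact ⟨.bead b, fun m x i h => (cap_bead h b).symm⟩
  | pos => exact ⟨.neg, fun m x i h => (lab_neg_succ_cap h).symm⟩
  | neg => exact ⟨.pos, fun m x i h => by rw [cap_flip h, cap_flip_right h]⟩

/-- The label nearest to the maximum goes over first, so the order of the labels is reversed. The
new list does not depend on the word or on the position. -/
theorem exists_labs_cap (hs : Function.Surjective (antip k (A := A))) (l : List (Lab A)) :
    ∃ l' : List (Lab A), ∀ (m : ℕ) (x : Word k A m) (i : ℕ),
      i + 2 ≤ x.wd → (x.labs i l).cap i = (x.labs (i + 1) l').cap i := by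
  induction l with
  | nil => exact ⟨[], fun m x i h => rfl⟩
  | cons o l ih =>
    obtain ⟨l', hl⟩ := ih
    obtain ⟨o', ho⟩ := exists_lab_cap hs o
    refine ⟨l' ++ [o'], fun m x i h => ?_⟩
    have e : x.labs (i + 1) (l' ++ [o']) = (x.labs (i + 1) l').lab (i + 1) o' := by
      simp [labs, List.foldl_append]
    have hc : ∀ (l : List (Lab A)) (y : Word k A m), i + 2 ≤ y.wd →
        (y.lab i o).labs (i + 1) l = (y.labs (i + 1) l).lab i o := by
      intro l
      induction l with
      | nil => intro y _; rfl
      | cons o' l ih =>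
        intro y hy
        rw [labs_cons, labs_cons, lab_lab_comm (by omega) (by omega),
          ih _ (by rwa [wd_lab (by omega)])]
    rw [labs_cons, hl _ _ _ (by rwa [wd_lab (by omega)]), e, hc _ _ h, ho _ _ _
      (by rwa [wd_labs (by omega)])]

/-! #### Pulling a strand to the left -/

theorem lab_pullTo_left {i t r : ℕ} (h : i < t) (hw : t + r < x.wd) (o : Lab A) :
    pullTo t (x.lab i o) r = (pullTo t x r).lab i o := by
  induction r generalizing x with
  | zero => rfl
  | succ r ih => rw [pullTo, pullTo, lab_P (by omega) (by omega), ih (by simp; omega)]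

theorem P_pullTo_right {j t r : ℕ} (h : t + r < j) (hw : j + 2 ≤ x.wd) :
    pullTo t (x.P j) r = (pullTo t x r).P j := by
  induction r generalizing x with
  | zero => rfl
  | succ r ih =>
    rw [pullTo, pullTo, ← P_P_comm (by omega) (by omega), ih (by omega) (by simp; omega)]

theorem lab_pullTo_right {j t r : ℕ} (h : t + r < j) (hw : j < x.wd) (o : Lab A) :
    pullTo t (x.lab j o) r = (pullTo t x r).lab j o := by
  induction r generalizing x with
  | zero => rfl
  | succ r ih =>
    rw [pullTo, pullTo, ← P_lab (by omega) (by omega), ih (by omega) (by simp; omega)]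

theorem cup_pullTo_right {j t r : ℕ} (h : t + r < j) (hw : j ≤ x.wd) :
    pullTo t (x.cup j) r = (pullTo t x r).cup j := by
  induction r generalizing x with
  | zero => rfl
  | succ r ih =>
    rw [pullTo, pullTo, ← P_cup (by omega) (by omega), ih (by omega) (by simp; omega)]

theorem lab_pullTo_self {t r : ℕ} (hw : t + r < x.wd) (o : Lab A) :
    pullTo t (x.lab (t + r) o) r = (pullTo t x r).lab t o := by
  induction r generalizing x with
  | zero => rfl
  | succ r ih =>
    rw [pullTo, pullTo, ← add_assoc, lab_succ_P (by omega), ih (by simp; omega)]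

theorem P_pullTo_self {t r : ℕ} (hw : t + r + 1 < x.wd) :
    pullTo t (x.P (t + r)) (r + 1) = pullTo t x r := by
  rw [pullTo, P_P (by omega)]

/-- The pulled strand ends up to the left of strand `j`, whose position thereby increases by one;
the same shift occurs in `P_pullTo` and `cup_pullTo`. -/
theorem lab_pullTo {j t r : ℕ} (h : t ≤ j) (h' : j < t + r) (hw : t + r < x.wd) (o : Lab A) :
    pullTo t (x.lab j o) r = (pullTo t x r).lab (j + 1) o := by
  induction r generalizing x with
  | zero => omega
  | succ r ih =>
    rw [pullTo, pullTo]
    rcases Nat.lt_or_ge j (t + r) with hj | hj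
    · rw [lab_P hj (by omega), ih hj (by simp; omega)]
    · obtain rfl : j = t + r := by omega
      rw [lab_P_self (by omega), lab_pullTo_right (by omega) (by simp; omega)]

theorem P_pullTo {j t r : ℕ} (h : t ≤ j) (h' : j + 2 ≤ t + r) (hw : t + r < x.wd) :
    pullTo t (x.P j) r = (pullTo t x r).P (j + 1) := by
  induction r generalizing x with
  | zero => omega
  | succ r ih =>
    rcases Nat.lt_or_ge (j + 1) (t + r) with hj | hj
    · rw [pullTo, pullTo, P_P_comm (by omega) (by omega), ih (by omega) (by simp; omega)]
    · obtain ⟨r, rfl⟩ : ∃ s, r = s + 1 := ⟨r - 1, by omega⟩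
      obtain rfl : j = t + r := by omega
      -- Here the pulled strand crosses exactly the two strands of the given crossing: the braid
      -- relation.
      rw [pullTo, pullTo, pullTo, pullTo, ← add_assoc, braid (by omega),
        P_pullTo_right (by omega) (by simp; omega)]

/-- With the minimum in its way the pulled strand starts two places further to the right and crosses
both legs. A switchback lets it pass below the minimum instead, which saves these two crossings. -/
theorem cup_pullTo {j t r : ℕ} (h : t ≤ j) (h' : j ≤ t + r) (hw : t + r < x.wd) :
    pullTo t (x.cup j) (r + 2) = (pullTo t x r).cup (j + 1) := by
  induction r generalizing x with
  | zero =>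
    obtain rfl : j = t := by omega
    simp only [pullTo, add_zero]
    rw [← cup_switchback (by omega), P_P (by simp; omega)]
  | succ r ih =>
    rcases Nat.lt_or_ge j (t + r + 1) with hj | hj
    · rw [show pullTo t x (r + 1) = pullTo t (x.P (t + r)) r from rfl, pullTo,
        show t + (r + 1 + 1) = t + r + 2 by ring, cup_P (by omega) (by omega),
        ih (by omega) (by simp; omega)]
    · obtain rfl : j = t + r + 1 := by omega
      rw [pullTo, pullTo, show t + (r + 1 + 1) = t + r + 1 + 1 by ring,
        show t + (r + 1) = t + r + 1 by ring, ← cup_switchback (by omega), P_P (by simp; omega),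
        cup_pullTo_right (by omega) (by omega)]

/-! #### Maxima with labels -/

/-- The strand in position `r + 1` is pulled to the strand in position `0`, with labels on
the latter, and both are joined by a maximum. -/
def join (x : Word k A m) (r : ℕ) (l : List (Lab A)) : Word k A m :=
  ((pullTo 1 x r).labs 0 l).cap 0

/-- Words without maxima, except those in curls. -/
inductive CapFree : Word k A 1 → Prop
  | nil : CapFree (mk k 1 [])
  | cup (x : Word k A 1) (i : ℕ) : CapFree x → i ≤ x.wd → CapFree (x.cup i)
  | P (x : Word k A 1) (i : ℕ) : CapFree x → i + 2 ≤ x.wd → CapFree (x.P i)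
  | lab (x : Word k A 1) (i : ℕ) (o : Lab A) : CapFree x → i < x.wd → CapFree (x.lab i o)

/-- Words that contain a small circle. -/
inductive Loopy : Word k A 1 → Prop
  | circle (x : Word k A 1) (l : List (Lab A)) : Loopy (((x.cup 0).labs 0 l).cap 0)
  | app (x : Word k A 1) (w : List (Layer (CatGen A))) : Loopy x → Loopy (x.app w)

/-- Words in which all maxima have been eliminated, or which contain a circle. -/
def Reduced (x : Word k A 1) : Prop := CapFree x ∨ Loopy x

theorem Reduced.P {x : Word k A 1} (h : Reduced x) {i : ℕ} (hi : i + 2 ≤ x.wd) :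
    Reduced (x.P i) :=
  h.imp (fun h => .P x i h hi) (fun h => .app x _ h)

theorem Reduced.cup {x : Word k A 1} (h : Reduced x) {i : ℕ} (hi : i ≤ x.wd) :
    Reduced (x.cup i) :=
  h.imp (fun h => .cup x i h hi) (fun h => .app x _ h)

theorem Loopy.lab {x : Word k A 1} (h : Loopy x) (i : ℕ) (o : Lab A) : Loopy (x.lab i o) := by
  cases o with
  | bead a => exact .app x _ h
  | _ => exact .app _ _ (.app _ _ (.app _ _ h))

theorem Reduced.lab {x : Word k A 1} (h : Reduced x) {i : ℕ} (hi : i < x.wd) (o : Lab A) :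
    Reduced (x.lab i o) :=
  h.imp (fun h => .lab x i o h hi) (fun h => h.lab i o)

theorem CapFree.labs {x : Word k A 1} (h : CapFree x) {i : ℕ} (hi : i < x.wd)
    (l : List (Lab A)) : CapFree (x.labs i l) := by
  induction l generalizing x with
  | nil => exact h
  | cons o l ih => exact ih (.lab x i o h hi) (by rwa [wd_lab (by omega)])

theorem capFree_pullTo {x : Word k A 1} (h : CapFree x) {t r : ℕ} (hr : t + r < x.wd) :
    CapFree (pullTo t x r) := by
  induction r generalizing x with
  | zero => exact h
  | succ r ih => exact ih (.P x _ h (by omega)) (by simp; omega)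

variable {x : Word k A 1}

theorem wd_join {r : ℕ} (h : r + 1 < x.wd) (l : List (Lab A)) : (x.join r l).wd = x.wd - 2 := by
  have h1 : (pullTo 1 x r).wd = x.wd := wd_pullTo (by omega)
  rw [join, wd_cap, wd_labs (by omega), h1]

/-- A crossing that avoids the left leg passes through the maximum or is absorbed by it. -/
theorem join_P {j r : ℕ} (h : j + 3 ≤ x.wd) (hr : r + 1 < x.wd) (l : List (Lab A)) :
    (∃ r', r' + 1 < x.wd ∧ (x.P (j + 1)).join r l = x.join r' l) ∨
    ∃ j', j' + 4 ≤ x.wd ∧ (x.P (j + 1)).join r l = (x.join r l).P j' := by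
  have h1 : (pullTo 1 x r).wd = x.wd := wd_pullTo (by omega)
  -- The right leg of the maximum comes from position `r + 1`. If the crossing at `j + 1`, `j + 2`
  -- involves this strand, that is `j = r` or `j + 1 = r`, it only changes the position from which
  -- the strand is pulled. Otherwise it survives above the maximum.
  rcases Nat.lt_trichotomy j r with hj | rfl | hj
  · obtain ⟨r, rfl⟩ : ∃ s, r = s + 1 := ⟨r - 1, by omega⟩
    rcases Nat.lt_or_ge j r with hj' | hj'
    · refine .inr ⟨j, by omega, ?_⟩
      rw [join, join, P_pullTo (by omega) (by omega) (by omega),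
        ← labs_P (by omega) (by omega), cap_P (by omega) (by rw [wd_labs (by omega)]; omega)]
    · obtain rfl : j = r := by omega
      refine .inl ⟨j, by omega, ?_⟩
      have h2 := P_pullTo_self (x := x) (t := 1) (r := j) (by omega)
      rw [add_comm 1 j] at h2
      rw [join, join, h2]
  · exact .inl ⟨j + 1, by omega, by rw [join, join, pullTo, add_comm 1 j]⟩
  · obtain ⟨j, rfl⟩ : ∃ s, j = s + 1 := ⟨j - 1, by omega⟩
    refine .inr ⟨j, by omega, ?_⟩
    rw [join, join, P_pullTo_right (by omega) (by omega), ← labs_P (by omega) (by omega),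
      cap_P (by omega) (by rw [wd_labs (by omega)]; omega)]

/-- A label that avoids the left leg passes through the maximum or is absorbed by it. -/
theorem join_lab {j r : ℕ} (h : j + 1 < x.wd) (hr : r + 1 < x.wd) (l : List (Lab A)) (o : Lab A) :
    (∃ l', (x.lab (j + 1) o).join r l = x.join r l') ∨
    ∃ j', j' + 2 < x.wd ∧ (x.lab (j + 1) o).join r l = (x.join r l).lab j' o := by
  have h1 : (pullTo 1 x r).wd = x.wd := wd_pullTo (by omega)
  rcases Nat.lt_trichotomy j r with hj | rfl | hj
  · refine .inr ⟨j, by omega, ?_⟩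
    rw [join, join, lab_pullTo (by omega) (by omega) (by omega), ← labs_lab_comm (by omega)
      (by omega), cap_lab (by omega) (by rw [wd_labs (by omega)]; omega)]
  -- The label sits on the right leg; it goes over the maximum and becomes the topmost label of the
  -- left leg.
  · obtain ⟨o', ho⟩ := exists_lab_succ_cap k o
    refine .inl ⟨l ++ [o'], ?_⟩
    rw [join, join, add_comm j 1, lab_pullTo_self (by omega), ← labs_lab_comm (by omega)
      (by omega), ho _ _ 0 (by rw [wd_labs (by omega)]; omega)]
    simp [labs, List.foldl_append]
  · obtain ⟨j, rfl⟩ : ∃ s, j = s + 1 := ⟨j - 1, by omega⟩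
    refine .inr ⟨j, by omega, ?_⟩
    rw [join, join, lab_pullTo_right (by omega) (by omega), ← labs_lab_comm (by omega)
      (by omega), cap_lab (by omega) (by rw [wd_labs (by omega)]; omega)]

/-- If the right leg of the maximum is the left leg of a minimum, they cancel. -/
theorem CapFree.join_cup (h : CapFree x) {r : ℕ} (hr : r < x.wd) (l : List (Lab A)) :
    CapFree ((x.cup (r + 1)).join r l) := by
  induction r with
  | zero =>
    have e : (x.cup 1).join 0 l = x.labs 0 l := by
      rw [join, pullTo, ← labs_cup (by omega) (by omega),
        zigzag_right (by rw [wd_labs (by omega)]; omega)]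
    rw [zero_add, e]
    exact h.labs hr l
  | succ r ih =>
    have h1 : (pullTo 1 (x.cup (r + 1)) r).wd = x.wd + 2 := by
      rw [wd_pullTo (by simp; omega), wd_cup]
    -- A switchback trades the first crossing of the pulled strand for a minimum one place further
    -- left and a crossing that escapes above the maximum.
    have e : (x.cup (r + 1 + 1)).join (r + 1) l = ((x.cup (r + 1)).join r l).P r := by
      rw [join, join, pullTo, add_comm 1 r, cup_switchback (by omega),
        P_pullTo_right (by omega) (by simp; omega), ← labs_P (by omega) (by omega),
        cap_P (by omega) (by rw [wd_labs (by omega)]; omega)]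
    rw [e]
    exact .P _ _ (ih (by omega)) (by rw [wd_join (by simp; omega)]; simp; omega)

/-- A minimum that avoids the left leg passes through the maximum or is absorbed by it. -/
theorem join_cup {j r : ℕ} (hx : CapFree x) (h : j < x.wd) (hr : r < x.wd + 1)
    (l : List (Lab A)) : CapFree ((x.cup (j + 1)).join r l) ∨
    ∃ r' j', r' + 1 < x.wd ∧ j' + 2 ≤ x.wd ∧
      (x.cup (j + 1)).join r l = (x.join r' l).cup j' := by
  rcases Nat.lt_trichotomy j r with hj | rfl | hj
  · obtain ⟨r, rfl⟩ : ∃ s, r = s + 1 := ⟨r - 1, by omega⟩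
    rcases Nat.lt_or_ge j r with hj' | hj'
    · obtain ⟨r, rfl⟩ : ∃ s, r = s + 1 := ⟨r - 1, by omega⟩
      refine .inr ⟨r, j, by omega, by omega, ?_⟩
      have h1 : (pullTo 1 x r).wd = x.wd := wd_pullTo (by omega)
      rw [join, join, cup_pullTo (by omega) (by omega) (by omega),
        ← labs_cup (by omega) (by omega), cap_cup (by omega) (by rw [wd_labs (by omega)]; omega)]
    · obtain rfl : j = r := by omega
      have h1 : (pullTo 1 (x.cup (j + 1)) j).wd = x.wd + 2 := by
        rw [wd_pullTo (by simp; omega), wd_cup]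
      -- The pulled strand is the right leg of the minimum. Its first crossing exchanges the two
      -- legs of the minimum, which is a curl on the other leg, and leaves the case of the left leg.
      have e : (x.cup (j + 1)).join (j + 1) l = ((x.cup (j + 1)).join j l).lab j .pos := by
        rw [join, join, pullTo, add_comm 1 j, cup_flip (by omega),
          lab_pullTo_right (by omega) (by simp; omega), ← labs_lab_comm (by omega) (by omega),
          cap_lab (by omega) (by rw [wd_labs (by omega)]; omega)]
      rw [e]
      exact .inl (.lab _ _ _ (hx.join_cup (by omega) l)
        (by rw [wd_join (by simp; omega)]; simp; omega))
  · exact .inl (hx.join_cup h l)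
  · obtain ⟨j, rfl⟩ : ∃ s, j = s + 1 := ⟨j - 1, by omega⟩
    refine .inr ⟨r, j, by omega, by omega, ?_⟩
    have h1 : (pullTo 1 x r).wd = x.wd := wd_pullTo (by omega)
    rw [join, join, cup_pullTo_right (by omega) (by omega), ← labs_cup (by omega) (by omega),
      cap_cup (by omega) (by rw [wd_labs (by omega)]; omega)]

/-- What arises from `x.cup 0` by crossings and labels that avoid the left leg of the minimum. -/
inductive OverCup (x : Word k A 1) : Word k A 1 → Prop
  | cup : OverCup x (x.cup 0)
  | P (y : Word k A 1) (j : ℕ) : OverCup x y → j + 3 ≤ y.wd → OverCup x (y.P (j + 1))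
  | lab (y : Word k A 1) (j : ℕ) (o : Lab A) :
      OverCup x y → j + 1 < y.wd → OverCup x (y.lab (j + 1) o)

/-- The left leg of the maximum is the left leg of a minimum. If the right leg is its right leg too,
there is a circle. If it is the next strand, the result is a curl on that strand. A strand further
away is first moved closer below the minimum. -/
theorem reduced_cup_join (hs : Function.Surjective (antip k (A := A))) (hx : CapFree x) {r : ℕ}
    (hr : r < x.wd + 1) (l : List (Lab A)) : Reduced ((x.cup 0).join r l) := by
  induction r generalizing x with
  | zero => exact .inr (.circle x l)
  | succ r ih =>
    cases r with
    | zero =>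
      -- The labels are moved to the right leg, through the crossing, and below the minimum, so that
      -- a bare `G⁻¹` remains above them. Moving beads from left to right over a maximum requires
      -- `s` to be surjective.
      obtain ⟨l', hl⟩ := exists_labs_cap hs l
      have h2 : ((x.labs 0 l').cup 0).P 1 = (((x.cup 0).P 1).labs 1 l') := by
        rw [← cup_labs (by omega) (by omega), labs_succ_P (i := 1) (by simp; omega)]
      have e : (x.cup 0).join 1 l = (x.labs 0 l').lab 0 .neg := by
        rw [join, pullTo, pullTo, hl _ _ _ (by simp), lab, ← h2]
      rw [zero_add, e]
      exact .inl (.lab _ _ _ (hx.labs (by omega) l') (by rw [wd_labs (by omega)]; omega))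
    | succ r =>
      have e : (x.cup 0).join (r + 1 + 1) l = ((x.P r).cup 0).join (r + 1) l := by
        rw [join, join, pullTo, show 1 + (r + 1) = r + 2 by ring, cup_P (by omega) (by omega)]
      rw [e]
      exact ih (.P x r hx (by omega)) (by simp; omega)

theorem OverCup.reduced_join (hs : Function.Surjective (antip k (A := A))) (hx : CapFree x)
    {y : Word k A 1} (hy : OverCup x y) {r : ℕ} (hr : r + 1 < y.wd) (l : List (Lab A)) :
    Reduced (y.join r l) := by
  induction hy generalizing r l with
  | cup => exact reduced_cup_join hs hx (by simpa using hr) l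
  | P y j hy hj ih =>
    have hr' : r + 1 < y.wd := by simp at hr; omega
    obtain ⟨r', h1, h2⟩ | ⟨j', h1, h2⟩ := join_P hj hr' l
    · rw [h2]; exact ih h1 l
    · rw [h2]; exact (ih hr' l).P (by rw [wd_join hr']; omega)
  | lab y j o hy hj ih =>
    have hr' : r + 1 < y.wd := by rwa [wd_lab (by omega)] at hr
    obtain ⟨l', h2⟩ | ⟨j', h1, h2⟩ := join_lab hj hr' l o
    · rw [h2]; exact ih hr' l'
    · rw [h2]; exact (ih hr' l).lab (by rw [wd_join hr']; omega) o

/-- Pulling the left leg of a minimum to the far left drags the whole minimum along by switchbacks,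
with crossings of its right leg left over. -/
theorem overCup_pullTo {i : ℕ} (hi : i ≤ x.wd) :
    OverCup x (pullTo 0 (x.cup i) i) := by
  induction i with
  | zero => exact .cup
  | succ i ih =>
    rw [pullTo, zero_add, cup_switchback (by omega), P_pullTo_right (by omega) (by simp; omega)]
    exact .P _ _ (ih (by omega)) (by rw [wd_pullTo (by simp; omega)]; simp; omega)

/-- A maximum that joins any two strands can be eliminated. -/
theorem CapFree.reduced_join (hs : Function.Surjective (antip k (A := A))) (hx : CapFree x)
    {p r : ℕ} (hp : p < x.wd) (hr : r + 1 < x.wd) (l : List (Lab A)) :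
    Reduced ((pullTo 0 x p).join r l) := by
  -- The topmost piece of the word below the maximum is examined. It passes through the maximum, is
  -- absorbed by it, or is a minimum that shares a leg with it; in the first two cases the maximum
  -- has sunk by one piece.
  induction hx generalizing p r l with
  | nil => exact absurd hr (by simp [wd, mk, wout])
  | P y j hy hj ih =>
    have hw : (y.P j).wd = y.wd := by simp; omega
    rw [hw] at hp hr
    have h0 : (pullTo 0 y p).wd = y.wd := wd_pullTo (by omega)
    rcases Nat.lt_trichotomy j p with hjp | rfl | hjp
    · obtain ⟨p, rfl⟩ : ∃ s, p = s + 1 := ⟨p - 1, by omega⟩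
      rcases Nat.lt_or_ge j p with hj' | hj'
      · rw [P_pullTo (by omega) (by omega) (by omega)]
        obtain ⟨r', h1, h2⟩ | ⟨j', h1, h2⟩ := join_P (x := pullTo 0 y (p + 1)) (j := j) (r := r)
          (by omega) (by omega) l
        · rw [h2]; exact ih hp (by omega) l
        · rw [h2]; exact (ih hp hr l).P (by rw [wd_join (by omega)]; omega)
      · obtain rfl : j = p := by omega
        have h2 := P_pullTo_self (x := y) (t := 0) (r := j) (by omega)
        rw [zero_add] at h2
        rw [h2]
        exact ih (by omega) hr l
    · have h2 : pullTo 0 (y.P j) j = pullTo 0 y (j + 1) := by rw [pullTo, zero_add]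
      rw [h2]
      exact ih (by omega) hr l
    · rw [P_pullTo_right (by omega) (by omega)]
      obtain ⟨j, rfl⟩ : ∃ s, j = s + 1 := ⟨j - 1, by omega⟩
      obtain ⟨r', h1, h2⟩ | ⟨j', h1, h2⟩ := join_P (x := pullTo 0 y p) (j := j) (r := r)
        (by omega) (by omega) l
      · rw [h2]; exact ih hp (by omega) l
      · rw [h2]; exact (ih hp hr l).P (by rw [wd_join (by omega)]; omega)
  | lab y j o hy hj ih =>
    have hw : (y.lab j o).wd = y.wd := wd_lab (by omega) o
    rw [hw] at hp hr
    have h0 : (pullTo 0 y p).wd = y.wd := wd_pullTo (by omega)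
    have key : ∀ j, j + 1 < y.wd → Reduced (((pullTo 0 y p).lab (j + 1) o).join r l) := by
      intro j hj
      obtain ⟨l', h2⟩ | ⟨j', h1, h2⟩ := join_lab (x := pullTo 0 y p) (j := j) (r := r)
        (by omega) (by omega) l o
      · rw [h2]; exact ih hp hr l'
      · rw [h2]; exact (ih hp hr l).lab (by rw [wd_join (by omega)]; omega) o
    rcases Nat.lt_trichotomy j p with hjp | rfl | hjp
    · rw [lab_pullTo (by omega) (by omega) (by omega)]
      exact key j (by omega)
    · have h2 := lab_pullTo_self (x := y) (t := 0) (r := j) (by omega) o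
      rw [zero_add] at h2
      have h3 : ((pullTo 0 y j).lab 0 o).join r l = (pullTo 0 y j).join r (o :: l) := by
        rw [join, join, lab_pullTo_left (by omega) (by omega), labs_cons]
      rw [h2, h3]
      exact ih hp hr (o :: l)
    · rw [lab_pullTo_right (by omega) (by omega)]
      obtain ⟨j, rfl⟩ : ∃ s, j = s + 1 := ⟨j - 1, by omega⟩
      exact key j hj
  | cup y j hy hj ih =>
    have hw : (y.cup j).wd = y.wd + 2 := wd_cup y j
    rw [hw] at hp hr
    have key : ∀ p j, p < y.wd → j < y.wd → Reduced (((pullTo 0 y p).cup (j + 1)).join r l) := by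
      intro p j hp hj
      have h0 : (pullTo 0 y p).wd = y.wd := wd_pullTo (by omega)
      have hc : CapFree (pullTo 0 y p) := capFree_pullTo hy (by omega)
      obtain h1 | ⟨r', j', h1, h2, h3⟩ := Word.join_cup (r := r) hc (j := j) (by omega) (by omega) l
      · exact .inl h1
      · rw [h3]; exact (ih hp (by omega) l).cup (by rw [wd_join (by omega)]; omega)
    rcases Nat.lt_trichotomy j p with hjp | rfl | hjp
    · obtain ⟨p, rfl⟩ : ∃ s, p = s + 1 := ⟨p - 1, by omega⟩
      rcases Nat.lt_or_ge j p with hj' | hj'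
      · obtain ⟨p, rfl⟩ : ∃ s, p = s + 1 := ⟨p - 1, by omega⟩
        rw [cup_pullTo (by omega) (by omega) (by omega)]
        exact key p j (by omega) (by omega)
      -- The left leg of the maximum is the right leg of the minimum. Flipping the minimum makes it
      -- the left leg, at the cost of a curl on the other one, and `OverCup` applies.
      · obtain rfl : j = p := by omega
        rw [pullTo, zero_add, cup_flip hj, lab_pullTo_right (by omega) (by omega)]
        have h0 : (pullTo 0 (y.cup j) j).wd = y.wd + 2 := by rw [wd_pullTo (by omega), hw]
        exact (OverCup.lab _ _ _ (overCup_pullTo hj) (by omega)).reduced_join hs hy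
          (by rw [wd_lab (by omega)]; omega) l
    · have h0 : (pullTo 0 (y.cup j) j).wd = y.wd + 2 := by rw [wd_pullTo (by omega), hw]
      exact (overCup_pullTo hj).reduced_join hs hy (by omega) l
    · rw [cup_pullTo_right (by omega) hj]
      obtain ⟨j, rfl⟩ : ∃ s, j = s + 1 := ⟨j - 1, by omega⟩
      exact key p j (by omega) (by omega)

/-- Each switchback moves a maximum one place to the left. In the end its left leg comes from
position `i`, and its right leg, pulled afterwards, from position `i + 1`. -/
theorem cap_eq_join {i : ℕ} (h : i + 2 ≤ x.wd) : x.cap i = (pullTo 0 x i).join i [] := by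
  induction i generalizing x with
  | zero => rfl
  | succ i ih =>
    have e : (pullTo 0 x (i + 1)).join (i + 1) [] =
        (pullTo 0 ((x.P i).P (i + 1)) i).join i [] := by
      rw [join, join, pullTo, pullTo, zero_add, add_comm 1 i,
        P_pullTo_right (x := x.P i) (t := 0) (by omega) (by simp; omega)]
    rw [e, ← ih (by simp; omega), ← cap_switchback (by simp; omega), P_P (by omega)]

/-- Every word on one strand can be reduced. -/
theorem reduced_mk (hs : Function.Surjective (antip k (A := A))) (w : List (Layer (CatGen A)))
    (hw : Fits 1 w) : Reduced (mk k 1 w) := by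
  induction w using List.reverseRecOn with
  | nil => exact .inl .nil
  | append_singleton w l ih =>
    rw [fits_append] at hw
    have h1 := ih hw.1
    have h2 : (mk k 1 w).wd = wout 1 w := rfl
    obtain ⟨i, g⟩ := l
    have h3 : i + inn g ≤ (mk k 1 w).wd := hw.2.1
    cases g with
    | bead a => exact h1.lab h3 (.bead a)
    | cup => exact h1.cup h3
    | P => exact h1.P h3
    | cap =>
      change Reduced ((mk k 1 w).cap i)
      obtain h | h := h1
      · rw [inn_cap] at h3
        rw [cap_eq_join h3]
        exact h.reduced_join hs (by omega) (by omega) []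
      · exact .inr (.app _ _ h)

/-- The reduced words with one strand at the top. -/
theorem CapFree.eq_labs (hx : CapFree x) : 1 ≤ x.wd ∧
    (x.wd = 1 → ∃ l, x = (mk k 1 []).labs 0 l) := by
  induction hx with
  | nil => exact ⟨le_rfl, fun _ => ⟨[], rfl⟩⟩
  -- Nothing in a cap-free word lowers the width, and after a minimum or a crossing it is at least
  -- two. With one strand at the top only labels are possible.
  | cup x i hx hi ih => simp
  | P x i hx hi ih => simp
  | lab x i o hx hi ih =>
    rw [wd_lab (by omega)]
    refine ⟨ih.1, fun h => ?_⟩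
    obtain ⟨l, hl⟩ := ih.2 h
    obtain rfl : i = 0 := by omega
    exact ⟨l ++ [o], by rw [hl, Word.labs, Word.labs, List.foldl_append]; rfl⟩

end Word

end Reduction

/-! ### Beads and curls on a single strand -/

section SingleStrand

/-- The layers of the curls `G ^ n`. -/
def curlLayers (A : Type*) : ℤ → List (Layer (CatGen A))
  | .ofNat n => (List.replicate n [(1, .cup), (0, .P), (1, .cap)]).flatten
  | .negSucc n => (List.replicate (n + 1) [(0, .cup), (1, .P), (0, .cap)]).flatten

namespace Word

variable {k : Type*} {A : Type*} [CommRing k] [Ring A] [HopfAlgebra k A] {m : ℕ}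
  {x : Word k A m}

theorem app_curls (n : ℕ) (o : Lab A) (w : List (Layer (CatGen A)))
    (hw : ∀ y : Word k A m, y.lab 0 o = y.app w) :
    x.app (List.replicate n w).flatten = x.labs 0 (List.replicate n o) := by
  induction n generalizing x with
  | zero => exact app_nil x
  | succ n ih =>
    rw [List.replicate_succ, List.replicate_succ, List.flatten_cons, ← app_app, labs_cons, hw, ih]

theorem app_curlLayers_ofNat (n : ℕ) :
    x.app (curlLayers A n) = x.labs 0 (List.replicate n .pos) :=
  app_curls n _ _ fun y => by simp [lab, cup, P, cap, app_app]

theorem app_curlLayers_negSucc (n : ℕ) :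
    x.app (curlLayers A (.negSucc n)) = x.labs 0 (List.replicate (n + 1) .neg) :=
  app_curls (n + 1) _ _ fun y => by simp [lab, cup, P, cap, app_app]

theorem labs_append (i : ℕ) (l l' : List (Lab A)) :
    x.labs i (l ++ l') = (x.labs i l).labs i l' := List.foldl_append

theorem labs_replicate_succ (i n : ℕ) (o : Lab A) :
    x.labs i (List.replicate (n + 1) o) = (x.labs i (List.replicate n o)).lab i o := by
  rw [List.replicate_succ', labs_append]; rfl

theorem app_curlLayers_pos (h : 0 < x.wd) (n : ℤ) :
    (x.app (curlLayers A n)).lab 0 .pos = x.app (curlLayers A (n + 1)) := by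
  cases n with
  | ofNat n =>
    rw [Int.ofNat_eq_natCast, app_curlLayers_ofNat, ← labs_replicate_succ, ← app_curlLayers_ofNat]
    rfl
  | negSucc n =>
    rw [app_curlLayers_negSucc, labs_replicate_succ, lab_neg_pos (by rwa [wd_labs h])]
    cases n with
    | zero => exact (app_nil x).symm
    | succ n =>
      rw [← app_curlLayers_negSucc]
      rfl

theorem app_curlLayers_neg (h : 0 < x.wd) (n : ℤ) :
    (x.app (curlLayers A n)).lab 0 .neg = x.app (curlLayers A (n - 1)) := by
  cases n with
  | ofNat n =>
    rw [Int.ofNat_eq_natCast, app_curlLayers_ofNat]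
    cases n with
    | zero => exact (app_curlLayers_negSucc 0).symm
    | succ n =>
      rw [labs_replicate_succ, lab_pos_neg (by rwa [wd_labs h]), ← app_curlLayers_ofNat]
      simp
  | negSucc n =>
    rw [app_curlLayers_negSucc, ← labs_replicate_succ, ← app_curlLayers_negSucc]
    rfl

/-- The bead passes the maximum and the minimum of the curl, each of which applies the antipode
once. -/
theorem lab_pos_bead (h : 0 < x.wd) (a : A) :
    (x.lab 0 .pos).bead 0 a = (x.bead 0 (antip k (antip k a))).lab 0 .pos := by
  simp only [lab]
  rw [← bead_cap (by omega) (by simp; omega), ← bead_succ_P (by simp),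
    cup_bead (by omega), ← P_bead (by omega) (by simp; omega), cap_bead (by simp; omega),
    ← bead_P_self (by simp), ← bead_cup (by omega) (by omega)]

theorem lab_neg_bead (h : 0 < x.wd) (a : A) :
    (x.lab 0 .neg).bead 0 (antip k (antip k a)) = (x.bead 0 a).lab 0 .neg := by
  simp only [lab]
  rw [cap_bead_right (by omega) (by simp; omega), ← bead_P_self (by simp; omega),
    ← cup_bead (by omega), bead_P (by omega) (by simp; omega), ← cap_bead (by simp),
    ← bead_succ_P (by simp; omega), cup_bead_right (by omega) h]

/-- Below `G⁻¹` the bead becomes a preimage under `s ^ 2`, hence the surjectivity. The value of the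
new bead is irrelevant here, as it is determined later by an invariant. -/
theorem exists_labs_bead (hs : Function.Surjective (antip k (A := A))) (h : 0 < x.wd)
    {o : Lab A} (ho : o = .pos ∨ o = .neg) (n : ℕ) (a : A) : ∃ b,
    (x.labs 0 (List.replicate n o)).bead 0 a = (x.bead 0 b).labs 0 (List.replicate n o) := by
  induction n generalizing a with
  | zero => exact ⟨a, rfl⟩
  | succ n ih =>
    simp only [labs_replicate_succ]
    obtain ⟨c, hc⟩ : ∃ c, ∀ y : Word k A m, 0 < y.wd →
        (y.lab 0 o).bead 0 a = (y.bead 0 c).lab 0 o := by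
      obtain rfl | rfl := ho
      · exact ⟨_, fun y hy => lab_pos_bead hy a⟩
      · obtain ⟨b, rfl⟩ := hs a
        obtain ⟨c, rfl⟩ := hs b
        exact ⟨c, fun y hy => lab_neg_bead hy c⟩
    obtain ⟨b, hb⟩ := ih c
    exact ⟨b, by rw [hc _ (by rwa [wd_labs h]), hb]⟩

/-- Labels on a single strand amount to one bead followed by curls. -/
theorem exists_labs_eq (hs : Function.Surjective (antip k (A := A))) (h : 0 < x.wd)
    (l : List (Lab A)) :
    ∃ (a : A) (n : ℤ), x.labs 0 l = (x.bead 0 a).app (curlLayers A n) := by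
  induction l using List.reverseRecOn with
  | nil => exact ⟨1, 0, by rw [bead_one h]; exact (app_nil x).symm⟩
  | append_singleton l o ih =>
    obtain ⟨a, n, e⟩ := ih
    have h' : 0 < (x.bead 0 a).wd := by simp
    have e1 : x.labs 0 (l ++ [o]) = (x.labs 0 l).lab 0 o := labs_append 0 l [o]
    rw [e1, e]
    cases o with
    | pos => exact ⟨a, n + 1, app_curlLayers_pos h' n⟩
    | neg => exact ⟨a, n - 1, app_curlLayers_neg h' n⟩
    | bead b =>
      change ∃ a' n', ((x.bead 0 a).app (curlLayers A n)).bead 0 b = _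
      cases n with
      | ofNat n =>
        obtain ⟨c, hc⟩ := exists_labs_bead hs h' (.inl rfl) n b
        refine ⟨a * c, n, ?_⟩
        rw [Int.ofNat_eq_natCast, app_curlLayers_ofNat, hc, bead_mul h, app_curlLayers_ofNat]
      | negSucc n =>
        obtain ⟨c, hc⟩ := exists_labs_bead hs h' (.inr rfl) (n + 1) b
        refine ⟨a * c, .negSucc n, ?_⟩
        rw [app_curlLayers_negSucc, hc, bead_mul h, app_curlLayers_negSucc]

end Word

end SingleStrand

/-! ### The journey along a strand -/

section Journey

variable {A : Type*}

namespace Traveller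

/-- The next position of a traveller. -/
def next (c : Traveller A) : Traveller A := c.advance.2

/-- The events met during the first `t` steps. -/
def events : ℕ → Traveller A → List (StrandEvent A)
  | 0, _ => []
  | t + 1, c => c.advance.1 ++ events t c.next

/-- The traveller turns around. -/
def rev (c : Traveller A) : Traveller A := { c with up := !c.up }

/-- The traveller is at the end of its journey. -/
def Stopped (c : Traveller A) : Prop :=
  (c.up = true ∧ c.above = []) ∨ (c.up = false ∧ c.below = [])

/-- The list of all layers. -/
def word (c : Traveller A) : List (Layer (CatGen A)) := c.below.reverse ++ c.above

theorem rev_rev (c : Traveller A) : c.rev.rev = c := by simp [rev]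

theorem rev_ne (c : Traveller A) : c.rev ≠ c := fun h => by
  have := congrArg Traveller.up h
  simp [rev] at this

theorem rev_injective {c d : Traveller A} (h : c.rev = d.rev) : c = d := by
  rw [← rev_rev c, h, rev_rev]

theorem advance_of_stopped {c : Traveller A} (h : c.Stopped) : c.advance = ([], c) := by
  obtain ⟨be, ab, p, u⟩ := c
  obtain ⟨rfl, rfl⟩ | ⟨rfl, rfl⟩ := h
  · rw [advance]
  · rw [advance]

theorem next_of_stopped {c : Traveller A} (h : c.Stopped) : c.next = c := by
  rw [next, advance_of_stopped h]

section

variable (be ab : List (Layer (CatGen A))) (i p : ℕ) (a : A)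

theorem advance_up_bead : advance ⟨be, (i, .bead a) :: ab, p, true⟩ =
    (if p = i then [.bead a] else [], ⟨(i, .bead a) :: be, ab, p, true⟩) := by
  simp only [advance, inn_bead, out_bead]
  split_ifs <;> first | rfl | omega | (congr 2; omega)

theorem advance_up_P : advance ⟨be, (i, .P) :: ab, p, true⟩ =
    ([], ⟨(i, .P) :: be, ab, if p = i then i + 1 else if p = i + 1 then i else p, true⟩) := by
  simp only [advance, inn_P, out_P]
  split_ifs <;> first | rfl | omega | (congr 2; omega)

theorem advance_up_cup : advance ⟨be, (i, .cup) :: ab, p, true⟩ =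
    ([], ⟨(i, .cup) :: be, ab, if p < i then p else p + 2, true⟩) := by
  simp only [advance, inn_cup, out_cup]
  split_ifs <;> first | rfl | omega

theorem advance_up_cap : advance ⟨be, (i, .cap) :: ab, p, true⟩ =
    if p = i then ([.turn 1], ⟨be, (i, .cap) :: ab, i + 1, false⟩)
    else if p = i + 1 then ([.turn (-1)], ⟨be, (i, .cap) :: ab, i, false⟩)
    else ([], ⟨(i, .cap) :: be, ab, if p < i then p else p - 2, true⟩) := by
  simp only [advance, inn_cap, out_cap]
  split_ifs <;> first | rfl | omega

theorem advance_down_bead : advance ⟨(i, .bead a) :: be, ab, p, false⟩ =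
    (if p = i then [.bead a] else [], ⟨be, (i, .bead a) :: ab, p, false⟩) := by
  simp only [advance, inn_bead, out_bead]
  split_ifs <;> first | rfl | omega | (congr 2; omega)

theorem advance_down_P : advance ⟨(i, .P) :: be, ab, p, false⟩ =
    ([], ⟨be, (i, .P) :: ab, if p = i then i + 1 else if p = i + 1 then i else p, false⟩) := by
  simp only [advance, inn_P, out_P]
  split_ifs <;> first | rfl | omega | (congr 2; omega)

theorem advance_down_cap : advance ⟨(i, .cap) :: be, ab, p, false⟩ =
    ([], ⟨be, (i, .cap) :: ab, if p < i then p else p + 2, false⟩) := by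
  simp only [advance, inn_cap, out_cap]
  split_ifs <;> first | rfl | omega

theorem advance_down_cup : advance ⟨(i, .cup) :: be, ab, p, false⟩ =
    if p = i then ([.turn (-1)], ⟨(i, .cup) :: be, ab, i + 1, true⟩)
    else if p = i + 1 then ([.turn 1], ⟨(i, .cup) :: be, ab, i, true⟩)
    else ([], ⟨be, (i, .cup) :: ab, if p < i then p else p - 2, false⟩) := by
  simp only [advance, inn_cup, out_cup]
  split_ifs <;> first | rfl | omega

theorem advance_top : advance ⟨be, [], p, true⟩ = ([], ⟨be, [], p, true⟩) := by
  rw [advance]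

theorem advance_bottom : advance ⟨[], ab, p, false⟩ = ([], ⟨[], ab, p, false⟩) := by
  rw [advance]

end

/-- The rules of the journey. -/
theorem induction_advance {motive : Traveller A → Prop}
    (stopped : ∀ c : Traveller A, c.Stopped → motive c)
    (up : ∀ be i g ab p, motive ⟨be, (i, g) :: ab, p, true⟩)
    (down : ∀ i g be ab p, motive ⟨(i, g) :: be, ab, p, false⟩) (c : Traveller A) : motive c := by
  obtain ⟨be, ab, p, u⟩ := c
  cases u with
  | true =>
    cases ab with
    | nil => exact stopped _ (.inl ⟨rfl, rfl⟩)
    | cons l ab => exact up be l.1 l.2 ab p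
  | false =>
    cases be with
    | nil => exact stopped _ (.inr ⟨rfl, rfl⟩)
    | cons l be => exact down l.1 l.2 be ab p

/-- The journey is reversible in time. This gives injectivity of the motion without an explicit
inverse. -/
theorem next_rev_next {c : Traveller A} (h : ¬ c.Stopped) : c.next.rev.next = c.rev := by
  induction c using induction_advance with
  | stopped c hc => exact absurd hc h
  | up be i g ab p =>
    cases g <;> simp only [next, rev, advance_up_bead, advance_up_P, advance_up_cup,
      advance_up_cap] <;> (try split_ifs) <;> simp [advance_down_bead, advance_down_P,
      advance_down_cup, advance_down_cap, advance_up_cap] <;> grind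
  | down i g be ab p =>
    cases g <;> simp only [next, rev, advance_down_bead, advance_down_P, advance_down_cup,
      advance_down_cap] <;> (try split_ifs) <;> simp [advance_up_bead, advance_up_P,
      advance_up_cup, advance_up_cap, advance_down_cup] <;> grind

/-- At an extremum the traveller changes to the other leg, so it never turns back on the spot. This
excludes the middle case when a journey is supposed to retrace itself. -/
theorem next_ne_rev (c : Traveller A) : c.next ≠ c.rev := by
  induction c using induction_advance with
  | stopped c hc => rw [next_of_stopped hc]; exact (rev_ne c).symm
  | up be i g ab p =>
    cases g <;> simp only [next, rev, advance_up_bead, advance_up_P, advance_up_cup,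
      advance_up_cap] <;> (try split_ifs) <;> simp <;> omega
  | down i g be ab p =>
    cases g <;> simp only [next, rev, advance_down_bead, advance_down_P, advance_down_cup,
      advance_down_cap] <;> (try split_ifs) <;> simp <;> omega

theorem next_ne_self {c : Traveller A} (h : ¬ c.Stopped) : c.next ≠ c := by
  induction c using induction_advance with
  | stopped c hc => exact absurd hc h
  | up be i g ab p =>
    cases g <;> simp only [next, advance_up_bead, advance_up_P, advance_up_cup,
      advance_up_cap] <;> (try split_ifs) <;> simp
  | down i g be ab p =>
    cases g <;> simp only [next, advance_down_bead, advance_down_P, advance_down_cup,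
      advance_down_cap] <;> (try split_ifs) <;> simp

theorem word_next (c : Traveller A) : c.next.word = c.word := by
  induction c using induction_advance with
  | stopped c hc => rw [next_of_stopped hc]
  | up be i g ab p =>
    cases g <;> simp only [next, advance_up_bead, advance_up_P, advance_up_cup,
      advance_up_cap] <;> (try split_ifs) <;> simp [word]
  | down i g be ab p =>
    cases g <;> simp only [next, advance_down_bead, advance_down_P, advance_down_cup,
      advance_down_cap] <;> (try split_ifs) <;> simp [word]

/-- The number of layers below the traveller. -/
def height (c : Traveller A) : ℕ := c.below.length

/-- The traveller is at one of the strands of the diagram. -/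
def OnStrand (n : ℕ) (c : Traveller A) : Prop := c.pos < wout n c.below.reverse

theorem OnStrand.next {n : ℕ} {c : Traveller A} (hf : Fits n c.word) (h : c.OnStrand n) :
    c.next.OnStrand n := by
  induction c using induction_advance with
  | stopped c hc => rwa [next_of_stopped hc]
  | up be i g ab p =>
    simp only [word, fits_append, Fits] at hf
    simp only [OnStrand] at h
    cases g <;> simp only [Traveller.next, advance_up_bead, advance_up_P, advance_up_cup,
      advance_up_cap, OnStrand, List.reverse_cons, wout_append, wout, inn_bead, inn_cup, inn_cap,
      inn_P, out_bead, out_cup, out_cap, out_P] at hf ⊢ <;> (try split_ifs) <;>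
      (try simp only [List.reverse_cons, wout_append, wout, inn_bead, inn_cup, inn_cap,
        inn_P, out_bead, out_cup, out_cap, out_P]) <;> omega
  | down i g be ab p =>
    simp only [word, List.reverse_cons, fits_append, Fits] at hf
    simp only [OnStrand, List.reverse_cons, wout_append, wout] at h
    cases g <;> simp only [Traveller.next, advance_down_bead, advance_down_P, advance_down_cup,
      advance_down_cap, OnStrand, List.reverse_cons, wout_append, wout, inn_bead, inn_cup, inn_cap,
      inn_P, out_bead, out_cup, out_cap, out_P] at hf h ⊢ <;> (try split_ifs) <;>
      (try simp only [List.reverse_cons, wout_append, wout, inn_bead, inn_cup, inn_cap,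
        inn_P, out_bead, out_cup, out_cap, out_P]) <;> omega

theorem events_add (s t : ℕ) (c : Traveller A) :
    events (s + t) c = events s c ++ events t (next^[s] c) := by
  induction s generalizing c with
  | zero => simp [events]
  | succ s ih => rw [Nat.succ_add, events, events, ih, List.append_assoc]; rfl

theorem iterate_next_of_stopped {c : Traveller A} (h : c.Stopped) (t : ℕ) : next^[t] c = c :=
  Function.iterate_fixed (next_of_stopped h) t

theorem events_of_stopped {c : Traveller A} (h : c.Stopped) (t : ℕ) : events t c = [] := by
  induction t with
  | zero => rfl
  | succ t ih => rw [events, next_of_stopped h, ih, advance_of_stopped h]; rfl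

/-- Once the journey has ended, nothing happens any more. -/
theorem events_eq_of_stopped {c : Traveller A} {s t : ℕ} (hs : (next^[s] c).Stopped)
    (ht : (next^[t] c).Stopped) : events s c = events t c := by
  wlog hst : s ≤ t generalizing s t
  · exact (this ht hs (by omega)).symm
  · obtain ⟨r, rfl⟩ := Nat.exists_eq_add_of_le hst
    rw [events_add, events_of_stopped hs, List.append_nil]

end Traveller

open Traveller

theorem journey_succ (w : List (Layer (CatGen A))) (t : ℕ) :
    journey w (t + 1) = (journey w t).next := Function.iterate_succ_apply' _ _ _

theorem journey_zero (w : List (Layer (CatGen A))) : journey w 0 = ⟨[], w, 0, true⟩ := rfl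

theorem journey_eq (w : List (Layer (CatGen A))) (t : ℕ) :
    journey w t = next^[t] ⟨[], w, 0, true⟩ := rfl

theorem flatMap_events (w : List (Layer (CatGen A))) (n : ℕ) :
    ((List.range n).flatMap fun t => (journey w t).advance.1) = events n ⟨[], w, 0, true⟩ := by
  induction n with
  | zero => rfl
  | succ n ih =>
    rw [List.range_succ, List.flatMap_append, ih, events_add]
    simp [events, journey_eq]

theorem word_journey (w : List (Layer (CatGen A))) (t : ℕ) : (journey w t).word = w := by
  induction t with
  | zero => rfl
  | succ t ih => rw [journey_succ, word_next, ih]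

theorem onStrand_journey {w : List (Layer (CatGen A))} (hw : Fits 1 w) (t : ℕ) :
    (journey w t).OnStrand 1 := by
  induction t with
  | zero => simp [journey, OnStrand, wout]
  | succ t ih => rw [journey_succ]; exact ih.next (by rwa [word_journey])

/-- Travellers in the same diagram are determined by height, position and direction. -/
theorem Traveller.eq_of_height {c d : Traveller A} (hw : c.word = d.word)
    (hh : c.height = d.height) (hp : c.pos = d.pos) (hu : c.up = d.up) : c = d := by
  obtain ⟨be, ab, p, u⟩ := c
  obtain ⟨be', ab', p', u'⟩ := d
  obtain ⟨h1, h2⟩ := List.append_inj hw (by simpa [height] using hh)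
  simp only [mk.injEq]
  exact ⟨List.reverse_injective h1, h2, hp, hu⟩

/-- A journey never comes back to its start. -/
theorem journey_ne_start {w : List (Layer (CatGen A))} {t : ℕ}
    (h : ¬ (journey w t).Stopped) : journey w (t + 1) ≠ journey w 0 := by
  intro e
  have h1 := next_rev_next h
  -- The reversed start faces the bottom end and does not move. By reversibility the predecessor of
  -- a return to the start would be the start itself.
  have h2 : (journey w 0).rev.Stopped := .inr ⟨rfl, rfl⟩
  rw [← journey_succ, e, next_of_stopped h2] at h1
  rw [journey_succ, ← rev_injective h1] at e
  refine next_ne_self (rev_injective h1 ▸ h) e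

/-- A journey never visits the same point twice in the same direction. -/
theorem journey_injective {w : List (Layer (CatGen A))} {s t : ℕ} (hst : s < t)
    (h : ∀ r < t, ¬ (journey w r).Stopped) : journey w s ≠ journey w t := by
  induction s generalizing t with
  | zero =>
    obtain ⟨t, rfl⟩ : ∃ r, t = r + 1 := ⟨t - 1, by omega⟩
    exact (journey_ne_start (h t (by omega))).symm
  | succ s ih =>
    obtain ⟨t, rfl⟩ : ∃ r, t = r + 1 := ⟨t - 1, by omega⟩
    intro e
    -- A coincidence at two times is moved back one step by reversibility, until the earlier time is
    -- zero.
    have h1 := next_rev_next (h s (by omega))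
    have h2 := next_rev_next (h t (by omega))
    rw [← journey_succ, e, journey_succ, h2] at h1
    exact ih (by omega) (fun r hr => h r (by omega)) (rev_injective h1).symm

/-- A journey never visits the same point twice in opposite directions. -/
theorem journey_ne_rev {w : List (Layer (CatGen A))} {s t : ℕ} (hst : s ≤ t)
    (h : ∀ r < t, ¬ (journey w r).Stopped) : journey w s ≠ (journey w t).rev := by
  induction hn : t - s using Nat.strong_induction_on generalizing s t with
  | _ n ih =>
    intro e
    -- Opposite travellers at times `s` and `t` are opposite at `s + 1` and `t - 1` as well. The two
    -- times approach each other until they are adjacent or equal, and both are impossible.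
    rcases Nat.lt_trichotomy (s + 1) t with hs | rfl | hs
    · obtain ⟨t, rfl⟩ : ∃ r, t = r + 1 := ⟨t - 1, by omega⟩
      have h1 := next_rev_next (h t (by omega))
      rw [← journey_succ, ← e, ← journey_succ] at h1
      exact ih (t - (s + 1)) (by omega) (by omega) (fun r hr => h r (by omega)) rfl h1
    · rw [journey_succ] at e
      exact next_ne_rev _ (by rw [← rev_rev (journey w s).next, ← e])
    · obtain rfl : s = t := by omega
      exact rev_ne _ e.symm

/-- A journey visits every point at most once. -/
theorem journey_point_injective {w : List (Layer (CatGen A))} {s t : ℕ} (hst : s < t)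
    (h : ∀ r < t, ¬ (journey w r).Stopped) (hh : (journey w s).height = (journey w t).height) :
    (journey w s).pos ≠ (journey w t).pos := by
  intro hp
  have hw : (journey w s).word = (journey w t).word := by rw [word_journey, word_journey]
  by_cases hu : (journey w s).up = (journey w t).up
  · exact journey_injective hst h (eq_of_height hw hh hp hu)
  · refine journey_ne_rev hst.le h (eq_of_height hw hh hp ?_)
    simp only [rev]
    revert hu
    cases (journey w s).up <;> cases (journey w t).up <;> simp

/-- This counts the points of the diagram, the pigeonholes for the bound on the length of the
journey. -/
theorem sum_widths {G : Type*} [Signature G] (n : ℕ) (w : List (Layer G)) :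
    (widths n w).sum = ∑ h ∈ Finset.range (w.length + 1), wout n (w.take h) := by
  induction w generalizing n with
  | nil => simp [widths, wout]
  | cons l w ih =>
    rw [widths, List.sum_cons, ih, List.length_cons, Finset.sum_range_succ' _ (w.length + 1),
      add_comm]
    rfl

theorem below_reverse_journey (w : List (Layer (CatGen A))) (t : ℕ) :
    (journey w t).below.reverse = w.take (journey w t).height := by
  have h := congrArg (List.take (journey w t).height) (word_journey w t)
  rw [word, height, ← List.length_reverse, List.take_left] at h
  rw [height, ← List.length_reverse]
  exact h

theorem height_journey_le (w : List (Layer (CatGen A))) (t : ℕ) :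
    (journey w t).height ≤ w.length := by
  have h := congrArg List.length (word_journey w t)
  simp only [word, List.length_append, List.length_reverse] at h
  simp only [height]
  omega

/-- The journey ends after at most as many steps as there are points. -/
theorem exists_stopped {w : List (Layer (CatGen A))} (hw : Fits 1 w) :
    ∃ t ≤ (widths 1 w).sum, (journey w t).Stopped := by
  by_contra! hc
  set N := (widths 1 w).sum with hN
  let pts : Finset (Σ _ : ℕ, ℕ) :=
    (Finset.range (w.length + 1)).sigma fun h => Finset.range (wout 1 (w.take h))
  have hcard : pts.card = N := by
    rw [hN, sum_widths, Finset.card_sigma]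
    simp
  let f : ℕ → Σ _ : ℕ, ℕ := fun t => ⟨(journey w t).height, (journey w t).pos⟩
  have hmaps : ∀ t ∈ Finset.range (N + 1), f t ∈ pts := by
    intro t _
    have h1 := onStrand_journey hw t
    rw [OnStrand, below_reverse_journey] at h1
    simp only [pts, f, Finset.mem_sigma, Finset.mem_range]
    exact ⟨by have := height_journey_le w t; omega, h1⟩
  obtain ⟨s, hs, t, ht, hne, he⟩ := Finset.exists_ne_map_eq_of_card_lt_of_maps_to
    (by rw [hcard, Finset.card_range]; omega) hmaps
  wlog hst : s < t generalizing s t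
  · exact this t ht s hs hne.symm he.symm (by omega)
  · simp only [Finset.mem_range] at hs ht
    simp only [f, Sigma.mk.injEq, heq_eq_eq] at he
    exact journey_point_injective hst (fun r hr => hc r (by omega)) he.1 he.2

/-- The end of the journey is at the top. -/
theorem journey_stopped {w : List (Layer (CatGen A))} (hw : Fits 1 w) {t : ℕ}
    (ht : (journey w t).Stopped) : (journey w t).up = true ∧ (journey w t).above = [] := by
  obtain h | ⟨h1, h2⟩ := ht
  · exact h
  · exfalso
    classical
    -- At the first arrival at the bottom end the traveller would be at the only bottom point, hence
    -- the reverse of the start. A journey never visits a point in opposite directions.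
    have hex : ∃ t, (journey w t).up = false ∧ (journey w t).below = [] := ⟨t, h1, h2⟩
    have hmin := fun r hr => Nat.find_min hex (m := r) hr
    obtain ⟨h1, h2⟩ := Nat.find_spec hex
    set s := Nat.find hex
    have hns : ∀ r < s, ¬ (journey w r).Stopped := by
      rintro r hr (h | h)
      · have h3 := iterate_next_of_stopped (.inl h) (s - r)
        rw [journey_eq, ← Function.iterate_add_apply, ← journey_eq, ← journey_eq,
          Nat.sub_add_cancel hr.le] at h3
        rw [h3, h.1] at h1
        cases h1
      · exact hmin r hr h
    refine journey_ne_rev (Nat.zero_le s) hns (eq_of_height ?_ ?_ ?_ ?_)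
    · have := word_journey w s
      rw [word_journey]
      exact this.symm
    · simp [height, rev, h2, journey_zero]
    · have := onStrand_journey hw s
      rw [OnStrand, h2] at this
      simp only [List.reverse_nil, wout, Nat.lt_one_iff] at this
      simp [rev, this, journey_zero]
    · simp [rev, h1, journey_zero]

/-- The events of a complete journey. -/
theorem events_eq_strandEvents {w : List (Layer (CatGen A))} (hw : Fits 1 w) {t : ℕ}
    (ht : (journey w t).Stopped) : events t ⟨[], w, 0, true⟩ = strandEvents w := by
  rw [strandEvents, flatMap_events]
  obtain ⟨s, hs, h⟩ := exists_stopped hw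
  refine events_eq_of_stopped ht ?_
  obtain ⟨r, hr⟩ := Nat.exists_eq_add_of_le' hs
  rw [hr, Function.iterate_add_apply, ← journey_eq, iterate_next_of_stopped h]
  exact h

end Journey

/-! ### Replacing a block of layers under a journey -/

section Simulation

variable {A : Type*}

namespace Traveller

/-- The traveller in a diagram with further layers below and above. -/
def frame (b a : List (Layer (CatGen A))) (c : Traveller A) : Traveller A :=
  ⟨c.below ++ b, c.above ++ a, c.pos, c.up⟩

/-- A traveller that enters a block, upwards at its bottom or downwards at its top. -/
def enter (x : List (Layer (CatGen A))) (p : ℕ) : Bool → Traveller A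
  | true => ⟨[], x, p, true⟩
  | false => ⟨x.reverse, [], p, false⟩

theorem advance_frame {c : Traveller A} (h : ¬ c.Stopped) (b a : List (Layer (CatGen A))) :
    (frame b a c).advance = (c.advance.1, frame b a c.next) := by
  induction c using induction_advance with
  | stopped c hc => exact absurd hc h
  | up be i g ab p =>
    cases g <;> simp only [next, frame, List.cons_append, advance_up_bead, advance_up_P,
      advance_up_cup, advance_up_cap] <;> (try split_ifs) <;> rfl
  | down i g be ab p =>
    cases g <;> simp only [next, frame, List.cons_append, advance_down_bead, advance_down_P,
      advance_down_cup, advance_down_cap] <;> (try split_ifs) <;> rfl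

theorem Stopped.of_frame {c : Traveller A} {b a : List (Layer (CatGen A))}
    (h : (frame b a c).Stopped) : c.Stopped := by
  obtain ⟨h1, h2⟩ | ⟨h1, h2⟩ := h
  · exact .inl ⟨h1, (List.append_eq_nil_iff.1 h2).1⟩
  · exact .inr ⟨h1, (List.append_eq_nil_iff.1 h2).1⟩

/-- A journey through a block takes place in the same way in a larger diagram. -/
theorem exists_iterate_frame (b a : List (Layer (CatGen A))) {s : ℕ} {c : Traveller A}
    (h : (next^[s] c).Stopped) : ∃ r, next^[r] (frame b a c) = frame b a (next^[s] c) ∧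
      events r (frame b a c) = events s c ∧ (∀ q < r, ¬ (next^[q] (frame b a c)).Stopped) ∧
      (¬ c.Stopped → 0 < r) := by
  induction s generalizing c with
  | zero => exact ⟨0, rfl, rfl, by simp, fun hc => absurd h hc⟩
  | succ s ih =>
    by_cases hc : c.Stopped
    · exact ⟨0, by rw [iterate_next_of_stopped hc]; rfl, by rw [events_of_stopped hc]; rfl,
        by simp, fun h => absurd hc h⟩
    · obtain ⟨r, h1, h2, h3, -⟩ := ih h
      have e : (frame b a c).next = frame b a c.next := by rw [next, advance_frame hc]
      refine ⟨r + 1, ?_, ?_, ?_, fun _ => by omega⟩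
      · rw [Function.iterate_succ_apply, e, h1]; rfl
      · rw [events, events, e, h2, advance_frame hc]
      · intro q hq
        cases q with
        | zero => exact fun h => hc h.of_frame
        | succ q => rw [Function.iterate_succ_apply, e]; exact h3 q (by omega)

theorem halfTurns_append (l l' : List (StrandEvent A)) :
    halfTurns (l ++ l') = halfTurns l + halfTurns l' := by
  induction l with
  | nil => simp [halfTurns]
  | cons e l ih => cases e <;> simp [halfTurns, ih, add_assoc]

/-- Each half turn reverses the direction. The parity is needed where two beads are multiplied:
whether `s ^ q` preserves the order depends on it. -/
theorem even_halfTurns_advance (c : Traveller A) :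
    Even (halfTurns c.advance.1) ↔ c.up = c.next.up := by
  induction c using induction_advance with
  | stopped c hc => rw [next_of_stopped hc, advance_of_stopped hc]; simp [halfTurns]
  | up be i g ab p =>
    cases g <;> simp only [next, advance_up_bead, advance_up_P, advance_up_cup,
      advance_up_cap] <;> (try split_ifs) <;> simp [halfTurns]
  | down i g be ab p =>
    cases g <;> simp only [next, advance_down_bead, advance_down_P, advance_down_cup,
      advance_down_cap] <;> (try split_ifs) <;> simp [halfTurns]

theorem even_halfTurns_events (t : ℕ) (c : Traveller A) :
    Even (halfTurns (events t c)) ↔ c.up = (next^[t] c).up := by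
  induction t generalizing c with
  | zero => simp [events, halfTurns]
  | succ t ih =>
    rw [events, halfTurns_append, Int.even_add, even_halfTurns_advance, ih,
      Function.iterate_succ_apply]
    cases c.up <;> cases c.next.up <;> cases (next^[t] c.next).up <;> simp

/-- A relation between lists of events that may depend on the direction at the beginning, and
is compatible with concatenation. -/
structure Congruence (R : Bool → List (StrandEvent A) → List (StrandEvent A) → Prop) : Prop where
  refl : ∀ u l, R u l l
  append : ∀ u u' l₁ l₁' l₂ l₂', (Even (halfTurns l₁) ↔ u = u') → R u l₁ l₁' → R u' l₂ l₂' →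
    R u (l₁ ++ l₂) (l₁' ++ l₂')

/-- Both blocks are traversed from every entry to the same exit, with related events. -/
def Simulates (R : Bool → List (StrandEvent A) → List (StrandEvent A) → Prop)
    (x y : List (Layer (CatGen A))) : Prop :=
  ∀ p u, ∃ s t, (next^[s] (enter x p u)).Stopped ∧ (next^[t] (enter y p u)).Stopped ∧
    (next^[s] (enter x p u)).up = (next^[t] (enter y p u)).up ∧
    (next^[s] (enter x p u)).pos = (next^[t] (enter y p u)).pos ∧
    R u (events s (enter x p u)) (events t (enter y p u))

/-- The traveller has arrived at the top. -/
def AtTop (c : Traveller A) : Prop := c.up = true ∧ c.above = []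

/-- Corresponding travellers outside of the blocks `x` and `y`. -/
inductive Corresponds (x y : List (Layer (CatGen A))) : Traveller A → Traveller A → Prop
  | below (c : Traveller A) (v : List (Layer (CatGen A))) :
      Corresponds x y (frame [] (x ++ v) c) (frame [] (y ++ v) c)
  | above (c : Traveller A) (b : List (Layer (CatGen A))) :
      Corresponds x y (frame (x.reverse ++ b) [] c) (frame (y.reverse ++ b) [] c)

theorem word_iterate (c : Traveller A) (t : ℕ) : (next^[t] c).word = c.word := by
  induction t generalizing c with
  | zero => rfl
  | succ t ih => rw [Function.iterate_succ_apply, ih, word_next]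

theorem eq_exit {x : List (Layer (CatGen A))} {c : Traveller A} (h : c.Stopped)
    (hw : c.word = x) : c = ⟨if c.up then x.reverse else [], if c.up then [] else x,
      c.pos, c.up⟩ := by
  obtain ⟨be, ab, p, u⟩ := c
  subst hw
  obtain ⟨rfl, rfl⟩ | ⟨rfl, rfl⟩ := h <;> simp [word]

theorem word_enter (x : List (Layer (CatGen A))) (p : ℕ) (u : Bool) : (enter x p u).word = x := by
  cases u <;> simp [enter, word]

theorem corresponds_exit {x y : List (Layer (CatGen A))} {c d : Traveller A}
    (hc : c.Stopped) (hd : d.Stopped) (hcw : c.word = x) (hdw : d.word = y) (hu : c.up = d.up)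
    (hp : c.pos = d.pos) (b a : List (Layer (CatGen A))) :
    Corresponds x y (frame b a c) (frame b a d) := by
  rw [eq_exit hc hcw, eq_exit hd hdw, hu, hp]
  cases d.up with
  | true => simpa [frame] using Corresponds.above (x := x) (y := y) ⟨[], a, d.pos, true⟩ b
  | false => simpa [frame] using Corresponds.below (x := x) (y := y) ⟨b, [], d.pos, false⟩ a

theorem enter_not_stopped {x : List (Layer (CatGen A))} (hx : x ≠ []) (p : ℕ) (u : Bool) :
    ¬ (enter x p u).Stopped := by
  cases u <;> simp [enter, Stopped, hx]

/-- Outside the blocks the two travellers move in parallel; a passage through the blocks is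
exchanged as a whole, since it leads from the same entry to the same exit. A journey may return to
the block many times, hence the induction on the remaining time. -/
theorem Corresponds.exists_events {R : Bool → List (StrandEvent A) → List (StrandEvent A) → Prop}
    (hR : Congruence R)
    {x y : List (Layer (CatGen A))} (hx : x ≠ []) (hs : Simulates R x y) {n : ℕ}
    {c d : Traveller A} (h : Corresponds x y c d) (hn : (next^[n] c).AtTop) :
    ∃ m, (next^[m] d).AtTop ∧ R c.up (events n c) (events m d) := by
  induction n using Nat.strong_induction_on generalizing c d with
  | _ n ih =>
    have step : ∀ c₀ : Traveller A, ∀ b a b' a', ¬ c₀.Stopped →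
        Corresponds x y (frame b a c₀.next) (frame b' a' c₀.next) →
        ¬ (frame b a c₀).AtTop → (next^[n] (frame b a c₀)).AtTop →
        ∃ m, (next^[m] (frame b' a' c₀)).AtTop ∧
          R c₀.up (events n (frame b a c₀)) (events m (frame b' a' c₀)) := by
      intro c₀ b a b' a' hc h hne hn
      cases n with
      | zero => exact absurd hn hne
      | succ n =>
        have e : ∀ b a, (frame b a c₀).next = frame b a c₀.next := fun b a => by
          rw [next, advance_frame hc]
        rw [Function.iterate_succ_apply, e] at hn
        obtain ⟨m, h1, h2⟩ := ih n (by omega) h hn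
        refine ⟨m + 1, by rwa [Function.iterate_succ_apply, e], ?_⟩
        rw [events, events, e, e, advance_frame hc, advance_frame hc]
        exact hR.append _ _ _ _ _ _ (even_halfTurns_advance c₀) (hR.refl _ _) h2
    -- A passage through `x` takes at least one step because `x` is not empty, so the remaining time
    -- decreases. The block `y` may be empty.
    have block : ∀ b a p u, (next^[n] (frame b a (enter x p u))).AtTop →
        ∃ m, (next^[m] (frame b a (enter y p u))).AtTop ∧
          R u (events n (frame b a (enter x p u))) (events m (frame b a (enter y p u))) := by
      intro b a p u hn
      obtain ⟨s, t, h1, h2, h3, h4, h5⟩ := hs p u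
      obtain ⟨s', s1, s2, s3, s4⟩ := exists_iterate_frame b a h1
      obtain ⟨t', t1, t2, -, -⟩ := exists_iterate_frame b a h2
      have hs' := s4 (enter_not_stopped hx p u)
      obtain ⟨r, rfl⟩ : ∃ r, n = s' + r := by
        refine Nat.exists_eq_add_of_le (not_lt.1 fun hlt => s3 n hlt (.inl hn))
      rw [add_comm, Function.iterate_add_apply, s1] at hn
      obtain ⟨m, m1, m2⟩ := ih r (by omega) (corresponds_exit h1 h2
        (by rw [word_iterate, word_enter]) (by rw [word_iterate, word_enter]) h3 h4 b a) hn
      refine ⟨t' + m, by rwa [add_comm, Function.iterate_add_apply, t1], ?_⟩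
      rw [events_add, events_add, s1, t1, s2, t2]
      refine hR.append _ _ _ _ _ _ ?_ h5 m2
      rw [even_halfTurns_events]
      cases u <;> rfl
    cases h with
    | below c v =>
      by_cases hc : c.Stopped
      · obtain ⟨be, ab, p, u⟩ := c
        obtain ⟨rfl, rfl⟩ | ⟨rfl, rfl⟩ := hc
        · have e : ∀ z, frame [] (z ++ v) ⟨be, [], p, true⟩ = frame be v (enter z p true) := by
            intro z; simp [frame, enter]
          rw [e] at hn
          rw [e, e]
          exact block _ _ _ _ hn
        · have h1 : (frame [] (x ++ v) ⟨[], ab, p, false⟩).Stopped := .inr ⟨rfl, rfl⟩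
          rw [iterate_next_of_stopped h1] at hn
          cases hn.1
      · exact step c _ _ _ _ hc (.below _ _) (fun h => hx (by
          have := h.2
          simp only [frame, List.append_eq_nil_iff] at this
          exact this.2.1)) hn
    | above c b =>
      by_cases hc : c.Stopped
      · obtain ⟨be, ab, p, u⟩ := c
        obtain ⟨rfl, rfl⟩ | ⟨rfl, rfl⟩ := hc
        · refine ⟨0, ⟨rfl, rfl⟩, ?_⟩
          rw [events_of_stopped (.inl ⟨rfl, rfl⟩)]
          exact hR.refl _ []
        · have e : ∀ z : List (Layer (CatGen A)), frame (z.reverse ++ b) [] ⟨[], ab, p, false⟩ =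
              frame b ab (enter z p false) := by
            intro z; simp [frame, enter]
          rw [e] at hn
          rw [e, e]
          exact block _ _ _ _ hn
      · exact step c _ _ _ _ hc (.above _ _) (fun h => hc (.inl ⟨h.1, by
          have := h.2
          simpa only [frame, List.append_nil] using this⟩)) hn

/-- Replacing a block by one that it simulates changes the events of the whole strand to
related events. -/
theorem Simulates.strandEvents {R : Bool → List (StrandEvent A) → List (StrandEvent A) → Prop}
    (hR : Congruence R)
    {x y : List (Layer (CatGen A))} (hx : x ≠ []) (hs : Simulates R x y)
    {u v : List (Layer (CatGen A))} (hfx : Fits 1 (u ++ x ++ v)) (hfy : Fits 1 (u ++ y ++ v)) :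
    R true (strandEvents (u ++ x ++ v)) (strandEvents (u ++ y ++ v)) := by
  obtain ⟨t, -, ht⟩ := exists_stopped hfx
  have e : ∀ z, frame [] (z ++ v) ⟨[], u, 0, true⟩ = ⟨[], u ++ z ++ v, 0, true⟩ := by
    simp [frame]
  have h1 : Corresponds x y ⟨[], u ++ x ++ v, 0, true⟩ ⟨[], u ++ y ++ v, 0, true⟩ := by
    rw [← e x, ← e y]
    exact .below _ _
  obtain ⟨m, m1, m2⟩ := h1.exists_events hR hx hs (journey_stopped hfx ht)
  rwa [events_eq_strandEvents hfx ht, events_eq_strandEvents hfy (.inl m1)] at m2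

end Traveller

end Simulation

/-! ### The local moves preserve the concentrated product and the number of half turns -/

section MoveEvents

namespace Traveller

variable {A : Type*} {be ab : List (Layer (CatGen A))} {i p : ℕ} {a : A}

/-- One rule for every relative position of traveller and piece. With these rules a journey through
a short block can be computed for symbolic positions. -/
theorem up_bead_self (h : p = i) : advance ⟨be, (i, .bead a) :: ab, p, true⟩ =
    ([.bead a], ⟨(i, .bead a) :: be, ab, p, true⟩) := by
  rw [advance_up_bead, if_pos h]

theorem up_bead_left (h : p < i) : advance ⟨be, (i, .bead a) :: ab, p, true⟩ =
    ([], ⟨(i, .bead a) :: be, ab, p, true⟩) := by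
  rw [advance_up_bead, if_neg h.ne]

theorem up_bead_right (h : i < p) : advance ⟨be, (i, .bead a) :: ab, p, true⟩ =
    ([], ⟨(i, .bead a) :: be, ab, p, true⟩) := by
  rw [advance_up_bead, if_neg h.ne']

theorem up_P_fst (h : p = i) : advance ⟨be, (i, .P) :: ab, p, true⟩ =
    ([], ⟨(i, .P) :: be, ab, i + 1, true⟩) := by
  rw [advance_up_P, if_pos h]

theorem up_P_snd (h : p = i + 1) : advance ⟨be, (i, .P) :: ab, p, true⟩ =
    ([], ⟨(i, .P) :: be, ab, i, true⟩) := by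
  rw [advance_up_P, if_neg (by omega), if_pos h]

theorem up_P_left (h : p < i) : advance ⟨be, (i, .P) :: ab, p, true⟩ =
    ([], ⟨(i, .P) :: be, ab, p, true⟩) := by
  rw [advance_up_P, if_neg (by omega), if_neg (by omega)]

theorem up_P_right (h : i + 1 < p) : advance ⟨be, (i, .P) :: ab, p, true⟩ =
    ([], ⟨(i, .P) :: be, ab, p, true⟩) := by
  rw [advance_up_P, if_neg (by omega), if_neg (by omega)]

theorem up_cup_left (h : p < i) : advance ⟨be, (i, .cup) :: ab, p, true⟩ =
    ([], ⟨(i, .cup) :: be, ab, p, true⟩) := by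
  rw [advance_up_cup, if_pos h]

theorem up_cup_right (h : i ≤ p) : advance ⟨be, (i, .cup) :: ab, p, true⟩ =
    ([], ⟨(i, .cup) :: be, ab, p + 2, true⟩) := by
  rw [advance_up_cup, if_neg (by omega)]

theorem up_cap_fst (h : p = i) : advance ⟨be, (i, .cap) :: ab, p, true⟩ =
    ([.turn 1], ⟨be, (i, .cap) :: ab, i + 1, false⟩) := by
  rw [advance_up_cap, if_pos h]

theorem up_cap_snd (h : p = i + 1) : advance ⟨be, (i, .cap) :: ab, p, true⟩ =
    ([.turn (-1)], ⟨be, (i, .cap) :: ab, i, false⟩) := by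
  rw [advance_up_cap, if_neg (by omega), if_pos h]

theorem up_cap_left (h : p < i) : advance ⟨be, (i, .cap) :: ab, p, true⟩ =
    ([], ⟨(i, .cap) :: be, ab, p, true⟩) := by
  rw [advance_up_cap, if_neg (by omega), if_neg (by omega), if_pos h]

theorem up_cap_right (h : i + 1 < p) : advance ⟨be, (i, .cap) :: ab, p, true⟩ =
    ([], ⟨(i, .cap) :: be, ab, p - 2, true⟩) := by
  rw [advance_up_cap, if_neg (by omega), if_neg (by omega), if_neg (by omega)]

theorem down_bead_self (h : p = i) : advance ⟨(i, .bead a) :: be, ab, p, false⟩ =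
    ([.bead a], ⟨be, (i, .bead a) :: ab, p, false⟩) := by
  rw [advance_down_bead, if_pos h]

theorem down_bead_left (h : p < i) : advance ⟨(i, .bead a) :: be, ab, p, false⟩ =
    ([], ⟨be, (i, .bead a) :: ab, p, false⟩) := by
  rw [advance_down_bead, if_neg h.ne]

theorem down_bead_right (h : i < p) : advance ⟨(i, .bead a) :: be, ab, p, false⟩ =
    ([], ⟨be, (i, .bead a) :: ab, p, false⟩) := by
  rw [advance_down_bead, if_neg h.ne']

theorem down_P_fst (h : p = i) : advance ⟨(i, .P) :: be, ab, p, false⟩ =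
    ([], ⟨be, (i, .P) :: ab, i + 1, false⟩) := by
  rw [advance_down_P, if_pos h]

theorem down_P_snd (h : p = i + 1) : advance ⟨(i, .P) :: be, ab, p, false⟩ =
    ([], ⟨be, (i, .P) :: ab, i, false⟩) := by
  rw [advance_down_P, if_neg (by omega), if_pos h]

theorem down_P_left (h : p < i) : advance ⟨(i, .P) :: be, ab, p, false⟩ =
    ([], ⟨be, (i, .P) :: ab, p, false⟩) := by
  rw [advance_down_P, if_neg (by omega), if_neg (by omega)]

theorem down_P_right (h : i + 1 < p) : advance ⟨(i, .P) :: be, ab, p, false⟩ =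
    ([], ⟨be, (i, .P) :: ab, p, false⟩) := by
  rw [advance_down_P, if_neg (by omega), if_neg (by omega)]

theorem down_cap_left (h : p < i) : advance ⟨(i, .cap) :: be, ab, p, false⟩ =
    ([], ⟨be, (i, .cap) :: ab, p, false⟩) := by
  rw [advance_down_cap, if_pos h]

theorem down_cap_right (h : i ≤ p) : advance ⟨(i, .cap) :: be, ab, p, false⟩ =
    ([], ⟨be, (i, .cap) :: ab, p + 2, false⟩) := by
  rw [advance_down_cap, if_neg (by omega)]

theorem down_cup_fst (h : p = i) : advance ⟨(i, .cup) :: be, ab, p, false⟩ =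
    ([.turn (-1)], ⟨(i, .cup) :: be, ab, i + 1, true⟩) := by
  rw [advance_down_cup, if_pos h]

theorem down_cup_snd (h : p = i + 1) : advance ⟨(i, .cup) :: be, ab, p, false⟩ =
    ([.turn 1], ⟨(i, .cup) :: be, ab, i, true⟩) := by
  rw [advance_down_cup, if_neg (by omega), if_pos h]

theorem down_cup_left (h : p < i) : advance ⟨(i, .cup) :: be, ab, p, false⟩ =
    ([], ⟨be, (i, .cup) :: ab, p, false⟩) := by
  rw [advance_down_cup, if_neg (by omega), if_neg (by omega), if_pos h]

theorem down_cup_right (h : i + 1 < p) : advance ⟨(i, .cup) :: be, ab, p, false⟩ =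
    ([], ⟨be, (i, .cup) :: ab, p - 2, false⟩) := by
  rw [advance_down_cup, if_neg (by omega), if_neg (by omega), if_neg (by omega)]

end Traveller

open Traveller

variable (k : Type*) {A : Type*} [CommRing k] [Ring A] [HopfAlgebra k A]

/-- Lists of events with the same number of half turns and the same product of beads.  The
number of half turns before an upward piece of the strand is even. -/
def SameEvents (u : Bool) (l l' : List (StrandEvent A)) : Prop :=
  halfTurns l = halfTurns l' ∧
    ∀ q, (Even q ↔ u = true) → concentrate k q l = concentrate k q l'

theorem concentrate_append (q : ℤ) (l l' : List (StrandEvent A)) :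
    concentrate k q (l ++ l') = concentrate k q l * concentrate k (q + halfTurns l) l' := by
  induction l generalizing q with
  | nil => simp [concentrate, halfTurns]
  | cons e l ih => cases e <;> simp [concentrate, halfTurns, ih, mul_assoc, add_assoc]

/-- The half turns of the first pieces agree, so the second pieces start with the same exponent, and
its parity is again the one that belongs to the direction. -/
theorem SameEvents.congruence : Congruence (SameEvents k (A := A)) where
  refl u l := ⟨rfl, fun _ _ => rfl⟩
  append u u' l₁ l₁' l₂ l₂' h h₁ h₂ := by
    refine ⟨by rw [halfTurns_append, halfTurns_append, h₁.1, h₂.1], fun q hq => ?_⟩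
    rw [concentrate_append, concentrate_append, h₁.2 q hq, h₁.1, h₂.2]
    rw [← h₁.1, Int.even_add, hq, h]
    cases u <;> cases u' <;> simp

/-- The antipode as a permutation. -/
noncomputable def antipEquiv (hs : Function.Bijective (antip k (A := A))) : Equiv.Perm A :=
  Equiv.ofBijective _ hs

variable {k} in
theorem antipPow_eq (hs : Function.Bijective (antip k (A := A))) (q : ℤ) (a : A) :
    antipPow k q a = (antipEquiv k hs ^ q) a := by
  have h : ∀ n : ℕ, (antip k (A := A))^[n] a = (antipEquiv k hs ^ n) a := fun n => by
    rw [Equiv.Perm.coe_pow]; rfl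
  cases q with
  | ofNat n => exact h n
  | negSucc n =>
    have e : Function.invFun (antip k (A := A)) = (antipEquiv k hs)⁻¹ := by
      funext b
      rw [Equiv.Perm.eq_inv_iff_eq]
      exact Function.invFun_eq (hs.2 b)
    rw [antipPow, e, zpow_negSucc, ← inv_pow, Equiv.Perm.coe_pow]

variable {k} in
theorem antipPow_add_one (hs : Function.Bijective (antip k (A := A))) (q : ℤ) (a : A) :
    antipPow k (q + 1) a = antipPow k q (antip k a) := by
  rw [antipPow_eq hs, antipPow_eq hs, zpow_add_one]; rfl

variable {k} in
theorem antipPow_sub_one (hs : Function.Bijective (antip k (A := A))) (q : ℤ) (a : A) :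
    antipPow k (q - 1) (antip k a) = antipPow k q a := by
  rw [← antipPow_add_one hs, sub_add_cancel]

variable {k} in
/-- The powers of the antipode as linear maps. -/
theorem antipPow_isLinearMap (hs : Function.Bijective (antip k (A := A))) (q : ℤ) :
    IsLinearMap k (antipPow k (A := A) q) := by
  have h : antipPow k (A := A) q =
      ((LinearEquiv.ofBijective (HopfAlgebra.antipode k (A := A)) hs) ^ q : A ≃ₗ[k] A) := by
    funext a
    have e : ∀ q : ℤ, ∀ a, ((LinearEquiv.ofBijective (HopfAlgebra.antipode k (A := A)) hs) ^ q :
        A ≃ₗ[k] A) a = (antipEquiv k hs ^ q) a := by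
      intro q
      induction q using Int.induction_on with
      | zero => intro a; rfl
      | succ i hi => intro a; rw [zpow_add_one, zpow_add_one]; exact hi _
      | pred i hi =>
        intro a
        rw [zpow_sub_one, zpow_sub_one]
        refine (hi _).trans (congrArg _ ?_)
        rw [Equiv.Perm.eq_inv_iff_eq]
        exact (LinearEquiv.ofBijective (HopfAlgebra.antipode k (A := A)) hs).apply_symm_apply a
    rw [antipPow_eq hs, e]
  rw [h]
  exact LinearMap.isLinear (LinearEquiv.toLinearMap _)

variable {k} in
theorem antipPow_one (hs : Function.Bijective (antip k (A := A))) (q : ℤ) :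
    antipPow k q (1 : A) = 1 := by
  have h1 : antip k (1 : A) = 1 := HopfAlgebra.antipode_one
  induction q using Int.induction_on with
  | zero => rfl
  | succ i hi => rw [antipPow_add_one hs, h1, hi]
  | pred i hi =>
    have := antipPow_sub_one hs (-(i : ℤ)) (1 : A)
    rw [h1] at this
    rw [this, hi]

variable {k} in
-- The antipode reverses products. This matches the fact that a traveller going down, with `q` odd,
-- meets two stacked beads in the opposite order.
theorem antipPow_mul (hs : Function.Bijective (antip k (A := A))) (q : ℤ) :
    (Even q → ∀ a b : A, antipPow k q (a * b) = antipPow k q a * antipPow k q b) ∧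
    (¬ Even q → ∀ a b : A, antipPow k q (a * b) = antipPow k q b * antipPow k q a) := by
  have h1 : ∀ a b : A, antip k (a * b) = antip k b * antip k a :=
    HopfAlgebra.antipode_mul_antidistrib
  induction q using Int.induction_on with
  | zero => exact ⟨fun _ _ _ => rfl, fun h => absurd (by decide) h⟩
  | succ i hi =>
    simp only [antipPow_add_one hs, h1, Int.even_add_one, not_not]
    exact ⟨fun h a b => hi.2 h _ _, fun h a b => hi.1 h _ _⟩
  | pred i hi =>
    have hp : Even (-(i : ℤ) - 1) ↔ ¬ Even (-(i : ℤ)) := by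
      simp [Int.even_sub_one]
    refine ⟨fun h a b => ?_, fun h a b => ?_⟩
    · obtain ⟨a, rfl⟩ := hs.2 a
      obtain ⟨b, rfl⟩ := hs.2 b
      rw [← h1, antipPow_sub_one hs, antipPow_sub_one hs, antipPow_sub_one hs]
      exact hi.2 (hp.1 h) _ _
    · obtain ⟨a, rfl⟩ := hs.2 a
      obtain ⟨b, rfl⟩ := hs.2 b
      rw [← h1, antipPow_sub_one hs, antipPow_sub_one hs, antipPow_sub_one hs]
      exact hi.1 (by rwa [hp, not_not] at h) _ _

variable {k} in
theorem CatMove.simulates_exchange (i j : ℕ) (g h : CatGen A) :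
    Simulates (SameEvents k (A := A)) [(i, g), (i + out g + j, h)]
      [(i + inn g + j, h), (i, g)] := by
  intro p u
  -- More steps than necessary are harmless, since a traveller that has left the block stands still.
  -- At most three are needed: through one piece, around in the other, and back.
  refine ⟨4, 4, ?_⟩
  -- The position of the right piece as seen from the side on which the traveller enters.
  obtain ⟨Q, hQ⟩ : ∃ Q, Q = i + (if u then inn g else out g) + j := ⟨_, rfl⟩
  have h1 : p < i ∨ p = i ∨ p = i + 1 ∨ i + 1 < p := by omega
  have h2 : p < Q ∨ p = Q ∨ p = Q + 1 ∨ Q + 1 < p := by omega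
  cases u
  all_goals simp only [if_true, if_false, Bool.false_eq_true] at hQ
  all_goals cases g
  all_goals
    simp only [inn_bead, inn_cup, inn_cap, inn_P, out_bead, out_cup, out_cap, out_P] at hQ ⊢
    rcases h1 with h1 | h1 | h1 | h1 <;> rcases h2 with h2 | h2 | h2 | h2 <;>
    first
    | omega
    | (cases h
       all_goals simp (disch := omega) only [enter, next, events, Function.iterate_succ_apply,
        Function.iterate_zero, id, List.reverse_cons, List.reverse_nil, List.cons_append,
        List.nil_append, up_bead_self, up_bead_left, up_bead_right, up_P_fst, up_P_snd, up_P_left,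
        up_P_right, up_cup_left, up_cup_right, up_cap_fst, up_cap_snd, up_cap_left, up_cap_right,
        down_bead_self, down_bead_left, down_bead_right, down_P_fst, down_P_snd, down_P_left,
        down_P_right, down_cup_fst, down_cup_snd, down_cup_left, down_cup_right, down_cap_left,
        down_cap_right, advance_top, advance_bottom]
       all_goals refine ⟨?_, ?_, ?_, ?_, ?_⟩
       all_goals first
        | exact .inl ⟨rfl, rfl⟩
        | exact .inr ⟨rfl, rfl⟩
        | exact ⟨rfl, fun _ _ => rfl⟩
        | trivial
        | omega)

variable {k} in
theorem CatMove.simulates (hs : Function.Bijective (antip k (A := A)))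
    {x y : List (Layer (CatGen A))} (h : CatMove k x y) :
    Simulates (SameEvents k (A := A)) x y := by
  cases h with
  | exchange i j g h => exact simulates_exchange i j g h
  | _ i =>
    intro p u
    -- Four steps are attained in a zigzag, where both layers are met twice.
    refine ⟨4, 4, ?_⟩
    obtain h | rfl | rfl | rfl | h : p < i ∨ p = i ∨ p = i + 1 ∨ p = i + 2 ∨ i + 2 < p := by omega
    all_goals cases u
    all_goals simp (disch := omega) only [enter, next, events, Function.iterate_succ_apply,
      Function.iterate_zero, id, List.reverse_cons, List.reverse_nil, List.cons_append,
      List.nil_append, up_bead_self, up_bead_left, up_bead_right, up_P_fst, up_P_snd, up_P_left,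
      up_P_right, up_cup_left, up_cup_right, up_cap_fst, up_cap_snd, up_cap_left, up_cap_right,
      down_bead_self, down_bead_left, down_bead_right, down_P_fst, down_P_snd, down_P_left,
      down_P_right, down_cup_fst, down_cup_snd, down_cup_left, down_cup_right, down_cap_left,
      down_cap_right, advance_top, advance_bottom, inn_bead, inn_cup, inn_cap, inn_P, out_bead,
      out_cup, out_cap, out_P]
    all_goals refine ⟨?_, ?_, ?_, ?_, ?_⟩
    all_goals first
      | exact .inl ⟨rfl, rfl⟩
      | exact .inr ⟨rfl, rfl⟩
      | exact ⟨rfl, fun _ _ => rfl⟩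
      | trivial
      | omega
      | (refine ⟨rfl, fun q hq => ?_⟩
         simp [concentrate, antipPow_one hs, antipPow_add_one hs, ← sub_eq_add_neg,
           antipPow_sub_one hs]
         done)
      -- The remaining goals come from the multiplication of beads: upwards `s ^ q` is
      -- multiplicative, downwards it is antimultiplicative.
      | (refine ⟨rfl, fun q hq => ?_⟩
         simp only [concentrate, List.cons_append, List.nil_append, mul_one, iff_true,
           Bool.false_eq_true, iff_false] at hq ⊢
         first
         | rw [(antipPow_mul hs q).1 hq]
         | rw [(antipPow_mul hs q).2 hq])

/-- Deleting a bead does not change the number of half turns. -/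
theorem halfTurns_congruence {B : Type*} :
    Congruence (fun _ (l l' : List (StrandEvent B)) => halfTurns l = halfTurns l') where
  refl _ _ := rfl
  append u u' l₁ l₁' l₂ l₂' h h₁ h₂ := by rw [halfTurns_append, halfTurns_append, h₁, h₂]

theorem bead_simulates {B : Type*} (i : ℕ) (a : B) :
    Simulates (fun _ l l' => halfTurns l = halfTurns l') [(i, .bead a)] [] := by
  intro p u
  refine ⟨2, 2, ?_⟩
  obtain h | h | h : p < i ∨ p = i ∨ i < p := by omega
  all_goals cases u
  all_goals simp (disch := omega) only [enter, next, events, Function.iterate_succ_apply,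
      Function.iterate_zero, id, List.reverse_cons, List.reverse_nil, List.cons_append,
      List.nil_append, up_bead_self, up_bead_left, up_bead_right,
      down_bead_self, down_bead_left, down_bead_right, advance_top, advance_bottom]
  all_goals refine ⟨?_, ?_, ?_, ?_, ?_⟩
  all_goals first
      | exact .inl ⟨rfl, rfl⟩
      | exact .inr ⟨rfl, rfl⟩
      | trivial

end MoveEvents

/-! ### Colorings of curves -/

section Colorings

/-- The color `v` for two new strands. -/
def insertColor (i : ℕ) (v : Bool) (c : ℕ → Bool) (p : ℕ) : Bool :=
  if p < i then c p else if p < i + 2 then v else c (p - 2)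

/-- Forget the colors of two strands. -/
def deleteColor (i : ℕ) (c : ℕ → Bool) (p : ℕ) : Bool := if p < i then c p else c (p + 2)

/-- Exchange the colors of two strands. -/
def swapColor (i : ℕ) (c : ℕ → Bool) (p : ℕ) : Bool :=
  if p = i then c (i + 1) else if p = i + 1 then c i else c p

/-- All strands have the color `true`. -/
abbrev plain : ℕ → Bool := fun _ => true

variable {A : Type*}

/-- The colors `c` below and `c'` above a layer agree along the strands.  (Imagine infinitely
many strands to the right of the diagram.) -/
def ColorStep : Layer (CatGen A) → (ℕ → Bool) → (ℕ → Bool) → Prop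
  | (_, .bead _), c, c' => c' = c
  | (i, .cup), c, c' => ∃ v, c' = insertColor i v c
  | (i, .cap), c, c' => c i = c (i + 1) ∧ c' = deleteColor i c
  | (i, .P), c, c' => c' = swapColor i c

/-- The colors `c` below and `c'` above a list of layers extend to a coloring of its strands. -/
def ColorRun : List (Layer (CatGen A)) → (ℕ → Bool) → (ℕ → Bool) → Prop
  | [], c, c' => c' = c
  | l :: w, c, c' => ∃ d, ColorStep l c d ∧ ColorRun w d c'

theorem colorRun_append (u v : List (Layer (CatGen A))) (c c' : ℕ → Bool) :
    ColorRun (u ++ v) c c' ↔ ∃ d, ColorRun u c d ∧ ColorRun v d c' := by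
  induction u generalizing c with
  | nil => simp [ColorRun]
  | cons l u ih =>
    simp only [List.cons_append, ColorRun, ih]
    exact ⟨fun ⟨d, h, e, h1, h2⟩ => ⟨e, ⟨d, h, h1⟩, h2⟩, fun ⟨e, ⟨d, h, h1⟩, h2⟩ => ⟨d, h, e, h1, h2⟩⟩

/-- The only coloring that is plain at the bottom and at the top is the plain one. -/
def Rigid (w : List (Layer (CatGen A))) : Prop :=
  ∀ u v, w = u ++ v → ∀ c, ColorRun u plain c → ColorRun v c plain → c = plain

/-- Blocks of layers that can be exchanged without changing the colorings. -/
structure ColorEquiv (x y : List (Layer (CatGen A))) : Prop where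
  run : ∀ c c', ColorRun x c c' ↔ ColorRun y c c'
  left : Rigid x
  right : Rigid y

theorem ColorEquiv.symm {x y : List (Layer (CatGen A))} (h : ColorEquiv x y) : ColorEquiv y x :=
  ⟨fun c c' => (h.run c c').symm, h.right, h.left⟩

/-- A cut below or above the block is also a cut of the old diagram. For a cut inside the block,
rigidity of the old diagram makes the colors at both ends of the block plain, and rigidity of the
new block itself does the rest. -/
theorem Rigid.replace {u x y v : List (Layer (CatGen A))} (h : ColorEquiv x y)
    (hu : Rigid (u ++ x ++ v)) : Rigid (u ++ y ++ v) := by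
  intro s t hst c h1 h2
  rw [List.append_assoc, List.append_eq_append_iff] at hst
  obtain ⟨y', rfl, h3⟩ | ⟨u', rfl, rfl⟩ := hst
  · rw [List.append_eq_append_iff] at h3
    obtain ⟨v', rfl, rfl⟩ | ⟨y'', rfl, rfl⟩ := h3
    · refine hu (u ++ x ++ v') t (by simp) c ?_ h2
      simp only [colorRun_append, h.run] at h1 ⊢
      obtain ⟨d, h4, e, h5, h6⟩ := h1
      exact ⟨e, ⟨d, h4, h5⟩, h6⟩
    · rw [colorRun_append] at h1 h2
      obtain ⟨d, h4, h5⟩ := h1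
      obtain ⟨e, h6, h7⟩ := h2
      have h8 : ColorRun x d e := by rw [h.run, colorRun_append]; exact ⟨c, h5, h6⟩
      obtain rfl := hu u (x ++ v) (by simp) d h4 (by rw [colorRun_append]; exact ⟨e, h8, h7⟩)
      obtain rfl := hu (u ++ x) v (by simp) e (by rw [colorRun_append]; exact ⟨_, h4, h8⟩) h7
      exact h.right _ _ rfl c h5 h6
  · refine hu s (u' ++ x ++ v) (by simp) c h1 ?_
    simp only [colorRun_append, h.run] at h2 ⊢
    obtain ⟨d, h4, e, h5, h6⟩ := h2
    exact ⟨e, ⟨d, h4, h5⟩, h6⟩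

theorem rigid_replace_iff {u x y v : List (Layer (CatGen A))} (h : ColorEquiv x y) :
    Rigid (u ++ x ++ v) ↔ Rigid (u ++ y ++ v) := ⟨.replace h, .replace h.symm⟩

/-- Going upwards, a new color can arise only at a minimum; dually, going downwards, only at a
maximum. -/
theorem ColorStep.plain_up {l : Layer (CatGen A)} (hl : l.2 ≠ .cup) {c : ℕ → Bool}
    (h : ColorStep l plain c) : c = plain := by
  obtain ⟨i, g⟩ := l
  cases g with
  | cup => exact absurd rfl hl
  | bead a => exact h
  | cap => obtain ⟨-, rfl⟩ := h; funext p; simp [deleteColor]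
  | P => rw [ColorStep] at h; subst h; funext p; simp [swapColor]

theorem ColorStep.plain_down {l : Layer (CatGen A)} (hl : l.2 ≠ .cap) {c : ℕ → Bool}
    (h : ColorStep l c plain) : c = plain := by
  obtain ⟨i, g⟩ := l
  cases g with
  | cap => exact absurd rfl hl
  | bead a => exact h.symm
  | cup =>
    obtain ⟨v, h⟩ := h
    funext p
    have h1 := congrFun h p
    have h2 := congrFun h (p + 2)
    simp only [insertColor] at h1 h2
    by_cases hp : p < i
    · rw [if_pos hp] at h1; exact h1.symm
    · rw [if_neg (by omega), if_neg (by omega)] at h2; exact h2.symm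
  | P =>
    rw [ColorStep] at h
    funext p
    have h1 := congrFun h p
    have h2 := congrFun h i
    have h3 := congrFun h (i + 1)
    simp only [swapColor, if_true, Nat.succ_ne_self, if_false] at h1 h2 h3
    by_cases hp : p = i
    · subst hp; exact h3.symm
    · by_cases hp' : p = i + 1
      · subst hp'; exact h2.symm
      · rw [if_neg hp, if_neg hp'] at h1; exact h1.symm

theorem rigid_nil : Rigid ([] : List (Layer (CatGen A))) := by
  intro u v h c h1 _
  obtain ⟨rfl, rfl⟩ := List.append_eq_nil_iff.1 h.symm
  exact h1

theorem rigid_singleton (l : Layer (CatGen A)) : Rigid [l] := by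
  intro u v h c h1 h2
  cases u with
  | nil => exact h1
  | cons l' u =>
    simp only [List.cons_append, List.cons.injEq] at h
    obtain ⟨rfl, h⟩ := h
    obtain ⟨rfl, rfl⟩ := List.append_eq_nil_iff.1 h.symm
    exact h2.symm

/-- A nonplain color between two layers is possible only if they form a circle. If the maximum is
displaced against the minimum, one new strand survives to the plain top. -/
theorem ColorStep.interior {l l' : Layer (CatGen A)}
    (h : l.1 ≠ l'.1 ∨ l.2 ≠ .cup ∨ l'.2 ≠ .cap) {c : ℕ → Bool} (h1 : ColorStep l plain c)
    (h2 : ColorStep l' c plain) : c = plain := by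
  by_cases hl : l.2 = .cup
  · by_cases hl' : l'.2 = .cap
    · obtain ⟨i, g⟩ := l
      obtain ⟨j, g'⟩ := l'
      simp only at hl hl'
      subst hl hl'
      have h : i ≠ j := by simpa using h
      obtain ⟨v, rfl⟩ := h1
      obtain ⟨h3, h4⟩ := h2
      obtain rfl : v = true := by
        rcases Nat.lt_or_gt_of_ne h with hij | hij
        · have h5 := congrFun h4 i
          simp [deleteColor, insertColor, hij] at h5
          exact h5
        · have h5 := congrFun h4 (i - 1)
          rw [deleteColor, if_neg (by omega), insertColor, if_neg (by omega),
            if_pos (by omega)] at h5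
          exact h5.symm
      funext p
      simp [insertColor]
    · exact h2.plain_down hl'
  · exact h1.plain_up hl

theorem rigid_pair {l l' : Layer (CatGen A)}
    (h : l.1 ≠ l'.1 ∨ l.2 ≠ .cup ∨ l'.2 ≠ .cap) : Rigid [l, l'] := by
  intro u v hw c h1 h2
  match u, hw with
  | [], _ => exact h1
  | [_], hw =>
    simp only [List.cons_append, List.nil_append, List.cons.injEq] at hw
    obtain ⟨rfl, rfl⟩ := hw
    obtain ⟨d, h1, rfl⟩ := h1
    obtain ⟨e, h2, rfl⟩ := h2
    exact h1.interior h h2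
  | [_, _], hw =>
    simp only [List.cons_append, List.nil_append, List.cons.injEq] at hw
    obtain ⟨rfl, rfl, rfl⟩ := hw
    exact h2.symm
  | _ :: _ :: _ :: _, hw => simp at hw

theorem ColorRun.plain_up {w : List (Layer (CatGen A))} (hw : ∀ l ∈ w, l.2 ≠ .cup) {c : ℕ → Bool}
    (h : ColorRun w plain c) : c = plain := by
  induction w with
  | nil => exact h
  | cons l w ih =>
    obtain ⟨d, h1, h2⟩ := h
    obtain rfl := h1.plain_up (hw l (by simp))
    exact ih (fun l hl => hw l (by simp [hl])) h2

theorem rigid_of_no_cup {w : List (Layer (CatGen A))} (hw : ∀ l ∈ w, l.2 ≠ .cup) :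
    Rigid w := by
  rintro u v rfl c h1 -
  exact h1.plain_up fun l hl => hw l (by simp [hl])

/-- These identities and the following ones are the actions of the local moves on colors: exchanges
of distant pieces, then zigzags, crossings and switchbacks. -/
theorem insertColor_comm (i j : ℕ) (v v' : Bool) (c : ℕ → Bool) :
    insertColor (i + 2 + j) v' (insertColor i v c) =
      insertColor i v (insertColor (i + j) v' c) := by
  funext p; simp only [insertColor]; split_ifs <;> first | omega | rfl | (congr 1; omega)

theorem deleteColor_insertColor_comm (i j : ℕ) (v : Bool) (c : ℕ → Bool) :
    deleteColor (i + 2 + j) (insertColor i v c) = insertColor i v (deleteColor (i + j) c) := by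
  funext p
  simp only [insertColor, deleteColor]
  split_ifs <;> first | omega | rfl | (congr 1; omega)

theorem swapColor_insertColor_comm (i j : ℕ) (v : Bool) (c : ℕ → Bool) :
    swapColor (i + 2 + j) (insertColor i v c) = insertColor i v (swapColor (i + j) c) := by
  funext p
  simp only [insertColor, swapColor]
  split_ifs <;> first | omega | rfl | (congr 1; omega)

theorem insertColor_deleteColor_comm (i j : ℕ) (v : Bool) (c : ℕ → Bool) :
    insertColor (i + j) v (deleteColor i c) = deleteColor i (insertColor (i + 2 + j) v c) := by
  funext p
  simp only [insertColor, deleteColor]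
  split_ifs <;> first | omega | rfl | (congr 1; omega)

theorem deleteColor_comm (i j : ℕ) (c : ℕ → Bool) :
    deleteColor (i + j) (deleteColor i c) = deleteColor i (deleteColor (i + 2 + j) c) := by
  funext p
  simp only [deleteColor]
  split_ifs <;> first | omega | rfl | (congr 1; omega)

theorem swapColor_deleteColor_comm (i j : ℕ) (c : ℕ → Bool) :
    swapColor (i + j) (deleteColor i c) = deleteColor i (swapColor (i + 2 + j) c) := by
  funext p
  simp only [swapColor, deleteColor]
  split_ifs <;> first | omega | rfl | (congr 1; omega)

theorem insertColor_swapColor_comm (i j : ℕ) (v : Bool) (c : ℕ → Bool) :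
    insertColor (i + 2 + j) v (swapColor i c) = swapColor i (insertColor (i + 2 + j) v c) := by
  funext p
  simp only [insertColor, swapColor]
  split_ifs <;> first | omega | rfl | (congr 1; omega)

theorem deleteColor_swapColor_comm (i j : ℕ) (c : ℕ → Bool) :
    deleteColor (i + 2 + j) (swapColor i c) = swapColor i (deleteColor (i + 2 + j) c) := by
  funext p
  simp only [swapColor, deleteColor]
  split_ifs <;> first | omega | rfl | (congr 1; omega)

theorem swapColor_comm (i j : ℕ) (c : ℕ → Bool) :
    swapColor (i + 2 + j) (swapColor i c) = swapColor i (swapColor (i + 2 + j) c) := by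
  funext p
  simp only [swapColor]
  split_ifs <;> first | omega | rfl | (congr 1; omega)

theorem zigzag_left_color (i : ℕ) (c : ℕ → Bool) :
    deleteColor (i + 1) (insertColor i (c i) c) = c := by
  funext p
  simp only [insertColor, deleteColor]
  split_ifs <;> first | omega | rfl | (congr 1; omega)

theorem zigzag_right_color (i : ℕ) (c : ℕ → Bool) :
    deleteColor i (insertColor (i + 1) (c i) c) = c := by
  funext p
  simp only [insertColor, deleteColor]
  split_ifs <;> first | omega | rfl | (congr 1; omega)

theorem swapColor_swapColor (i : ℕ) (c : ℕ → Bool) : swapColor i (swapColor i c) = c := by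
  funext p
  simp only [swapColor]
  split_ifs <;> first | omega | rfl | (congr 1; omega)

theorem swapColor_braid (i : ℕ) (c : ℕ → Bool) :
    swapColor i (swapColor (i + 1) (swapColor i c)) =
      swapColor (i + 1) (swapColor i (swapColor (i + 1) c)) := by
  funext p
  simp only [swapColor]
  split_ifs <;> first | omega | rfl | (congr 1; omega)

theorem deleteColor_swapColor (i : ℕ) (c : ℕ → Bool) :
    deleteColor (i + 1) (swapColor i c) = deleteColor i (swapColor (i + 1) c) := by
  funext p
  simp only [swapColor, deleteColor]
  split_ifs <;> first | omega | rfl | (congr 1; omega)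

theorem swapColor_insertColor (i : ℕ) (v : Bool) (c : ℕ → Bool) :
    swapColor i (insertColor (i + 1) v c) = swapColor (i + 1) (insertColor i v c) := by
  funext p
  simp only [swapColor, insertColor]
  split_ifs <;> first | omega | rfl | (congr 1; omega)

theorem insertColor_of_lt {i p : ℕ} (v : Bool) (c : ℕ → Bool) (h : p < i) :
    insertColor i v c p = c p := by rw [insertColor, if_pos h]

theorem insertColor_fst {i p : ℕ} (v : Bool) (c : ℕ → Bool) (h : p = i) :
    insertColor i v c p = v := by rw [insertColor, if_neg (by omega), if_pos (by omega)]

theorem insertColor_snd {i p : ℕ} (v : Bool) (c : ℕ → Bool) (h : p = i + 1) :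
    insertColor i v c p = v := by rw [insertColor, if_neg (by omega), if_pos (by omega)]

theorem insertColor_of_gt {i p : ℕ} (v : Bool) (c : ℕ → Bool) (h : i + 1 < p) :
    insertColor i v c p = c (p - 2) := by rw [insertColor, if_neg (by omega), if_neg (by omega)]

theorem deleteColor_of_lt {i p : ℕ} (c : ℕ → Bool) (h : p < i) :
    deleteColor i c p = c p := by rw [deleteColor, if_pos h]

theorem deleteColor_of_ge {i p : ℕ} (c : ℕ → Bool) (h : i ≤ p) :
    deleteColor i c p = c (p + 2) := by rw [deleteColor, if_neg (by omega)]

theorem swapColor_of_lt {i p : ℕ} (c : ℕ → Bool) (h : p < i) :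
    swapColor i c p = c p := by rw [swapColor, if_neg (by omega), if_neg (by omega)]

theorem swapColor_fst {i p : ℕ} (c : ℕ → Bool) (h : p = i) :
    swapColor i c p = c (i + 1) := by rw [swapColor, if_pos h]

theorem swapColor_snd {i p : ℕ} (c : ℕ → Bool) (h : p = i + 1) :
    swapColor i c p = c i := by rw [swapColor, if_neg (by omega), if_pos h]

theorem swapColor_of_gt {i p : ℕ} (c : ℕ → Bool) (h : i + 1 < p) :
    swapColor i c p = c p := by rw [swapColor, if_neg (by omega), if_neg (by omega)]

theorem exists_eq_apply_and {α β : Type*} {f : α → β} {q : β → Prop} :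
    (∃ d, (∃ v, d = f v) ∧ q d) ↔ ∃ v, q (f v) :=
  ⟨fun ⟨_, ⟨v, h⟩, hq⟩ => ⟨v, h ▸ hq⟩, fun ⟨v, hq⟩ => ⟨_, ⟨v, rfl⟩, hq⟩⟩

theorem colorEquiv_exchange (i j : ℕ) (g h : CatGen A) :
    ColorEquiv [(i, g), (i + out g + j, h)] [(i + inn g + j, h), (i, g)] where
  run c c' := by
    have e1 : i + 2 + j - 2 = i + j := by omega
    have e2 : i + 2 + j + 1 - 2 = i + j + 1 := by omega
    have e3 : i + j + 2 = i + 2 + j := by omega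
    have e4 : i + j + 1 + 2 = i + 2 + j + 1 := by omega
    cases g <;> cases h <;> simp only [ColorRun, ColorStep, inn_bead, inn_cup, inn_cap, inn_P,
      out_bead, out_cup, out_cap, out_P, exists_eq_left, exists_eq_apply_and, and_assoc, add_zero,
      exists_and_left,
      insertColor_comm, deleteColor_insertColor_comm, swapColor_insertColor_comm,
      insertColor_deleteColor_comm, deleteColor_comm, swapColor_deleteColor_comm,
      insertColor_swapColor_comm, deleteColor_swapColor_comm, swapColor_comm]
    all_goals try simp (disch := omega) only [insertColor_of_gt, insertColor_of_lt, deleteColor_of_ge,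
      deleteColor_of_lt,
      swapColor_of_lt, swapColor_of_gt, e1, e2, e3, e4, exists_and_left,
      exists_eq_left]
    · exact exists_comm
    · tauto
  -- The two pieces never form a circle. A minimum on the left shifts the right piece by two, and so
  -- does a maximum on the left in the other order.
  left := by
    refine rigid_pair ?_
    cases g <;> simp <;> omega
  right := by
    refine rigid_pair ?_
    cases g <;> simp <;> omega

theorem CatMove.colorEquiv {k : Type*} [CommRing k] [Ring A] [HopfAlgebra k A]
    {x y : List (Layer (CatGen A))} (h : CatMove k x y) :
    ColorEquiv x y := by
  cases h with
  | exchange i j g h => exact colorEquiv_exchange i j g h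
  | _ =>
    refine ⟨fun c c' => ?_, ?_, ?_⟩
    rotate_left
    all_goals try first
      | exact rigid_nil
      | exact rigid_singleton _
      | (refine rigid_pair ?_; simp)
      | (refine rigid_of_no_cup ?_; simp)
    all_goals simp only [ColorRun, ColorStep, exists_eq_left, exists_eq_apply_and, and_assoc,
      exists_and_left]
    all_goals try simp (disch := omega) only [insertColor_of_gt, insertColor_of_lt, insertColor_fst,
      insertColor_snd, swapColor_fst, swapColor_snd, swapColor_of_lt, swapColor_of_gt,
      exists_eq_left, exists_eq_left']
    all_goals first
      | exact Iff.of_eq (congrArg _ (zigzag_left_color _ c))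
      | rw [zigzag_right_color]
      | rw [swapColor_swapColor]
      | rw [swapColor_braid]
      | rw [deleteColor_swapColor]
      | simp only [swapColor_insertColor]

theorem colorEquiv_bead (i : ℕ) (a : A) : ColorEquiv [(i, .bead a)] [] where
  run c c' := by simp only [ColorRun, ColorStep, exists_eq_left]
  left := rigid_singleton _
  right := rigid_nil

/-- The curl is one arc: the condition at its maximum forces the color created at the minimum to be
that of the incoming strand. -/
theorem colorEquiv_curl : ColorEquiv [(1, .cup), (0, .P), (1, .cap)] ([] : List (Layer (CatGen A)))
    where
  run c c' := by
    simp only [ColorRun, ColorStep, exists_eq_left, exists_eq_apply_and, and_assoc,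
      exists_and_left]
    simp (disch := omega) only [insertColor_of_lt, insertColor_fst,
      insertColor_snd, swapColor_fst, swapColor_snd, swapColor_of_lt, swapColor_of_gt,
      exists_eq_left, exists_eq_left']
    have : deleteColor 1 (swapColor 0 (insertColor 1 (c 0) c)) = c := by
      funext p
      simp only [swapColor, insertColor, deleteColor]
      split_ifs <;> first | omega | rfl | (congr 1; omega) | contradiction
    rw [this]
  left := by
    intro u v hw c h1 h2
    match u, hw with
    | [], _ => exact h1
    | [_], hw =>
      simp only [List.cons_append, List.nil_append, List.cons.injEq] at hw
      obtain ⟨rfl, rfl⟩ := hw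
      obtain ⟨d, ⟨b, rfl⟩, rfl⟩ := h1
      obtain ⟨d, rfl, e, ⟨h2, -⟩, -⟩ := h2
      simp (disch := omega) only [insertColor_of_lt, insertColor_fst, insertColor_snd,
        swapColor_snd, swapColor_of_gt] at h2
      subst h2
      funext p
      simp [insertColor]
    | [_, _], hw =>
      simp only [List.cons_append, List.nil_append, List.cons.injEq] at hw
      obtain ⟨rfl, rfl, rfl⟩ := hw
      obtain ⟨d, ⟨b, rfl⟩, e, rfl, rfl⟩ := h1
      obtain ⟨e, ⟨h2, -⟩, -⟩ := h2
      simp (disch := omega) only [insertColor_of_lt, insertColor_fst, insertColor_snd,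
        swapColor_snd, swapColor_of_gt] at h2
      subst h2
      funext p
      simp [swapColor, insertColor]
    | [_, _, _], hw =>
      simp only [List.cons_append, List.nil_append, List.cons.injEq] at hw
      obtain ⟨rfl, rfl, rfl, rfl⟩ := hw
      exact h2.symm
    | _ :: _ :: _ :: _ :: _, hw => simp at hw
  right := rigid_nil

theorem colorEquiv_curlInv :
    ColorEquiv [(0, .cup), (1, .P), (0, .cap)] ([] : List (Layer (CatGen A))) where
  run c c' := by
    simp only [ColorRun, ColorStep, exists_eq_left, exists_eq_apply_and, and_assoc,
      exists_and_left]
    simp (disch := omega) only [insertColor_of_gt, insertColor_fst,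
      insertColor_snd, swapColor_fst, swapColor_snd, swapColor_of_lt, swapColor_of_gt,
      exists_eq_left, exists_eq_left']
    have : deleteColor 0 (swapColor 1 (insertColor 0 (c 0) c)) = c := by
      funext p
      simp only [swapColor, insertColor, deleteColor]
      split_ifs <;> first | omega | rfl | (congr 1; omega)
    exact Iff.of_eq (congrArg _ this)
  left := by
    intro u v hw c h1 h2
    match u, hw with
    | [], _ => exact h1
    | [_], hw =>
      simp only [List.cons_append, List.nil_append, List.cons.injEq] at hw
      obtain ⟨rfl, rfl⟩ := hw
      obtain ⟨d, ⟨b, rfl⟩, rfl⟩ := h1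
      obtain ⟨d, rfl, e, ⟨h2, -⟩, -⟩ := h2
      simp (disch := omega) only [insertColor_of_gt, insertColor_fst, insertColor_snd,
        swapColor_fst, swapColor_of_lt] at h2
      subst h2
      funext p
      simp [insertColor]
    | [_, _], hw =>
      simp only [List.cons_append, List.nil_append, List.cons.injEq] at hw
      obtain ⟨rfl, rfl, rfl⟩ := hw
      obtain ⟨d, ⟨b, rfl⟩, e, rfl, rfl⟩ := h1
      obtain ⟨e, ⟨h2, -⟩, -⟩ := h2
      simp (disch := omega) only [insertColor_of_gt, insertColor_fst, insertColor_snd,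
        swapColor_fst, swapColor_of_lt] at h2
      subst h2
      funext p
      simp [swapColor, insertColor]
    | [_, _, _], hw =>
      simp only [List.cons_append, List.nil_append, List.cons.injEq] at hw
      obtain ⟨rfl, rfl, rfl, rfl⟩ := hw
      exact h2.symm
    | _ :: _ :: _ :: _ :: _, hw => simp at hw
  right := rigid_nil

theorem rigid_curlLayers (n : ℤ) : Rigid (curlLayers A n) := by
  have h : ∀ {x : List (Layer (CatGen A))}, ColorEquiv x [] → ∀ n : ℕ,
      Rigid (List.replicate n x).flatten := by
    intro x hx n
    induction n with
    | zero => exact rigid_nil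
    | succ n ih =>
      have := (rigid_replace_iff (u := []) (v := (List.replicate n x).flatten) hx).2 ih
      simpa [List.replicate_succ] using this
  cases n with
  | ofNat n => exact h colorEquiv_curl n
  | negSucc n => exact h colorEquiv_curlInv (n + 1)

theorem rigid_bead_curlLayers (i : ℕ) (a : A) (n : ℤ) :
    Rigid ((i, .bead a) :: curlLayers A n) :=
  (rigid_replace_iff (u := []) (colorEquiv_bead i a)).2 (rigid_curlLayers n)

end Colorings

/-! ### A strand that passes through the whole diagram -/

section SingleStrand

open Traveller

variable {A : Type*}

/-- The strand that enters at the bottom passes through every point. -/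
def Visits (w : List (Layer (CatGen A))) : Prop :=
  ∀ h p, h ≤ w.length → p < wout 1 (w.take h) →
    ∃ t, (journey w t).height = h ∧ (journey w t).pos = p

/-- A coloring of all points of a diagram that is constant along the strands. -/
def Colors (w : List (Layer (CatGen A))) (f : ℕ → ℕ → Bool) : Prop :=
  ∀ h l, w[h]? = some l → ColorStep l (f h) (f (h + 1))

/-- A chain of intermediate colors becomes one function of height and position, which can be
evaluated at the points of a journey. -/
theorem ColorRun.exists_colors {w : List (Layer (CatGen A))} {c c' : ℕ → Bool}
    (h : ColorRun w c c') : ∃ f, f 0 = c ∧ f w.length = c' ∧ Colors w f := by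
  induction w generalizing c with
  | nil => exact ⟨fun _ => c, rfl, h.symm, fun _ _ h => by simp at h⟩
  | cons l w ih =>
    obtain ⟨d, h1, h2⟩ := h
    obtain ⟨f, rfl, h4, h5⟩ := ih h2
    refine ⟨fun n => Nat.casesOn n c f, rfl, h4, fun n l' hl => ?_⟩
    cases n with
    | zero =>
      simp only [List.getElem?_cons_zero, Option.some.injEq] at hl
      subst hl
      exact h1
    | succ n => exact h5 n l' (by simpa using hl)

theorem exists_colors {u v : List (Layer (CatGen A))} {c c' c'' : ℕ → Bool}
    (h : ColorRun u c c') (h' : ColorRun v c' c'') :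
    ∃ f, f 0 = c ∧ f u.length = c' ∧ Colors (u ++ v) f := by
  obtain ⟨f, hf0, hf1, hf⟩ := h.exists_colors
  obtain ⟨g, hg0, -, hg⟩ := h'.exists_colors
  refine ⟨fun n => if n < u.length then f n else g (n - u.length), ?_, ?_, fun n l hl => ?_⟩
  · beta_reduce
    split_ifs with h0
    · exact hf0
    · have : u.length = 0 := by omega
      rw [this, Nat.sub_zero, hg0, ← hf1, this, hf0]
  · simp [hg0]
  · rcases Nat.lt_trichotomy (n + 1) u.length with hn | hn | hn
    · simp only [if_pos hn, if_pos (Nat.lt_of_succ_lt hn)]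
      exact hf n l (by rwa [List.getElem?_append_left (by omega)] at hl)
    · simp only [hn, lt_irrefl, if_false, Nat.sub_self, hg0, ← hf1, if_pos (show n < u.length by omega)]
      rw [← hn]
      exact hf n l (by rwa [List.getElem?_append_left (by omega)] at hl)
    · rw [List.getElem?_append_right (by omega)] at hl
      simp only [if_neg (show ¬ n + 1 < u.length by omega), if_neg (show ¬ n < u.length by omega),
        Nat.sub_add_comm (show u.length ≤ n by omega)]
      exact hg _ l hl

theorem Colors.run {u v : List (Layer (CatGen A))} {f : ℕ → ℕ → Bool} (hf : Colors (u ++ v) f) :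
    ColorRun u (f 0) (f u.length) ∧ ColorRun v (f u.length) (f (u ++ v).length) := by
  induction u generalizing f with
  | nil =>
    refine ⟨rfl, ?_⟩
    simp only [List.nil_append, List.length_nil] at hf ⊢
    induction v generalizing f with
    | nil => rfl
    | cons l v ih =>
      exact ⟨f 1, hf 0 l rfl, ih (f := fun n => f (n + 1)) fun n l' hl => hf (n + 1) l' (by simpa)⟩
  | cons l u ih =>
    have := ih (f := fun n => f (n + 1)) fun n l' hl => hf (n + 1) l' (by simpa)
    exact ⟨⟨f 1, hf 0 l rfl, this.1⟩, this.2⟩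

/-- The color is constant along the journey. At an extremum this is the condition that both legs
have the same color. -/
theorem Colors.next {w : List (Layer (CatGen A))} {f : ℕ → ℕ → Bool} (hf : Colors w f)
    {c : Traveller A} (hc : c.word = w) :
    f c.next.height c.next.pos = f c.height c.pos := by
  subst hc
  induction c using induction_advance with
  | stopped c hc => rw [next_of_stopped hc]
  | up be i g ab p =>
    have h := hf be.length (i, g) (by simp [word])
    cases g <;> simp only [ColorStep] at h
    case bead a => simp [Traveller.next, advance_up_bead, height, h]
    case P =>
      simp only [Traveller.next, advance_up_P, height]
      split_ifs <;> simp_all [swapColor]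
    case cup =>
      obtain ⟨v, h⟩ := h
      simp only [Traveller.next, advance_up_cup, height]
      split_ifs <;> simp_all [insertColor] <;> (try split_ifs) <;> first | omega | rfl
    case cap =>
      obtain ⟨h1, h⟩ := h
      simp only [Traveller.next, advance_up_cap, height]
      split_ifs with h2 h3 h4
      · simp [h2, h1]
      · simp [h3, h1]
      · simp [h, deleteColor, h4]
      · simp only [List.length_cons, h, deleteColor]
        rw [if_neg (by omega)]
        congr 1; omega
  | down i g be ab p =>
    have h := hf be.length (i, g) (by simp [word])
    cases g <;> simp only [ColorStep] at h
    case bead a => simp [Traveller.next, advance_down_bead, height, h]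
    case P =>
      simp only [Traveller.next, advance_down_P, height]
      split_ifs <;> simp_all [swapColor]
    case cup =>
      obtain ⟨v, h⟩ := h
      simp only [Traveller.next, advance_down_cup, height]
      split_ifs with h2 h3 h4
      · simp [h2, h, insertColor]
      · simp [h3, h, insertColor]
      · simp [h, insertColor, h4]
      · simp only [List.length_cons, h, insertColor]
        rw [if_neg (by omega), if_neg (by omega)]
    case cap =>
      obtain ⟨h1, h⟩ := h
      simp only [Traveller.next, advance_down_cap, height]
      split_ifs with h2 <;> simp [h, deleteColor, h2]

/-- To the right of the diagram, the colors do not change. -/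
theorem ColorStep.outside {l : Layer (CatGen A)} {c c' : ℕ → Bool} (h : ColorStep l c c') {p : ℕ}
    (hp : l.1 + out l.2 ≤ p) : c' p = c (p - out l.2 + inn l.2) := by
  obtain ⟨i, g⟩ := l
  cases g <;> simp only [ColorStep, inn_bead, inn_cup, inn_cap, inn_P, out_bead, out_cup, out_cap,
    out_P] at h hp ⊢
  · rw [h]; congr 1; omega
  · obtain ⟨v, rfl⟩ := h
    rw [insertColor_of_gt _ _ (by omega)]; congr 1
  · rw [h.2, deleteColor_of_ge _ (by omega)]; congr 1
  · rw [h, swapColor_of_gt _ (by omega)]; congr 1; omega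

theorem Colors.outside {w : List (Layer (CatGen A))} {f : ℕ → ℕ → Bool} (hf : Colors w f)
    {n : ℕ} (hw : Fits n w) (h0 : f 0 = plain) {h p : ℕ} (hh : h ≤ w.length)
    (hp : wout n (w.take h) ≤ p) : f h p = true := by
  induction h generalizing p with
  | zero => rw [h0]
  | succ h ih =>
    have hl : w.take (h + 1) = w.take h ++ [w[h]] := (List.take_append_getElem hh).symm
    have hw' := hw
    rw [← List.take_append_drop (h + 1) w, fits_append, hl, fits_append] at hw'
    have h1 : w[h].1 + inn w[h].2 ≤ wout n (w.take h) := hw'.1.2.1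
    rw [hl, wout_append] at hp
    simp only [wout] at hp
    have hi := hf h w[h] (List.getElem?_eq_getElem hh)
    rw [hi.outside (by omega)]
    exact ih (by omega) (by omega)

/-- The color at the start propagates along the journey to all points of the diagram; the imagined
strands on its right keep their plain color. -/
theorem Visits.rigid {w : List (Layer (CatGen A))} (hw : Fits 1 w) (h : Visits w) : Rigid w := by
  rintro u v rfl c h1 h2
  obtain ⟨f, h0, rfl, hf⟩ := exists_colors h1 h2
  have key : ∀ t, f (journey (u ++ v) t).height (journey (u ++ v) t).pos = true := by
    intro t
    induction t with
    | zero => simp [journey_zero, height, h0]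
    | succ t ih => rw [journey_succ, hf.next (word_journey _ _), ih]
  funext p
  by_cases hp : p < wout 1 ((u ++ v).take u.length)
  · obtain ⟨t, ht, rfl⟩ := h u.length p (by simp) hp
    rw [← ht, key]
  · exact hf.outside hw h0 (by simp) (by omega)

/-- A coloring that does not change along any strand. -/
theorem colors_of_next {w : List (Layer (CatGen A))} {f : ℕ → ℕ → Bool}
    (hf : ∀ c : Traveller A, c.word = w → f c.next.height c.next.pos = f c.height c.pos) :
    Colors w f := by
  intro h l hl
  obtain ⟨be, ab, rfl, rfl⟩ : ∃ be ab : List (Layer (CatGen A)), be.length = h ∧ w = be.reverse ++ l :: ab := by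
    obtain ⟨hh, rfl⟩ := List.getElem?_eq_some_iff.1 hl
    exact ⟨(w.take h).reverse, w.drop (h + 1), by simp; omega, by simp⟩
  obtain ⟨i, g⟩ := l
  have hu : ∀ p, _ := fun p => hf ⟨be, (i, g) :: ab, p, true⟩ rfl
  have hd : ∀ p, _ := fun p => hf ⟨(i, g) :: be, ab, p, false⟩ (by simp [word])
  cases g with
  | bead a => 
    funext p
    simpa [Traveller.next, advance_up_bead, height] using hu p
  | P =>
    funext p
    have h := hd p
    simp only [Traveller.next, advance_down_P, height] at h
    simp only [swapColor]
    split_ifs at h ⊢ <;> exact h.symm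
  | cup =>
    refine ⟨f (be.length + 1) i, ?_⟩
    funext p
    simp only [insertColor]
    have h := hd p
    have h' := hd i
    simp only [Traveller.next, advance_down_cup, height] at h h'
    split_ifs at h h' ⊢ <;> first | omega | exact h.symm | (subst p; rfl)
  | cap =>
    refine ⟨?_, ?_⟩
    · have h := hu i
      simp only [Traveller.next, advance_up_cap, height, if_true] at h
      exact h.symm
    · funext p
      have h := hd p
      simp only [Traveller.next, advance_down_cap, height] at h
      simp only [deleteColor]
      split_ifs at h ⊢ <;> exact h.symm

/-- The journey passes through the point of a traveller. -/
def Visited (w : List (Layer (CatGen A))) (c : Traveller A) : Prop :=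
  ∃ t, (journey w t).height = c.height ∧ (journey w t).pos = c.pos

theorem eq_or_eq_rev {c d : Traveller A} (hw : c.word = d.word) (hh : c.height = d.height)
    (hp : c.pos = d.pos) : c = d ∨ c = d.rev := by
  by_cases hu : c.up = d.up
  · exact .inl (eq_of_height hw hh hp hu)
  · refine .inr (eq_of_height hw hh hp ?_)
    simp only [rev]
    revert hu
    cases c.up <;> cases d.up <;> simp

/-- If the journey passes the point in the direction of `c`, its next step will do; if in the
opposite direction, its previous step. -/
theorem Visited.next {w : List (Layer (CatGen A))} {c : Traveller A} (hc : c.word = w)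
    (hs : ¬ c.Stopped) (h : Visited w c) : Visited w c.next := by
  obtain ⟨t, hh, hp⟩ := h
  obtain h | h := eq_or_eq_rev ((word_journey w t).trans hc.symm) hh hp
  · exact ⟨t + 1, by rw [journey_succ, h], by rw [journey_succ, h]⟩
  · induction t with
    | zero =>
      refine absurd (.inr ?_) hs
      rw [journey_zero] at h
      have h1 := congrArg Traveller.up h
      have h2 := congrArg Traveller.below h
      simp only [rev] at h1 h2
      exact ⟨by rw [← Bool.not_eq_true', ← h1], h2.symm⟩
    | succ t ih =>
      by_cases hst : (journey w t).Stopped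
      · have : journey w (t + 1) = journey w t := by rw [journey_succ, next_of_stopped hst]
        rw [this] at hh hp h
        exact ih hh hp h
      · have h1 := next_rev_next hst
        rw [← journey_succ, h, rev_rev] at h1
        rw [h1]
        exact ⟨t, rfl, rfl⟩

theorem visited_next {w : List (Layer (CatGen A))} {c : Traveller A} (hc : c.word = w) :
    Visited w c.next ↔ Visited w c := by
  by_cases hs : c.Stopped
  · rw [next_of_stopped hs]
  refine ⟨fun h => ?_, fun h => h.next hc hs⟩
  have h1 : Visited w c.next.rev := h
  have h2 := h1.next (by rw [← hc, ← word_next c]; rfl) fun h => ?_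
  · rw [next_rev_next hs] at h2
    exact h2
  · have h3 := next_rev_next hs
    rw [next_of_stopped h] at h3
    exact next_ne_self hs (rev_injective h3)

theorem onStrand_next {n : ℕ} {c : Traveller A} (hf : Fits n c.word) :
    c.next.OnStrand n ↔ c.OnStrand n := by
  by_cases hs : c.Stopped
  · rw [next_of_stopped hs]
  refine ⟨fun h => ?_, fun h => h.next hf⟩
  have h1 : c.next.rev.OnStrand n := h
  have h2 := h1.next (by rwa [← word_next c] at hf)
  rw [next_rev_next hs] at h2
  exact h2

/-- Coloring the visited points gives a coloring that is constant along strands. It is plain at both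
ends because the journey leads from the only bottom point to the only top point, so it is plain
everywhere. -/
theorem Rigid.visits {w : List (Layer (CatGen A))} (hw : Fits 1 w) (hw' : wout 1 w = 1)
    (h : Rigid w) : Visits w := by
  classical
  -- The implication gives the color `true` to all positions to the right of the diagram.
  let f : ℕ → ℕ → Bool := fun h p => decide (p < wout 1 (w.take h) →
    ∃ t, (journey w t).height = h ∧ (journey w t).pos = p)
  have hf : Colors w f := by
    refine colors_of_next fun c hc => ?_
    have e : ∀ d : Traveller A, d.word = w →
        f d.height d.pos = decide (d.OnStrand 1 → Visited w d) := by
      intro d hd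
      have : w.take d.height = d.below.reverse := by
        rw [← hd, word, height, ← List.length_reverse, List.take_left]
      simp only [f, this]
      exact decide_eq_decide.2 Iff.rfl
    rw [e c hc, e c.next (by rw [word_next, hc]), visited_next hc,
      onStrand_next (by rwa [hc])]
  have h0 : f 0 = plain := by
    funext p
    simp only [f, List.take_zero, wout, decide_eq_true_eq]
    intro hp
    exact ⟨0, rfl, by simp [journey_zero]; omega⟩
  have h1 : f w.length = plain := by
    funext p
    simp only [f, List.take_length, hw', decide_eq_true_eq]
    intro hp
    obtain ⟨t, -, ht⟩ := exists_stopped hw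
    have h2 := (journey_stopped hw ht).2
    have h3 := word_journey w t
    have h4 := onStrand_journey hw t
    rw [word, h2, List.append_nil] at h3
    rw [OnStrand, h3, hw'] at h4
    refine ⟨t, ?_, by omega⟩
    rw [height, ← List.length_reverse, h3]
  intro n p hn hp
  have := h (w.take n) (w.drop n) (by simp) (f n)
  rw [← List.take_append_drop n w] at hf
  have h2 := hf.run
  simp only [List.length_take, min_eq_left hn, List.take_append_drop, h0, h1] at h2
  have h3 := congrFun (this h2.1 h2.2) p
  simp only [f, decide_eq_true_eq] at h3
  exact h3 hp

/-! #### Rigidity of words up to the local moves -/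

theorem plain_run (w : List (Layer (CatGen A))) : ColorRun w plain plain := by
  induction w with
  | nil => rfl
  | cons l w ih =>
    refine ⟨plain, ?_, ih⟩
    obtain ⟨i, g⟩ := l
    cases g with
    | bead a => rfl
    | cup => exact ⟨true, by funext p; simp [insertColor]⟩
    | cap => exact ⟨rfl, by funext p; simp [deleteColor]⟩
    | P => funext p; simp [swapColor]

variable {k : Type*} [CommRing k] [Ring A] [HopfAlgebra k A]

theorem WordStep.rigid_iff {m : ℕ} {x y : List (Layer (CatGen A))} (h : WordStep k m x y) :
    Rigid x ↔ Rigid y := by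
  obtain ⟨u, v, a, b, hm, -, rfl, rfl⟩ := h
  exact rigid_replace_iff hm.colorEquiv

namespace Word

/-- The only coloring of a word that is plain at the bottom and at the top is the plain one. -/
def Rigid {m : ℕ} (x : Word k A m) : Prop :=
  Quot.lift KnotOnString.Rigid (fun _ _ h => propext h.rigid_iff) x

/-- A label does not change the color of its strand, so a circle with labels can still be colored
like a bare one. -/
theorem exists_lab_layers (o : Lab A) : ∃ L : List (Layer (CatGen A)),
    (∀ (m : ℕ) (x : Word k A m), x.lab 0 o = x.app L) ∧ ∀ c, ColorRun L c c := by
  cases o with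
  | bead a => exact ⟨[(0, .bead a)], fun _ _ => rfl, fun c => ⟨c, rfl, rfl⟩⟩
  | pos =>
    refine ⟨[(1, .cup), (0, .P), (1, .cap)], fun m x => ?_, fun c => ?_⟩
    · simp only [lab, cup, P, cap, app_app]; rfl
    · exact (colorEquiv_curl.run c c).2 rfl
  | neg =>
    refine ⟨[(0, .cup), (1, .P), (0, .cap)], fun m x => ?_, fun c => ?_⟩
    · simp only [lab, cup, P, cap, app_app]; rfl
    · exact (colorEquiv_curlInv.run c c).2 rfl

theorem exists_labs_layers (l : List (Lab A)) : ∃ L : List (Layer (CatGen A)),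
    (∀ (m : ℕ) (x : Word k A m), x.labs 0 l = x.app L) ∧ ∀ c, ColorRun L c c := by
  induction l with
  | nil => exact ⟨[], fun m x => (app_nil x).symm, fun c => rfl⟩
  | cons o l ih =>
    obtain ⟨L, h1, h2⟩ := ih
    obtain ⟨L', h3, h4⟩ := exists_lab_layers (k := k) o
    refine ⟨L' ++ L, fun m x => ?_, fun c => ?_⟩
    · rw [labs_cons, h1, h3, app_app]
    · exact (colorRun_append _ _ _ _).2 ⟨c, h4 c, h2 c⟩

/-- The circle gets the color `false` and everything else remains plain; a cut just above the
minimum of the circle shows that the coloring is not plain. -/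
theorem Loopy.not_rigid {x : Word k A 1} (h : Loopy x) : ¬ x.Rigid := by
  induction h with
  | circle x l =>
    induction x using Quot.ind with
    | mk u =>
      obtain ⟨L, h1, h2⟩ := exists_labs_layers (k := k) l
      rw [h1]
      intro h
      have h3 : KnotOnString.Rigid (u ++ [(0, .cup)] ++ L ++ [(0, .cap)]) := h
      have h5 : ColorRun (u ++ [(0, .cup)] : List (Layer (CatGen A))) plain
          (insertColor 0 false plain) :=
        (colorRun_append _ _ _ _).2 ⟨plain, plain_run u, _, ⟨false, rfl⟩, rfl⟩
      have h6 : ColorStep ((0, .cap) : Layer (CatGen A)) (insertColor 0 false plain) plain :=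
        ⟨by simp [insertColor], by funext p; simp [deleteColor, insertColor]⟩
      have h4 := h3 (u ++ [(0, .cup)]) (L ++ [(0, .cap)]) (by simp) _ h5
        ((colorRun_append _ _ _ _).2 ⟨_, h2 _, plain, h6, rfl⟩)
      have := congrFun h4 0
      simp [insertColor] at this
  | app x w _ ih =>
    induction x using Quot.ind with
    | mk u =>
      intro h
      refine ih fun s t hst c h1 h2 => ?_
      have h3 : KnotOnString.Rigid (u ++ w) := h
      exact h3 s (t ++ w) (by simp [hst]) c h1
        ((colorRun_append _ _ _ _).2 ⟨plain, h2, plain_run w⟩)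

/-- A rigid word is a curl with a bead. -/
theorem exists_eq_bead_curl (hs : Function.Surjective (antip k (A := A)))
    {w : List (Layer (CatGen A))} (hw : Fits 1 w) (hw' : wout 1 w = 1)
    (hr : KnotOnString.Rigid w) :
    ∃ (a : A) (n : ℤ), mk k 1 w = mk k 1 ((0, .bead a) :: curlLayers A n) := by
  obtain h | h := reduced_mk hs w hw
  · obtain ⟨l, hl⟩ := h.eq_labs.2 hw'
    obtain ⟨a, n, h⟩ := exists_labs_eq hs (x := mk k 1 []) (by simp [mk, wd, wout]) l
    exact ⟨a, n, by rw [hl, h]; rfl⟩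
  · exact absurd hr h.not_rigid

end Word

end SingleStrand

/-! ### Changing the beads of a diagram -/

section ChangeBeads

open Traveller

variable {A B : Type*}

/-- Apply a map to the bead of a generator. -/
def CatGen.map (f : A → B) : CatGen A → CatGen B
  | .bead a => .bead (f a)
  | .cup => .cup
  | .cap => .cap
  | .P => .P

/-- Apply a map to all beads of a list of layers. -/
def mapBeads (f : A → B) (w : List (Layer (CatGen A))) : List (Layer (CatGen B)) :=
  w.map fun l => (l.1, l.2.map f)

/-- Apply a map to a bead on a strand. -/
def StrandEvent.map (f : A → B) : StrandEvent A → StrandEvent B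
  | .bead a => .bead (f a)
  | .turn δ => .turn δ

/-- Apply a map to all beads in the diagram of a traveller. -/
def Traveller.map (f : A → B) (c : Traveller A) : Traveller B :=
  ⟨mapBeads f c.below, mapBeads f c.above, c.pos, c.up⟩

theorem inn_map (f : A → B) (g : CatGen A) : inn (g.map f) = inn g := by cases g <;> rfl

theorem out_map (f : A → B) (g : CatGen A) : out (g.map f) = out g := by cases g <;> rfl

theorem wout_mapBeads (f : A → B) (n : ℕ) (w : List (Layer (CatGen A))) :
    wout n (mapBeads f w) = wout n w := by
  induction w generalizing n with
  | nil => rfl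
  | cons l w ih => simp only [mapBeads, List.map_cons, wout, inn_map, out_map]; exact ih _

theorem fits_mapBeads (f : A → B) (n : ℕ) (w : List (Layer (CatGen A))) :
    Fits n (mapBeads f w) ↔ Fits n w := by
  induction w generalizing n with
  | nil => rfl
  | cons l w ih =>
    simp only [mapBeads, List.map_cons, Fits, inn_map, out_map]
    exact and_congr_right fun _ => ih _

/-- The route depends on the curve alone; the beads are merely read off. This permits marking one
bead by a value of its own. -/
theorem advance_map (f : A → B) (c : Traveller A) :
    (c.map f).advance = (c.advance.1.map (StrandEvent.map f), c.next.map f) := by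
  induction c using induction_advance with
  | stopped c hc =>
    have : (c.map f).Stopped := by
      obtain ⟨h1, h2⟩ | ⟨h1, h2⟩ := hc
      · exact .inl ⟨h1, by simp [Traveller.map, mapBeads, h2]⟩
      · exact .inr ⟨h1, by simp [Traveller.map, mapBeads, h2]⟩
    rw [advance_of_stopped this, next_of_stopped hc, advance_of_stopped hc]
    rfl
  | up be i g ab p =>
    cases g <;> simp only [next, Traveller.map, mapBeads, CatGen.map, List.map_cons,
      advance_up_bead, advance_up_P, advance_up_cup, advance_up_cap] <;> (try split_ifs) <;> rfl
  | down i g be ab p =>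
    cases g <;> simp only [next, Traveller.map, mapBeads, CatGen.map, List.map_cons,
      advance_down_bead, advance_down_P, advance_down_cup, advance_down_cap] <;>
      (try split_ifs) <;> rfl

theorem events_map (f : A → B) (t : ℕ) (c : Traveller A) :
    events t (c.map f) = (events t c).map (StrandEvent.map f) := by
  induction t generalizing c with
  | zero => rfl
  | succ t ih => rw [events, events, next, advance_map, List.map_append, ih]

theorem journey_map (f : A → B) (w : List (Layer (CatGen A))) (t : ℕ) :
    journey (mapBeads f w) t = (journey w t).map f := by
  induction t with
  | zero => rfl
  | succ t ih => rw [journey_succ, journey_succ, ih, next, advance_map]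

theorem widths_mapBeads (f : A → B) (n : ℕ) (w : List (Layer (CatGen A))) :
    widths n (mapBeads f w) = widths n w := by
  induction w generalizing n with
  | nil => rfl
  | cons l w ih =>
    simp only [mapBeads, List.map_cons, widths, inn_map, out_map]
    exact congrArg _ (ih _)

theorem strandEvents_mapBeads (f : A → B) (w : List (Layer (CatGen A))) :
    strandEvents (mapBeads f w) = (strandEvents w).map (StrandEvent.map f) := by
  rw [strandEvents, strandEvents, flatMap_events, flatMap_events, widths_mapBeads]
  exact events_map f _ ⟨[], w, 0, true⟩

theorem halfTurns_map (f : A → B) (l : List (StrandEvent A)) :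
    halfTurns (l.map (StrandEvent.map f)) = halfTurns l := by
  induction l with
  | nil => rfl
  | cons e l ih => cases e <;> simp [StrandEvent.map, halfTurns, ih]

theorem Visits.mapBeads {w : List (Layer (CatGen A))} (h : Visits w) (f : A → B) :
    Visits (mapBeads f w) := by
  intro n p hn hp
  have e : (KnotOnString.mapBeads f w).take n = KnotOnString.mapBeads f (w.take n) := by
    simp [KnotOnString.mapBeads]
  rw [e, wout_mapBeads] at hp
  obtain ⟨t, h1, h2⟩ := h n p (by simpa [KnotOnString.mapBeads] using hn) hp
  exact ⟨t, by rw [journey_map, ← h1]; simp [height, Traveller.map, KnotOnString.mapBeads],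
    by rw [journey_map, ← h2]; rfl⟩

/-! #### A bead in a single-stranded diagram is met exactly once -/

theorem mem_events {e : StrandEvent A} {t : ℕ} {c : Traveller A} (h : e ∈ events t c) :
    ∃ r < t, e ∈ (next^[r] c).advance.1 := by
  induction t generalizing c with
  | zero => simp [events] at h
  | succ t ih =>
    rw [events, List.mem_append] at h
    obtain h | h := h
    · exact ⟨0, by omega, h⟩
    · obtain ⟨r, hr, h⟩ := ih h
      exact ⟨r + 1, by omega, h⟩

/-- The traveller is about to meet a bead in position `i` of the layer at height `h`. -/
def AtBead (h i : ℕ) (c : Traveller A) : Prop :=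
  (c.up = true ∧ c.height = h ∧ c.pos = i ∧ c.next.height = h + 1 ∧ c.next.pos = i) ∨
  (c.up = false ∧ c.height = h + 1 ∧ c.pos = i ∧ c.next.height = h ∧ c.next.pos = i)

/-- Since the value `a` occurs only once in the diagram, the event betrays the place of the
traveller. -/
theorem atBead_of_mem {a : A} {u v : List (Layer (CatGen A))} {i : ℕ}
    (hu : ∀ j, (j, CatGen.bead a) ∉ u) (hv : ∀ j, (j, CatGen.bead a) ∉ v) {c : Traveller A}
    (hc : c.word = u ++ [(i, .bead a)] ++ v) (h : .bead a ∈ c.advance.1) :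
    AtBead u.length i c ∧ c.advance.1 = [.bead a] := by
  have key : ∀ be ab : List (Layer (CatGen A)), ∀ j,
      be.reverse ++ (j, .bead a) :: ab = u ++ [(i, .bead a)] ++ v →
      be.length = u.length ∧ j = i := by
    intro be ab j e
    rw [List.append_assoc, List.singleton_append, List.append_eq_append_iff] at e
    obtain ⟨x, rfl, h⟩ | ⟨x, h', h⟩ := e
    · cases x with
      | nil => simp_all
      | cons l x =>
        simp only [List.cons_append, List.cons.injEq] at h
        exact absurd (by simp [h.1]) (hu j)
    · cases x with
      | nil =>
        simp only [List.append_nil] at h'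
        rw [← h', List.length_reverse]
        simp_all
      | cons l x =>
        simp only [List.cons_append, List.cons.injEq] at h
        exact absurd (by simp [h.2]) (hv j)
  induction c using induction_advance with
  | stopped c hs => rw [advance_of_stopped hs] at h; simp at h
  | up be j g ab p =>
    cases g with
    | bead b =>
      rw [advance_up_bead] at h ⊢
      split_ifs at h ⊢ with hp
      · obtain rfl : a = b := by simpa using h
        obtain ⟨h1, rfl⟩ := key be ab j (by simpa [word] using hc)
        exact ⟨.inl ⟨rfl, h1, hp, by simp [next, advance_up_bead, height, h1],
          by simp [next, advance_up_bead, hp]⟩, rfl⟩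
      · simp at h
    | P => rw [advance_up_P] at h; split_ifs at h <;> simp at h
    | cup => rw [advance_up_cup] at h; split_ifs at h <;> simp at h
    | cap => rw [advance_up_cap] at h; split_ifs at h <;> simp at h
  | down j g be ab p =>
    cases g with
    | bead b =>
      rw [advance_down_bead] at h ⊢
      split_ifs at h ⊢ with hp
      · obtain rfl : a = b := by simpa using h
        obtain ⟨h1, rfl⟩ := key be ab j (by simpa [word] using hc)
        exact ⟨.inr ⟨rfl, by simp [height, h1], hp, by simp [next, advance_down_bead, height, h1],
          by simp [next, advance_down_bead, hp]⟩, rfl⟩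
      · simp at h
    | P => rw [advance_down_P] at h; split_ifs at h <;> simp at h
    | cup => rw [advance_down_cup] at h; split_ifs at h <;> simp at h
    | cap => rw [advance_down_cap] at h; split_ifs at h <;> simp at h

/-- Two meetings with the bead, in the same or in opposite directions, would visit a point next to
it twice. -/
theorem AtBead.unique {w : List (Layer (CatGen A))} {h i s t : ℕ} (hst : s < t)
    (hn : ∀ r ≤ t, ¬ (journey w r).Stopped) (h1 : AtBead h i (journey w s))
    (h2 : AtBead h i (journey w t)) : False := by
  rw [AtBead, ← journey_succ] at h1 h2
  obtain ⟨-, a1, a2, a3, a4⟩ | ⟨-, a1, a2, a3, a4⟩ := h1 <;>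
    obtain ⟨-, b1, b2, b3, b4⟩ | ⟨-, b1, b2, b3, b4⟩ := h2
  · exact journey_point_injective hst (fun r hr => hn r hr.le) (by omega) (by omega)
  · exact journey_point_injective (show s < t + 1 by omega) (fun r hr => hn r (by omega))
      (by omega) (by omega)
  · exact journey_point_injective (show s < t + 1 by omega) (fun r hr => hn r (by omega))
      (by omega) (by omega)
  · exact journey_point_injective hst (fun r hr => hn r hr.le) (by omega) (by omega)

/-- A journey at the point below the bead is either on its way up, and meets the bead next, or has
just come down through it. -/
theorem exists_meets {a : A} {u v : List (Layer (CatGen A))} {i : ℕ} {t : ℕ}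
    (hh : (journey (u ++ [(i, .bead a)] ++ v) t).height = u.length)
    (hp : (journey (u ++ [(i, .bead a)] ++ v) t).pos = i) :
    ∃ s, (journey (u ++ [(i, .bead a)] ++ v) s).advance.1 = [.bead a] := by
  set w := u ++ [(i, .bead a)] ++ v with hw
  have hd : (⟨u.reverse, (i, .bead a) :: v, i, true⟩ : Traveller A).word = w := by simp [word, hw]
  obtain h | h := eq_or_eq_rev ((word_journey w t).trans hd.symm)
    (by rw [hh]; simp [height]) (by rw [hp])
  · exact ⟨t, by rw [h, advance_up_bead, if_pos rfl]⟩
  · induction t with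
    | zero =>
      have := congrArg Traveller.up h
      simp [journey_zero, rev] at this
    | succ t ih =>
      by_cases hst : (journey w t).Stopped
      · have : journey w (t + 1) = journey w t := by rw [journey_succ, next_of_stopped hst]
        rw [this] at hh hp h
        exact ih hh hp h
      · have h1 := next_rev_next hst
        rw [← journey_succ, h, rev_rev, next, advance_up_bead] at h1
        refine ⟨t, ?_⟩
        rw [← rev_rev (journey w t), ← h1]
        simp only [rev, Bool.not_true]
        rw [advance_down_bead, if_pos rfl]

theorem exists_strandEvents_eq {a : A} {u v : List (Layer (CatGen A))} {i : ℕ}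
    (hu : ∀ j, (j, CatGen.bead a) ∉ u) (hv : ∀ j, (j, CatGen.bead a) ∉ v)
    (hf : Fits 1 (u ++ [(i, .bead a)] ++ v)) (hs : Visits (u ++ [(i, .bead a)] ++ v)) :
    ∃ l₁ l₂, strandEvents (u ++ [(i, .bead a)] ++ v) = l₁ ++ [.bead a] ++ l₂ ∧
      .bead a ∉ l₁ ∧ .bead a ∉ l₂ := by
  have hfu := hf
  rw [List.append_assoc, fits_append] at hfu
  have hi : i + 1 ≤ wout 1 u := hfu.2.1
  obtain ⟨t, ht, hp⟩ := hs u.length i (by simp) (by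
    rw [List.append_assoc, List.take_left]; omega)
  obtain ⟨s, hs⟩ := exists_meets ht hp
  set w := u ++ [(i, .bead a)] ++ v with hw
  obtain ⟨N, -, hN⟩ := exists_stopped hf
  have hns : ∀ r, .bead a ∈ (journey w r).advance.1 → ∀ q ≤ r, ¬ (journey w q).Stopped := by
    intro r hr q hq hst
    have h3 := iterate_next_of_stopped hst (r - q)
    rw [journey_eq, ← Function.iterate_add_apply, ← journey_eq, ← journey_eq,
      Nat.sub_add_cancel hq] at h3
    rw [h3, advance_of_stopped hst] at hr
    simp at hr
  have hat : ∀ r, .bead a ∈ (journey w r).advance.1 → AtBead u.length i (journey w r) :=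
    fun r hr => (atBead_of_mem hu hv (word_journey w r) hr).1
  have hsm : .bead a ∈ (journey w s).advance.1 := by rw [hs]; simp
  have hsN : s < N := by
    by_contra hsN
    exact hns s hsm N (by omega) hN
  obtain ⟨m, rfl⟩ := Nat.exists_eq_add_of_lt hsN
  refine ⟨events s ⟨[], w, 0, true⟩, events m (journey w (s + 1)), ?_, fun h => ?_, fun h => ?_⟩
  · rw [← events_eq_strandEvents hf hN, add_assoc, add_comm m 1, ← add_assoc, events_add (s + 1),
      events_add s, ← journey_eq, ← journey_eq]
    simp only [events, List.append_nil, hs]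
  · obtain ⟨r, hr, h⟩ := mem_events h
    exact AtBead.unique hr (hns s hsm) (hat r h) (hat s hsm)
  · obtain ⟨r, hr, h⟩ := mem_events h
    rw [journey_eq, ← Function.iterate_add_apply, ← journey_eq] at h
    exact AtBead.unique (show s < r + (s + 1) by omega) (hns _ h) (hat s hsm) (hat _ h)

end ChangeBeads

/-! ### The linear functional that concentrates the beads -/

section Concentration

open Traveller

variable {k : Type*} {A : Type*} [CommRing k] [Ring A] [HopfAlgebra k A]

theorem concentrate_map_congr (f g : Option A → A) (hfg : ∀ a, f (some a) = g (some a)) (q : ℤ)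
    {l : List (StrandEvent (Option A))} (hl : .bead none ∉ l) :
    concentrate k q (l.map (StrandEvent.map f)) = concentrate k q (l.map (StrandEvent.map g)) := by
  induction l generalizing q with
  | nil => rfl
  | cons e l ih =>
    rw [List.mem_cons, not_or] at hl
    cases e with
    | turn δ => exact ih _ hl.2
    | bead a =>
      cases a with
      | none => exact absurd rfl hl.1
      | some a => simp only [List.map_cons, StrandEvent.map, concentrate, hfg, ih _ hl.2]

/-- The concentrated product depends on every bead of a single-stranded diagram through a power
of the antipode. -/
theorem exists_concentrate_eq {u v : List (Layer (CatGen A))} {i : ℕ}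
    (hf : Fits 1 (u ++ [(i, .bead 0)] ++ v)) (hw : wout 1 (u ++ [(i, .bead 0)] ++ v) = 1)
    (hr : Rigid (u ++ [(i, .bead 0)] ++ v)) :
    ∃ (x y : A) (q : ℤ), ∀ a : A,
      concentrate k 0 (strandEvents (u ++ [(i, .bead a)] ++ v)) = x * antipPow k q a * y := by
  -- All beads but one become `some _` and the distinguished one becomes `none`, so that it can be
  -- told apart even from beads of the same value.
  let u' := mapBeads some u
  let v' := mapBeads some v
  have hmem : ∀ (w : List (Layer (CatGen A))) (j : ℕ), (j, CatGen.bead none) ∉ mapBeads some w := by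
    intro w j h
    simp only [mapBeads, List.mem_map] at h
    obtain ⟨⟨j', g⟩, -, h⟩ := h
    cases g <;> simp [CatGen.map] at h
  have hmap : ∀ a : A, mapBeads (fun o : Option A => o.getD a) (u' ++ [(i, .bead none)] ++ v') =
      u ++ [(i, .bead a)] ++ v := by
    intro a
    have h : ∀ w : List (Layer (CatGen A)), mapBeads (fun o : Option A => o.getD a)
        (mapBeads some w) = w := by
      intro w
      simp only [mapBeads, List.map_map]
      conv_rhs => rw [← List.map_id w]
      refine List.map_congr_left fun l _ => ?_
      obtain ⟨j, g⟩ := l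
      cases g <;> rfl
    have e : ∀ x y : List (Layer (CatGen (Option A))), mapBeads (fun o : Option A => o.getD a)
        (x ++ y) = mapBeads (fun o : Option A => o.getD a) x ++
          mapBeads (fun o : Option A => o.getD a) y := fun x y => List.map_append
    rw [e, e, h, h]
    rfl
  have hf' : Fits 1 (u' ++ [(i, .bead none)] ++ v') := by
    rw [← fits_mapBeads (fun o : Option A => o.getD 0), hmap]; exact hf
  have hvis : Visits (u' ++ [(i, .bead none)] ++ v') := by
    have h := (hr.visits hf hw).mapBeads some
    have e : ∀ x y : List (Layer (CatGen A)), mapBeads some (x ++ y) =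
        mapBeads some x ++ mapBeads some y := fun x y => List.map_append
    rw [e, e] at h
    -- The marked diagram is not an image under `some`. Via rigidity the bead `some 0` is deleted
    -- and `none` is put in its place.
    have h1 := h.rigid (by rw [← e, ← e]; exact (fits_mapBeads _ _ _).2 hf)
    have h2 := (rigid_replace_iff (colorEquiv_bead i (some (0 : A)))).1 h1
    have h3 := (rigid_replace_iff (colorEquiv_bead i (none : Option A))).2 h2
    refine h3.visits hf' ?_
    rw [← wout_mapBeads (fun o : Option A => o.getD 0), hmap]; exact hw
  obtain ⟨l₁, l₂, h, h1, h2⟩ := exists_strandEvents_eq (hmem u) (hmem v) hf' hvis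
  let fill : A → Option A → A := fun a o => o.getD a
  -- The factors come from the events before and after the marked bead, and the exponent is the
  -- number of half turns before it. The default `0` is never read in the outer factors, as `none`
  -- does not occur there.
  refine ⟨concentrate k 0 (l₁.map (StrandEvent.map (fill 0))),
    concentrate k (halfTurns l₁) (l₂.map (StrandEvent.map (fill 0))), halfTurns l₁, fun a => ?_⟩
  rw [← hmap, strandEvents_mapBeads, h, List.map_append, List.map_append, concentrate_append,
    concentrate_append, halfTurns_append, halfTurns_map]
  rw [concentrate_map_congr _ (fill 0) (by simp [fill]) _ h1,
    concentrate_map_congr _ (fill 0) (by simp [fill]) _ h2]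
  simp [concentrate, StrandEvent.map, halfTurns]

theorem CatMove.ne_nil {x y : List (Layer (CatGen A))} (h : CatMove k x y) : x ≠ [] := by
  cases h <;> simp

theorem CatMove.sameEvents (hs : Function.Bijective (antip k (A := A)))
    {x y u v : List (Layer (CatGen A))} (h : CatMove k x y) (hx : Fits 1 (u ++ x ++ v))
    (hy : Fits 1 (u ++ y ++ v)) :
    SameEvents k true (strandEvents (u ++ x ++ v)) (strandEvents (u ++ y ++ v)) :=
  (h.simulates hs).strandEvents (SameEvents.congruence k) h.ne_nil hx hy

theorem WordStep.sameEvents (hs : Function.Bijective (antip k (A := A)))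
    {x y : List (Layer (CatGen A))} (h : WordStep k 1 x y) (hx : Fits 1 x) :
    SameEvents k true (strandEvents x) (strandEvents y) := by
  have hy := h.fits_iff.1 hx
  obtain ⟨u, v, a, b, hm, -, rfl, rfl⟩ := h
  exact hm.sameEvents hs hx hy

/-- Equality in the quotient is a chain of moves in both directions. That every member of the chain
fits has to be carried along the induction. -/
theorem Word.sameEvents (hs : Function.Bijective (antip k (A := A)))
    {x y : List (Layer (CatGen A))} (h : mk k 1 x = mk k 1 y) (hx : Fits 1 x) :
    SameEvents k true (strandEvents x) (strandEvents y) := by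
  have h' := Quot.eqvGen_exact h
  have : (Fits 1 x ↔ Fits 1 y) ∧
      (Fits 1 x → SameEvents k true (strandEvents x) (strandEvents y)) := by
    clear h hx
    induction h' with
    | rel x y h => exact ⟨h.fits_iff, h.sameEvents hs⟩
    | refl x => exact ⟨Iff.rfl, fun _ => ⟨rfl, fun _ _ => rfl⟩⟩
    | symm x y _ ih =>
      refine ⟨ih.1.symm, fun h => ?_⟩
      have := ih.2 (ih.1.2 h)
      exact ⟨this.1.symm, fun q hq => (this.2 q hq).symm⟩
    | trans x y z _ _ ih ih' =>
      refine ⟨ih.1.trans ih'.1, fun h => ?_⟩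
      have h1 := ih.2 h
      have h2 := ih'.2 (ih.1.1 h)
      exact ⟨h1.1.trans h2.1, fun q hq => (h1.2 q hq).trans (h2.2 q hq)⟩
  exact this.2 hx

theorem fits_bead_congr {B : Type*} {u v : List (Layer (CatGen B))} {i m n : ℕ} {a : B} (b : B) :
    (Fits m (u ++ [(i, .bead a)] ++ v) ∧ wout m (u ++ [(i, .bead a)] ++ v) = n) ↔
    (Fits m (u ++ [(i, .bead b)] ++ v) ∧ wout m (u ++ [(i, .bead b)] ++ v) = n) := by
  simp only [fits_append, wout_append]
  rfl

open Classical in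
/-- The concentrated product of a single-stranded diagram. -/
noncomputable def strandElement (k : Type*) {A : Type*} [CommRing k] [Ring A] [HopfAlgebra k A]
    (w : List (Layer (CatGen A))) : A :=
  if Rigid w then concentrate k 0 (strandEvents w) else 0

theorem strandElement_congr {x y : List (Layer (CatGen A))} (h : Rigid x ↔ Rigid y)
    (hc : concentrate k 0 (strandEvents x) = concentrate k 0 (strandEvents y)) :
    strandElement k x = strandElement k y := by
  by_cases hx : Rigid x
  · rw [strandElement, strandElement, if_pos hx, if_pos (h.1 hx), hc]
  · rw [strandElement, strandElement, if_neg hx, if_neg (fun hy => hx (h.2 hy))]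

/-- In a rigid diagram the bead is met exactly once, so it enters through one power of `s`. In a
diagram with further components the concentrated product might ignore the bead and would not be
linear in it; this is the reason for the value zero there. -/
theorem strandElement_linear (hs : Function.Bijective (antip k (A := A)))
    {u v : List (Layer (CatGen A))} {i : ℕ} (hf : Fits 1 (u ++ [(i, .bead 0)] ++ v))
    (hw : wout 1 (u ++ [(i, .bead 0)] ++ v) = 1) :
    IsLinearMap k fun a => strandElement k (u ++ [(i, .bead a)] ++ v) := by
  have e : ∀ a : A, Rigid (u ++ [(i, .bead a)] ++ v) ↔ Rigid (u ++ [(i, .bead 0)] ++ v) :=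
    fun a => (rigid_replace_iff (colorEquiv_bead i a)).trans
      (rigid_replace_iff (colorEquiv_bead i 0)).symm
  by_cases h : Rigid (u ++ [(i, .bead 0)] ++ v)
  · obtain ⟨x, y, q, hq⟩ := exists_concentrate_eq (k := k) hf hw h
    have e' : (fun a => strandElement k (u ++ [(i, .bead a)] ++ v)) =
        fun a => x * antipPow k q a * y := by
      funext a
      rw [strandElement, if_pos ((e a).2 h), hq]
    rw [e']
    exact ⟨fun a b => by rw [(antipPow_isLinearMap hs q).map_add, mul_add, add_mul],
      fun c a => by rw [(antipPow_isLinearMap hs q).map_smul, mul_smul_comm, smul_mul_assoc]⟩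
  · have e' : (fun a => strandElement k (u ++ [(i, .bead a)] ++ v)) = fun a => 0 := by
      funext a
      rw [strandElement, if_neg (fun h' => h ((e a).1 h'))]
    rw [e']
    exact ⟨fun a b => by simp, fun c a => by simp⟩

/-- The concentrated product, as a linear map on morphisms. -/
noncomputable def CatHom.element (hs : Function.Bijective (antip k (A := A))) :
    CatHom k A 1 1 →ₗ[k] A :=
  (catRelSpan k A 1 1).liftQ (Finsupp.linearCombination k fun D => strandElement k D.layers) (by
    rw [catRelSpan, Submodule.span_le]
    rintro _ ⟨f, g, h, rfl⟩
    rw [SetLike.mem_coe, LinearMap.mem_ker, map_sub, sub_eq_zero]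
    cases h with
    | move D D' h =>
      obtain ⟨u, v, x, y, hm, h1, h2⟩ := h
      simp only [Finsupp.linearCombination_single, one_smul]
      have hx := D.fits_layers.1
      have hy := D'.fits_layers.1
      rw [h1] at hx ⊢
      rw [h2] at hy ⊢
      have := (hm.sameEvents hs hx hy).2 0 (by simp)
      exact strandElement_congr (rigid_replace_iff hm.colorEquiv) this
    | add D D₁ D₂ u v i a b h h₁ h₂ =>
      simp only [map_add, Finsupp.linearCombination_single, one_smul, h, h₁, h₂]
      have hD := D.fits_layers
      rw [h] at hD
      rw [fits_bead_congr 0] at hD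
      exact (strandElement_linear hs hD.1 hD.2).map_add a b
    | smul D D₁ u v i c a h h₁ =>
      simp only [map_smul, Finsupp.linearCombination_single, one_smul, h, h₁]
      have hD := D.fits_layers
      rw [h] at hD
      rw [fits_bead_congr 0] at hD
      exact (strandElement_linear hs hD.1 hD.2).map_smul c a)

theorem CatHom.element_of (hs : Function.Bijective (antip k (A := A))) (D : BeadDiagram A 1 1) :
    CatHom.element hs (CatHom.of k D) = strandElement k D.layers := by
  have : CatHom.element hs (CatHom.of k D) =
    Finsupp.linearCombination k (fun D : BeadDiagram A 1 1 => strandElement k D.layers)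
      (Finsupp.single D 1) := rfl
  rw [this, Finsupp.linearCombination_single, one_smul]

/-! #### Curls -/

/-- The only connection between the two diagrams is one point, and the journey through `u` ends
there going up, so it does not come back. -/
theorem strandEvents_append {B : Type*} {u v : List (Layer (CatGen B))} (hu : Fits 1 u) (hu' : wout 1 u = 1)
    (hv : Fits 1 v) : strandEvents (u ++ v) = strandEvents u ++ strandEvents v := by
  obtain ⟨s, -, hs⟩ := exists_stopped hu
  obtain ⟨t, -, ht⟩ := exists_stopped hv
  obtain ⟨r, h1, h2, -⟩ := exists_iterate_frame [] v hs
  obtain ⟨q, h3, h4, -⟩ := exists_iterate_frame u.reverse [] ht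
  have hst := journey_stopped hu hs
  have hw := word_journey u s
  have hpos := onStrand_journey hu s
  have e : journey u s = ⟨u.reverse, [], 0, true⟩ := by
    rw [word, hst.2, List.append_nil] at hw
    rw [OnStrand, hw, hu'] at hpos
    refine eq_of_height ?_ ?_ (by simpa using hpos) hst.1
    · rw [word_journey]; simp [word]
    · simp only [height]
      rw [← List.length_reverse, hw, List.length_reverse]
  rw [← journey_eq, e] at h1
  have e1 : frame [] v ⟨[], u, 0, true⟩ = (⟨[], u ++ v, 0, true⟩ : Traveller B) := by simp [frame]
  have e2 : frame [] v ⟨u.reverse, [], 0, true⟩ =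
      frame u.reverse [] (⟨[], v, 0, true⟩ : Traveller B) := by simp [frame]
  rw [e1, e2] at h1
  rw [e1] at h2
  have h_top : (journey (u ++ v) (q + r)).Stopped := by
    rw [journey_eq, Function.iterate_add_apply, h1, h3]
    have := journey_stopped hv ht
    exact .inl ⟨this.1, by
      change (journey v t).above ++ [] = []
      rw [this.2]; rfl⟩
  rw [← events_eq_strandEvents ((fits_append _ _ _).2 ⟨hu, by rwa [hu']⟩) h_top, add_comm q r,
    events_add, h1, h2, h4, events_eq_strandEvents hu hs, events_eq_strandEvents hv ht]

/-- A curl consists of two half turns of the same sign and carries no bead. -/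
theorem curlLayers_spec (n : ℤ) : Fits 1 (curlLayers A n) ∧ wout 1 (curlLayers A n) = 1 ∧
    halfTurns (strandEvents (curlLayers A n)) = 2 * n ∧
    ∀ q, concentrate k q (strandEvents (curlLayers A n)) = 1 := by
  have key : ∀ (x : List (Layer (CatGen A))) (δ : ℤ), Fits 1 x → wout 1 x = 1 →
      strandEvents x = [.turn δ, .turn δ] → ∀ n : ℕ,
      Fits 1 (List.replicate n x).flatten ∧ wout 1 (List.replicate n x).flatten = 1 ∧
      halfTurns (strandEvents (List.replicate n x).flatten) = 2 * (n * δ) ∧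
      ∀ q, concentrate k q (strandEvents (List.replicate n x).flatten) = 1 := by
    intro x δ h1 h2 h3 n
    induction n with
    | zero => exact ⟨trivial, rfl, by simp [strandEvents, halfTurns, widths, journey, advance],
        fun q => rfl⟩
    | succ n ih =>
      obtain ⟨i1, i2, i3, i4⟩ := ih
      rw [List.replicate_succ, List.flatten_cons]
      refine ⟨(fits_append _ _ _).2 ⟨h1, by rwa [h2]⟩, by rw [wout_append, h2, i2], ?_, fun q => ?_⟩
      · rw [strandEvents_append h1 h2 i1, halfTurns_append, h3, i3]
        simp only [halfTurns]
        push_cast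
        ring
      · rw [strandEvents_append h1 h2 i1, concentrate_append, h3, i4]
        simp [concentrate]
  cases n with
  | ofNat n =>
    have := key [(1, .cup), (0, .P), (1, .cap)] 1 (by simp [Fits]) (by simp [wout]) rfl n
    simpa [curlLayers] using this
  | negSucc n =>
    have := key [(0, .cup), (1, .P), (0, .cap)] (-1) (by simp [Fits]) (by simp [wout]) rfl (n + 1)
    refine ⟨this.1, this.2.1, this.2.2.1.trans ?_, this.2.2.2⟩
    rw [Int.negSucc_eq]
    push_cast
    ring

theorem bead_curlLayers_spec (a : A) (n : ℤ) : Fits 1 ((0, .bead a) :: curlLayers A n) ∧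
    wout 1 ((0, .bead a) :: curlLayers A n) = 1 ∧
    halfTurns (strandEvents ((0, .bead a) :: curlLayers A n)) = 2 * n ∧
    concentrate k 0 (strandEvents ((0, .bead a) :: curlLayers A n)) = a := by
  obtain ⟨h1, h2, h3, h4⟩ := curlLayers_spec (k := k) (A := A) n
  have hb : Fits 1 [((0 : ℕ), CatGen.bead a)] := by simp [Fits]
  have hb' : wout 1 [((0 : ℕ), CatGen.bead a)] = 1 := by simp [wout]
  have hb'' : strandEvents [((0 : ℕ), CatGen.bead a)] = [.bead a] := rfl
  have e := strandEvents_append hb hb' h1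
  rw [hb'', List.singleton_append, List.singleton_append] at e
  refine ⟨⟨by simp, by simpa using h1⟩, by simpa [wout] using h2, ?_, ?_⟩
  · rw [e, halfTurns, h3]
  · rw [e, concentrate, h4, mul_one]; rfl

/-- Every single-stranded diagram is, up to the local moves, a bead followed by a curl. -/
theorem Word.mk_eq_bead_curl (hs : Function.Bijective (antip k (A := A)))
    {w : List (Layer (CatGen A))} (hw : Fits 1 w) (hw' : wout 1 w = 1)
    (hr : KnotOnString.Rigid w) :
    mk k 1 w = mk k 1 ((0, .bead (concentrate k 0 (strandEvents w))) ::
      curlLayers A (halfTurns (strandEvents w) / 2)) := by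
  obtain ⟨a, n, h⟩ := exists_eq_bead_curl hs.2 hw hw' hr
  obtain ⟨-, -, h1, h2⟩ := bead_curlLayers_spec (k := k) a n
  obtain ⟨h3, h4⟩ := sameEvents hs h hw
  -- The unknown bead and exponent of the reduced word are recovered from the two invariants, which
  -- have the same values on `w`.
  rw [h3, h4 0 (by simp), h1, h2, h, Int.mul_ediv_cancel_left _ (by norm_num)]

end Concentration

/-! ### Quasitriangular Hopf algebras -/

section QuasitriangularHopf

variable {k A ι : Type*} [CommRing k] [Ring A] [HopfAlgebra k A] [Fintype ι]

variable {ρ : (A ⊗[k] A)ˣ} {e e' : ι → A}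

theorem leg13_mul_leg23 (he : (ρ : A ⊗[k] A) = ∑ x, e x ⊗ₜ[k] e' x) :
    leg13 k (ρ : A ⊗[k] A) * leg23 k (ρ : A ⊗[k] A) =
      ∑ x, ∑ y, e x ⊗ₜ[k] (e y ⊗ₜ[k] (e' x * e' y)) := by
  rw [he, map_sum, map_sum, Finset.sum_mul_sum]
  simp [leg13, leg23]

theorem leg13_mul_leg12 (he : (ρ : A ⊗[k] A) = ∑ x, e x ⊗ₜ[k] e' x) :
    leg13 k (ρ : A ⊗[k] A) * leg12 k (ρ : A ⊗[k] A) =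
      ∑ x, ∑ y, (e x * e y) ⊗ₜ[k] (e' y ⊗ₜ[k] e' x) := by
  rw [he, map_sum, map_sum, Finset.sum_mul_sum]
  simp [leg13, leg12]

/-- The counit on the first leg of `(Δ ⊗ 1) ρ = ρ₁₃ ρ₂₃` gives `ρ = (1 ⊗ c) ρ`, where `c` is the sum
in question; then `ρ` is cancelled. -/
theorem IsQuasitriangular.sum_counit_left (hρ : IsQuasitriangular k ρ)
    (he : (ρ : A ⊗[k] A) = ∑ x, e x ⊗ₜ[k] e' x) : ∑ x, Coalgebra.counit (R := k) (e x) • e' x = 1 := by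
  have h := hρ.comul_tensor_id
  rw [leg13_mul_leg23 he, he] at h
  let M : A ⊗[k] (A ⊗[k] A) →ₗ[k] A ⊗[k] A :=
    (TensorProduct.lid k (A ⊗[k] A)).toLinearMap ∘ₗ LinearMap.rTensor (A ⊗[k] A) (Coalgebra.counit (R := k) (A := A))
  have hM : ∀ t : A ⊗[k] A, ∀ c : A, M (TensorProduct.assoc k A A A (t ⊗ₜ c)) =
      (TensorProduct.lid k A (LinearMap.rTensor A (Coalgebra.counit (R := k) (A := A)) t)) ⊗ₜ c := by
    intro t c
    induction t using TensorProduct.induction_on with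
    | zero => simp
    | tmul a b => simp [M, TensorProduct.smul_tmul']
    | add x y hx hy => simp only [TensorProduct.add_tmul, map_add, hx, hy]
  have h1 := congrArg M h
  simp only [map_sum, LinearMap.rTensor_tmul, hM, Coalgebra.rTensor_counit_comul,
    TensorProduct.lid_tmul, one_smul] at h1
  simp only [M, LinearMap.comp_apply, LinearMap.rTensor_tmul, LinearEquiv.coe_coe,
    TensorProduct.lid_tmul] at h1
  have h2 : ((1 : A) ⊗ₜ[k] (∑ x, Coalgebra.counit (R := k) (e x) • e' x)) * (ρ : A ⊗[k] A) = (ρ : A ⊗[k] A) := by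
    conv_rhs => rw [he, h1]
    rw [he, TensorProduct.tmul_sum, Finset.sum_mul_sum]
    simp [TensorProduct.tmul_smul]
  have h3 : (1 : A) ⊗ₜ[k] (∑ x, Coalgebra.counit (R := k) (e x) • e' x) = 1 := by
    have := congrArg (· * ((ρ⁻¹ : (A ⊗[k] A)ˣ) : A ⊗[k] A)) h2
    simpa [mul_assoc] using this
  have h4 := congrArg (fun t => TensorProduct.lid k A (LinearMap.rTensor A (Coalgebra.counit (R := k) (A := A)) t)) h3
  simpa [Algebra.TensorProduct.one_def] using h4

/-- Likewise, with the counit on the middle leg of `(1 ⊗ Δ) ρ = ρ₁₃ ρ₁₂`. -/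
theorem IsQuasitriangular.sum_counit_right (hρ : IsQuasitriangular k ρ)
    (he : (ρ : A ⊗[k] A) = ∑ x, e x ⊗ₜ[k] e' x) : ∑ x, Coalgebra.counit (R := k) (e' x) • e x = 1 := by
  have h := hρ.id_tensor_comul
  rw [leg13_mul_leg12 he, he] at h
  let M : A ⊗[k] (A ⊗[k] A) →ₗ[k] A ⊗[k] A :=
    LinearMap.lTensor A ((TensorProduct.lid k A).toLinearMap ∘ₗ LinearMap.rTensor A (Coalgebra.counit (R := k) (A := A)))
  have h1 := congrArg M h
  simp only [map_sum, M, LinearMap.lTensor_tmul, LinearMap.comp_apply,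
    Coalgebra.rTensor_counit_comul, LinearMap.rTensor_tmul, LinearEquiv.coe_coe,
    TensorProduct.lid_tmul, one_smul] at h1
  have h2 : (ρ : A ⊗[k] A) * ((∑ x, Coalgebra.counit (R := k) (e' x) • e x) ⊗ₜ[k] (1 : A)) = (ρ : A ⊗[k] A) := by
    conv_rhs => rw [he, h1]
    rw [he, TensorProduct.sum_tmul, Finset.sum_mul_sum]
    simp [TensorProduct.smul_tmul']
  have h3 : (∑ x, Coalgebra.counit (R := k) (e' x) • e x) ⊗ₜ[k] (1 : A) = 1 := by
    have := congrArg (((ρ⁻¹ : (A ⊗[k] A)ˣ) : A ⊗[k] A) * ·) h2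
    simpa [← mul_assoc] using this
  have h4 := congrArg (fun t => TensorProduct.rid k A (LinearMap.lTensor A (Coalgebra.counit (R := k) (A := A)) t)) h3
  simpa [Algebra.TensorProduct.one_def] using h4

/-- `ρ⁻¹ = (s ⊗ 1) ρ` -/
theorem IsQuasitriangular.inv_eq (hρ : IsQuasitriangular k ρ)
    (he : (ρ : A ⊗[k] A) = ∑ x, e x ⊗ₜ[k] e' x) :
    ((ρ⁻¹ : (A ⊗[k] A)ˣ) : A ⊗[k] A) = ∑ x, antip k (e x) ⊗ₜ[k] e' x := by
  have h := hρ.comul_tensor_id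
  rw [leg13_mul_leg23 he] at h
  let M : A ⊗[k] (A ⊗[k] A) →ₗ[k] A ⊗[k] A :=
    LinearMap.rTensor A (LinearMap.mul' k A) ∘ₗ (TensorProduct.assoc k A A A).symm.toLinearMap ∘ₗ
      LinearMap.rTensor (A ⊗[k] A) (HopfAlgebra.antipode k (A := A))
  have hM : ∀ t : A ⊗[k] A, ∀ c : A, M (TensorProduct.assoc k A A A (t ⊗ₜ c)) =
      (LinearMap.mul' k A (LinearMap.rTensor A (HopfAlgebra.antipode k (A := A)) t)) ⊗ₜ c := by
    intro t c
    induction t using TensorProduct.induction_on with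
    | zero => simp
    | tmul a b => simp [M]
    | add x y hx hy => simp only [TensorProduct.add_tmul, map_add, hx, hy]
  -- Multiplying the first two legs after applying `s` to the first one turns `Δ` into the counit,
  -- and `ρ₁₃ ρ₂₃` into `(s ⊗ 1) ρ` times `ρ`.
  have h1 := congrArg M h
  rw [he] at h1
  simp only [map_sum, LinearMap.rTensor_tmul, hM,
    HopfAlgebra.mul_antipode_rTensor_comul_apply] at h1
  simp only [M, LinearMap.comp_apply, LinearMap.rTensor_tmul, LinearEquiv.coe_coe,
    TensorProduct.assoc_symm_tmul, LinearMap.mul'_apply] at h1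
  have h2 : (∑ x, antip k (e x) ⊗ₜ[k] e' x) * (ρ : A ⊗[k] A) = 1 := by
    rw [he, Finset.sum_mul_sum]
    simp only [Algebra.TensorProduct.tmul_mul_tmul]
    have e1 : (1 : A ⊗[k] A) = (1 : A) ⊗ₜ[k] ∑ x, Coalgebra.counit (R := k) (e x) • e' x := by
      rw [hρ.sum_counit_left he, Algebra.TensorProduct.one_def]
    rw [← h1, e1, TensorProduct.tmul_sum]
    refine Finset.sum_congr rfl fun x _ => ?_
    rw [Algebra.algebraMap_eq_smul_one, TensorProduct.smul_tmul]
  rw [Units.inv_eq_of_mul_eq_one_left h2]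

/-- `(1 ⊗ s) ρ⁻¹ = ρ` -/
theorem IsQuasitriangular.lTensor_inv (hρ : IsQuasitriangular k ρ)
    (he : (ρ : A ⊗[k] A) = ∑ x, e x ⊗ₜ[k] e' x) :
    (HopfAlgebra.antipode k (A := A)).lTensor A ((ρ⁻¹ : (A ⊗[k] A)ˣ) : A ⊗[k] A) =
      (ρ : A ⊗[k] A) := by
  let D : A ⊗[k] A →ₐ[k] A ⊗[k] (A ⊗[k] A) :=
    Algebra.TensorProduct.map (AlgHom.id k A) (Bialgebra.comulAlgHom k A)
  have hD : ∀ t, D t = (Coalgebra.comul (R := k) (A := A)).lTensor A t := by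
    intro t
    induction t using TensorProduct.induction_on with
    | zero => simp
    | tmul a b => simp [D]
    | add x y hx hy => simp only [map_add, hx, hy]
  -- As `1 ⊗ Δ` is an algebra map, the axiom for `ρ` can be inverted. Multiplying the last two legs,
  -- with `s` on the last one, then shows that `(1 ⊗ s) ρ⁻¹` is a right inverse of `ρ⁻¹`.
  have h : D ((ρ⁻¹ : (A ⊗[k] A)ˣ) : A ⊗[k] A) = leg12 k ((ρ⁻¹ : (A ⊗[k] A)ˣ) : A ⊗[k] A) *
      leg13 k ((ρ⁻¹ : (A ⊗[k] A)ˣ) : A ⊗[k] A) := by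
    have h1 : D (ρ : A ⊗[k] A) * D ((ρ⁻¹ : (A ⊗[k] A)ˣ) : A ⊗[k] A) = 1 := by
      rw [← map_mul, Units.mul_inv, map_one]
    have h2 : leg12 k ((ρ⁻¹ : (A ⊗[k] A)ˣ) : A ⊗[k] A) *
        leg13 k ((ρ⁻¹ : (A ⊗[k] A)ˣ) : A ⊗[k] A) * D (ρ : A ⊗[k] A) = 1 := by
      rw [hD, hρ.id_tensor_comul, mul_assoc, ← mul_assoc (leg13 k _) (leg13 k _), ← map_mul,
        Units.inv_mul, map_one, one_mul, ← map_mul, Units.inv_mul, map_one]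
    exact (left_inv_eq_right_inv h2 h1).symm
  have hi := hρ.inv_eq he
  have h3 : leg12 k ((ρ⁻¹ : (A ⊗[k] A)ˣ) : A ⊗[k] A) *
      leg13 k ((ρ⁻¹ : (A ⊗[k] A)ˣ) : A ⊗[k] A) =
      ∑ x, ∑ y, (antip k (e x) * antip k (e y)) ⊗ₜ[k] (e' x ⊗ₜ[k] e' y) := by
    rw [hi, map_sum, map_sum, Finset.sum_mul_sum]
    simp [leg13, leg12]
  rw [hD, h3, hi] at h
  have h4 := congrArg ((LinearMap.mul' k A ∘ₗ
    (HopfAlgebra.antipode k (A := A)).lTensor A).lTensor A) h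
  simp only [map_sum, LinearMap.lTensor_tmul, LinearMap.comp_apply,
    HopfAlgebra.mul_antipode_lTensor_comul_apply, LinearMap.mul'_apply] at h4
  have h5 : ((ρ⁻¹ : (A ⊗[k] A)ˣ) : A ⊗[k] A) * (HopfAlgebra.antipode k (A := A)).lTensor A
      ((ρ⁻¹ : (A ⊗[k] A)ˣ) : A ⊗[k] A) = 1 := by
    rw [hi, map_sum, Finset.sum_mul_sum]
    simp only [LinearMap.lTensor_tmul, Algebra.TensorProduct.tmul_mul_tmul]
    rw [← h4]
    have e1 : (1 : A ⊗[k] A) =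
        (antip k (∑ x, Coalgebra.counit (R := k) (e' x) • e x)) ⊗ₜ[k] (1 : A) := by
      rw [hρ.sum_counit_right he, Algebra.TensorProduct.one_def, antip, HopfAlgebra.antipode_one]
    rw [e1, antip, map_sum, TensorProduct.sum_tmul]
    refine Finset.sum_congr rfl fun x _ => ?_
    rw [Algebra.algebraMap_eq_smul_one, map_smul, TensorProduct.smul_tmul]
  have h6 := congrArg ((ρ : A ⊗[k] A) * ·) h5
  simpa [← mul_assoc] using h6

/-- `(s ⊗ s) ρ = ρ` -/
theorem IsQuasitriangular.antipode_antipode (hρ : IsQuasitriangular k ρ)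
    (he : (ρ : A ⊗[k] A) = ∑ x, e x ⊗ₜ[k] e' x) :
    ∑ x, antip k (e x) ⊗ₜ[k] antip k (e' x) = ∑ x, e x ⊗ₜ[k] e' x := by
  rw [← he, ← hρ.lTensor_inv he, hρ.inv_eq he, map_sum]
  rfl

/-- The Yang--Baxter equation. -/
theorem IsQuasitriangular.yangBaxter (hρ : IsQuasitriangular k ρ) :
    leg12 k (ρ : A ⊗[k] A) * (leg13 k (ρ : A ⊗[k] A) * leg23 k (ρ : A ⊗[k] A)) =
      leg23 k (ρ : A ⊗[k] A) * leg13 k (ρ : A ⊗[k] A) * leg12 k (ρ : A ⊗[k] A) := by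
  -- `S` exchanges the first two legs. The relation `ρ Δ = Δ' ρ` in these legs is applied to `(Δ ⊗
  -- 1) ρ = ρ₁₃ ρ₂₃`.
  let S : A ⊗[k] (A ⊗[k] A) →ₐ[k] A ⊗[k] (A ⊗[k] A) :=
    ((Algebra.TensorProduct.assoc k k k A A A).toAlgHom.comp
      (Algebra.TensorProduct.map (Algebra.TensorProduct.comm k A A).toAlgHom (AlgHom.id k A))).comp
      (Algebra.TensorProduct.assoc k k k A A A).symm.toAlgHom
  have hS : ∀ a b c : A, S (a ⊗ₜ (b ⊗ₜ c)) = b ⊗ₜ (a ⊗ₜ c) := fun a b c => rfl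
  have h1 : ∀ t : A ⊗[k] A, ∀ c : A, leg12 k t * (1 : A) ⊗ₜ[k] ((1 : A) ⊗ₜ[k] c) =
      TensorProduct.assoc k A A A (t ⊗ₜ c) := by
    intro t c
    induction t using TensorProduct.induction_on with
    | zero => simp
    | tmul a b => simp [leg12]
    | add x y hx hy => simp only [TensorProduct.add_tmul, map_add, add_mul, hx, hy]
  have h1' : ∀ t : A ⊗[k] A, ∀ c : A, (1 : A) ⊗ₜ[k] ((1 : A) ⊗ₜ[k] c) * leg12 k t =
      TensorProduct.assoc k A A A (t ⊗ₜ c) := by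
    intro t c
    induction t using TensorProduct.induction_on with
    | zero => simp
    | tmul a b => simp [leg12]
    | add x y hx hy => simp only [TensorProduct.add_tmul, map_add, mul_add, hx, hy]
  have h2 : ∀ t : A ⊗[k] A, ∀ c : A, S (TensorProduct.assoc k A A A (t ⊗ₜ c)) =
      TensorProduct.assoc k A A A (TensorProduct.comm k A A t ⊗ₜ c) := by
    intro t c
    induction t using TensorProduct.induction_on with
    | zero => simp
    | tmul a b => simp [hS]
    | add x y hx hy => simp only [TensorProduct.add_tmul, map_add, hx, hy]
  have h3 : ∀ t : A ⊗[k] A, leg12 k (ρ : A ⊗[k] A) * TensorProduct.assoc k A A A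
      ((Coalgebra.comul (R := k) (A := A)).rTensor A t) =
      S (TensorProduct.assoc k A A A ((Coalgebra.comul (R := k) (A := A)).rTensor A t)) *
        leg12 k (ρ : A ⊗[k] A) := by
    intro t
    induction t using TensorProduct.induction_on with
    | zero => simp
    | tmul a c =>
      rw [LinearMap.rTensor_tmul, h2, ← h1, ← mul_assoc, ← map_mul, hρ.mul_comul, h1, ← h1', map_mul,
        ← mul_assoc, h1']
    | add x y hx hy => simp only [map_add, mul_add, add_mul, hx, hy]
  have h4 : ∀ t : A ⊗[k] A, S (leg13 k t) = leg23 k t := by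
    intro t
    induction t using TensorProduct.induction_on with
    | zero => simp
    | tmul a b => simp [leg13, leg23, hS]
    | add x y hx hy => simp only [map_add, hx, hy]
  have h5 : ∀ t : A ⊗[k] A, S (leg23 k t) = leg13 k t := by
    intro t
    induction t using TensorProduct.induction_on with
    | zero => simp
    | tmul a b => simp [leg13, leg23, hS]
    | add x y hx hy => simp only [map_add, hx, hy]
  rw [← hρ.comul_tensor_id, h3, hρ.comul_tensor_id, map_mul, h4, h5]

/-! #### The Drinfeld element and the bijectivity of the antipode -/

/-- The Drinfeld element `∑ s(e') e`. -/
noncomputable def drinfeld (k : Type*) {A : Type*} [CommRing k] [Ring A] [HopfAlgebra k A]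
    (e e' : ι → A) : A := ∑ x, antip k (e' x) * e x

/-- The map `ω`, sending `a ⊗ b ⊗ c` to `s(b s(c)) u a`, is evaluated at the iterated coproduct of
`x`. In one bracketing `b s(c)` collapses to the counit and `u x` remains; in the other one `ρ Δ =
Δ' ρ` moves `Δ` to the other side of `ρ`, the antipode axiom applies, and `s(s(x)) u` remains. -/
theorem IsQuasitriangular.drinfeld_mul (hρ : IsQuasitriangular k ρ)
    (he : (ρ : A ⊗[k] A) = ∑ x, e x ⊗ₜ[k] e' x) (x : A) :
    drinfeld k e e' * x = antip k (antip k x) * drinfeld k e e' := by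
  have hs : ∀ a b : A, antip k (a * b) = antip k b * antip k a :=
    HopfAlgebra.antipode_mul_antidistrib
  set u := drinfeld k e e' with hu
  let s : A →ₗ[k] A := HopfAlgebra.antipode k
  let m : A →ₗ[k] A →ₗ[k] A := LinearMap.mul k A
  let θ : A → A ⊗[k] A →ₗ[k] A := fun r =>
    TensorProduct.lift (m.flip.compl₂ (LinearMap.mulLeft k (s (s r)) ∘ₗ s))
  have hθ : ∀ r a b, θ r (a ⊗ₜ b) = s (s r) * s b * a := fun r a b => rfl
  let ω : A ⊗[k] (A ⊗[k] A) →ₗ[k] A := TensorProduct.lift (m.flip.compl₂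
    (LinearMap.mulRight k u ∘ₗ s ∘ₗ LinearMap.mul' k A ∘ₗ s.lTensor A))
  have hω : ∀ a t, ω (a ⊗ₜ t) = s (LinearMap.mul' k A (s.lTensor A t)) * u * a := fun a t => rfl
  have h1 : ∀ (r : A) (t : A ⊗[k] A), θ r ((ρ : A ⊗[k] A) * t) =
      ω (TensorProduct.assoc k A A A (t ⊗ₜ r)) := by
    intro r t
    induction t using TensorProduct.induction_on with
    | zero => simp
    | tmul a b =>
      rw [TensorProduct.assoc_tmul, hω, he, Finset.sum_mul, map_sum, LinearMap.lTensor_tmul,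
        LinearMap.mul'_apply]
      simp only [Algebra.TensorProduct.tmul_mul_tmul, hθ]
      rw [hu, drinfeld, Finset.mul_sum, Finset.sum_mul]
      refine Finset.sum_congr rfl fun y _ => ?_
      simp only [s, hs, mul_assoc]
    | add x y hx hy => simp only [TensorProduct.add_tmul, map_add, mul_add, hx, hy]
  have h2 : ∀ (r : A) (t : A ⊗[k] A), θ r (TensorProduct.comm k A A t * (ρ : A ⊗[k] A)) =
      ∑ y, s (s r) * s (e' y) * LinearMap.mul' k A (s.rTensor A t) * e y := by
    intro r t
    induction t using TensorProduct.induction_on with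
    | zero => simp
    | tmul a b =>
      rw [TensorProduct.comm_tmul, he, Finset.mul_sum, map_sum, LinearMap.rTensor_tmul,
        LinearMap.mul'_apply]
      simp only [Algebra.TensorProduct.tmul_mul_tmul, hθ]
      refine Finset.sum_congr rfl fun y _ => ?_
      simp only [s, hs, mul_assoc]
    | add x y hx hy =>
      simp only [map_add, add_mul, mul_add, hx, hy, Finset.sum_add_distrib]
  have h3 : ∀ l r : A, ω (TensorProduct.assoc k A A A (Coalgebra.comul (R := k) l ⊗ₜ r)) =
      s (s (Coalgebra.counit (R := k) l • r)) * u := by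
    intro l r
    rw [← h1, hρ.mul_comul, h2, HopfAlgebra.mul_antipode_rTensor_comul_apply, map_smul, map_smul,
      hu, drinfeld, Finset.mul_sum]
    refine Finset.sum_congr rfl fun y _ => ?_
    rw [Algebra.algebraMap_eq_smul_one]
    simp only [mul_smul_comm, smul_mul_assoc, mul_one, mul_assoc]
    rfl
  have h4 : ∀ t : A ⊗[k] A, ω (TensorProduct.assoc k A A A
      ((Coalgebra.comul (R := k) (A := A)).rTensor A t)) =
      s (s (TensorProduct.lid k A ((Coalgebra.counit (R := k) (A := A)).rTensor A t))) * u := by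
    intro t
    induction t using TensorProduct.induction_on with
    | zero => simp
    | tmul a b => rw [LinearMap.rTensor_tmul, h3, LinearMap.rTensor_tmul, TensorProduct.lid_tmul]
    | add x y hx hy => simp only [map_add, add_mul, hx, hy]
  have h5 : ∀ t : A ⊗[k] A, ω ((Coalgebra.comul (R := k) (A := A)).lTensor A t) =
      u * TensorProduct.rid k A ((Coalgebra.counit (R := k) (A := A)).lTensor A t) := by
    intro t
    induction t using TensorProduct.induction_on with
    | zero => simp
    | tmul a b =>
      rw [LinearMap.lTensor_tmul, hω, HopfAlgebra.mul_antipode_lTensor_comul_apply,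
        LinearMap.lTensor_tmul, TensorProduct.rid_tmul, Algebra.algebraMap_eq_smul_one, map_smul]
      simp only [s, HopfAlgebra.antipode_one, smul_mul_assoc, one_mul, mul_smul_comm]
    | add x y hx hy => simp only [map_add, mul_add, hx, hy]
  have h6 := h4 (Coalgebra.comul (R := k) x)
  rw [Coalgebra.coassoc_apply, h5, Coalgebra.lTensor_counit_comul,
    Coalgebra.rTensor_counit_comul, TensorProduct.rid_tmul, TensorProduct.lid_tmul, one_smul]
    at h6
  exact h6

/-- Apply the map sending `a ⊗ b` to `s(b) a` to `ρ ρ⁻¹ = 1`, which gives `∑ s(e') u s(e) = 1`, and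
remove both antipodes by `(s ⊗ s) ρ = ρ`. -/
theorem IsQuasitriangular.drinfeld_mul_inv (hρ : IsQuasitriangular k ρ)
    (he : (ρ : A ⊗[k] A) = ∑ x, e x ⊗ₜ[k] e' x) :
    ∑ x, e' x * drinfeld k e e' * e x = 1 := by
  have h1 : (ρ : A ⊗[k] A) * ∑ x, antip k (e x) ⊗ₜ[k] e' x = 1 := by
    rw [← hρ.inv_eq he, Units.mul_inv]
  have h2 := congrArg (TensorProduct.lift ((LinearMap.mul k A).flip.compl₂
    (HopfAlgebra.antipode k (A := A)))) h1
  rw [he, Finset.sum_mul_sum] at h2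
  simp only [map_sum, Algebra.TensorProduct.tmul_mul_tmul, Algebra.TensorProduct.one_def,
    TensorProduct.lift.tmul, LinearMap.compl₂_apply, LinearMap.flip_apply, LinearMap.mul_apply',
    HopfAlgebra.antipode_one, one_mul, HopfAlgebra.antipode_mul_antidistrib] at h2
  have h3 := congrArg (TensorProduct.lift ((LinearMap.mul k A).flip.compl₂
    (LinearMap.mulRight k (drinfeld k e e')))) (hρ.antipode_antipode he)
  simp only [map_sum, TensorProduct.lift.tmul, LinearMap.compl₂_apply, LinearMap.flip_apply,
    LinearMap.mul_apply', LinearMap.mulRight_apply] at h3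
  rw [← h3, ← h2, Finset.sum_comm]
  refine Finset.sum_congr rfl fun x _ => ?_
  rw [drinfeld, Finset.mul_sum, Finset.sum_mul]
  refine Finset.sum_congr rfl fun y _ => ?_
  simp only [mul_assoc]

/-- The inverse of the Drinfeld element `u` is `∑ e' s(s(e))`. One product reduces to `∑ e' u e` by
commuting `u` past `e`, the other by commuting it past `e'` and using `(s ⊗ s) ρ = ρ` twice. Thus
the square of `s` is conjugation by `u`. -/
theorem IsQuasitriangular.bijective_antipode (hρ : IsQuasitriangular k ρ)
    (he : (ρ : A ⊗[k] A) = ∑ x, e x ⊗ₜ[k] e' x) : Function.Bijective (antip k (A := A)) := by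
  set u := drinfeld k e e' with hu
  set v := ∑ x, e' x * antip k (antip k (e x)) with hv
  have hvu : v * u = 1 := by
    rw [hv, Finset.sum_mul, ← hρ.drinfeld_mul_inv he]
    exact Finset.sum_congr rfl fun x _ => by
      rw [mul_assoc, ← hρ.drinfeld_mul he, mul_assoc]
  have huv : u * v = 1 := by
    have h3 := congrArg (TensorProduct.lift ((LinearMap.mul k A).flip.compl₂
      (LinearMap.mulRight k u))) (hρ.antipode_antipode he)
    have h4 := congrArg (TensorProduct.lift ((LinearMap.mul k A).flip.compl₁₂
      (HopfAlgebra.antipode k (A := A))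
      (LinearMap.mulRight k u ∘ₗ (HopfAlgebra.antipode k (A := A))))) (hρ.antipode_antipode he)
    simp only [map_sum, TensorProduct.lift.tmul, LinearMap.compl₂_apply, LinearMap.flip_apply,
      LinearMap.mul_apply', LinearMap.mulRight_apply, LinearMap.compl₁₂_apply,
      LinearMap.comp_apply] at h3 h4
    rw [← hρ.drinfeld_mul_inv he, ← h3, ← h4, hv, Finset.mul_sum]
    exact Finset.sum_congr rfl fun x _ => by
      rw [← mul_assoc, hρ.drinfeld_mul he]
  have hsq : ∀ x : A, antip k (antip k x) = u * x * v := fun x => by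
    rw [hρ.drinfeld_mul he, mul_assoc, huv, mul_one]
  have hb : Function.Bijective (fun x : A => antip k (antip k x)) := by
    refine Function.bijective_iff_has_inverse.2 ⟨fun x => v * x * u, fun x => ?_, fun x => ?_⟩
    · simp only [hsq]
      rw [mul_assoc, mul_assoc, mul_assoc, hvu, mul_one, ← mul_assoc, hvu, one_mul]
    · simp only [hsq]
      rw [← mul_assoc, ← mul_assoc, huv, one_mul, mul_assoc, huv, mul_one]
  refine ⟨fun x y h => hb.1 ?_, fun y => ?_⟩
  · simp only [h]
  · obtain ⟨x, hx⟩ := hb.2 y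
    exact ⟨_, hx⟩

end QuasitriangularHopf

/-! ### The functor `F` -/

section Functor

variable {k A ι M : Type*} [CommRing k] [Ring A] [HopfAlgebra k A] [Fintype ι] [AddCommGroup M]
  {m : ℕ}

theorem Word.exchange_shift {x : Word k A m} {i : ℕ} (g : CatGen A)
    {v : List (Layer (CatGen A))} (hi : i + inn g ≤ x.wd) (hv : Fits (x.wd - (i + inn g)) v) :
    x.app ((i, g) :: v.map fun l => (i + out g + l.1, l.2)) =
      x.app ((v.map fun l => (i + inn g + l.1, l.2)) ++ [(i, g)]) := by
  induction v generalizing x with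
  | nil => rfl
  | cons l v ih =>
    obtain ⟨j, h⟩ := l
    obtain ⟨h1, h2⟩ := hv
    have h3 : (x.app [(i + inn g + j, h)]).wd = x.wd - inn h + out h := Word.wd_app x _
    have h4 := ih (x := x.app [(i + inn g + j, h)]) (by omega) (by
      rw [h3, show x.wd - inn h + out h - (i + inn g) = x.wd - (i + inn g) - inn h + out h by omega]
      exact h2)
    have h5 := Word.exchange_app (x := x) (i := i) (j := i + out g + j) (j' := i + inn g + j) g h
      (by omega) (by omega) (by omega)
    rw [Word.app_app] at h4
    simp only [List.map_cons, List.cons_append]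
    refine Eq.trans ?_ (h4.trans (Word.app_app _ _ _))
    simpa [Word.app_app] using congrArg (·.app (v.map fun l => (i + out g + l.1, l.2))) h5

theorem fits_shift {G : Type*} [Signature G] (c n : ℕ) {v : List (Layer G)} (hv : Fits n v) :
    Fits (c + n) (v.map fun l => (c + l.1, l.2)) := by
  induction v generalizing n with
  | nil => trivial
  | cons l v ih =>
    obtain ⟨j, g⟩ := l
    obtain ⟨h1, h2⟩ := hv
    have h3 := ih _ h2
    rw [show c + (n - inn g + out g) = c + n - inn g + out g by omega] at h3
    exact ⟨by show c + j + inn g ≤ c + n; omega, h3⟩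

theorem Fits.mono {G : Type*} [Signature G] {n n' : ℕ} {v : List (Layer G)} (hv : Fits n v)
    (h : n ≤ n') : Fits n' v := by
  induction v generalizing n n' with
  | nil => trivial
  | cons l v ih => exact ⟨hv.1.trans h, ih hv.2 (by omega)⟩

/-- A crossing of a tangle resolves into three layers, so the exchange of two tangle pieces is an
exchange of blocks. -/
theorem Word.exchange_blocks {x : Word k A m} {i p : ℕ} {u v : List (Layer (CatGen A))}
    (hi : i + p ≤ x.wd) (hu : Fits p u) (hv : Fits (x.wd - (i + p)) v) :
    x.app ((u.map fun l => (i + l.1, l.2)) ++ v.map fun l => (i + wout p u + l.1, l.2)) =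
      x.app ((v.map fun l => (i + p + l.1, l.2)) ++ u.map fun l => (i + l.1, l.2)) := by
  induction u generalizing x p with
  | nil => simp [wout]
  | cons l u ih =>
    obtain ⟨j, g⟩ := l
    obtain ⟨h1, h2⟩ := hu
    have h3 : (x.app [(i + j, g)]).wd = x.wd - inn g + out g := Word.wd_app x _
    have h4 := ih (x := x.app [(i + j, g)]) (p := p - inn g + out g) (by omega) h2 (by
      rwa [h3, show x.wd - inn g + out g - (i + (p - inn g + out g)) = x.wd - (i + p) by omega])
    have h5 := Word.exchange_shift (x := x) (i := i + j) g
      (v := v.map fun l => (p - j - inn g + l.1, l.2)) (by omega) (by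
        have := fits_shift (p - j - inn g) _ hv
        rwa [show p - j - inn g + (x.wd - (i + p)) = x.wd - (i + j + inn g) by omega] at this)
    simp only [List.map_map, Function.comp_def] at h5
    have h6 : ∀ a : ℕ, i + j + out g + (p - j - inn g + a) = i + (p - inn g + out g) + a := by
      omega
    have h7 : ∀ a : ℕ, i + j + inn g + (p - j - inn g + a) = i + p + a := by omega
    simp only [h6, h7] at h5
    have h8 := h4.trans (by
      simpa [Word.app_app] using congrArg (·.app (u.map fun l => (i + l.1, l.2))) h5)
    rw [Word.app_app] at h8
    exact h8

theorem Word.bead_mul_right_left {x : Word k A m} {i : ℕ} (hi : i + 2 ≤ x.wd) (a b c d : A) :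
    (((x.bead i a).bead (i + 1) b).bead i c).bead (i + 1) d =
      (x.bead i (a * c)).bead (i + 1) (b * d) := by
  rw [← Word.bead_bead_comm (j := i + 1) (i := i) (x := x.bead i a) (by omega) (by simp; omega),
    Word.bead_mul (x := x) (by omega), Word.bead_mul (by simp; omega)]

/-- All beads are collected above the three flat crossings, where the two sides of the third
Reidemeister move carry the two sides of the Yang-Baxter equation. -/
theorem Word.braid_slide_left {x : Word k A m} {i : ℕ} (hi : i + 3 ≤ x.wd) (a a' b b' c c' : A) :
    ((((((((x.P i).bead i a).bead (i + 1) a').P (i + 1)).bead (i + 1) b).bead (i + 1 + 1) b').P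
      i).bead i c).bead (i + 1) c' = (((((x.P i).P (i + 1)).P i).bead i (b * c)).bead (i + 1)
        (a * c')).bead (i + 2) (a' * b') := by
  rw [Word.bead_P_self (by simp; omega), Word.bead_P (i := i) (by omega) (by simp; omega),
    ← Word.bead_bead_comm (j := i + 1 + 1) (i := i + 1) (by omega) (by simp; omega),
    Word.bead_mul (by simp; omega), ← Word.P_bead (by omega) (by simp; omega),
    Word.bead_bead_P (by simp; omega),
    ← Word.bead_bead_comm (j := i + 1 + 1) (i := i) (by omega) (by simp; omega),
    ← Word.bead_bead_comm (j := i + 1 + 1) (i := i + 1) (by omega) (by simp; omega),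
    Word.bead_mul_right_left (by simp; omega)]

theorem Word.braid_slide_right {x : Word k A m} {i : ℕ} (hi : i + 3 ≤ x.wd) (a a' b b' c c' : A) :
    ((((((((x.P (i + 1)).bead (i + 1) a).bead (i + 1 + 1) a').P i).bead i b).bead (i + 1) b').P
      (i + 1)).bead (i + 1) c).bead (i + 1 + 1) c' =
      (((((x.P i).P (i + 1)).P i).bead i (a * b)).bead (i + 1) (a' * c)).bead (i + 2)
        (b' * c') := by
  rw [← Word.P_bead (i := i) (by omega) (by simp; omega), Word.bead_succ_P (by simp; omega),
    ← Word.bead_bead_comm (j := i + 1 + 1) (i := i) (by omega) (by simp; omega),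
    Word.bead_mul (by simp; omega),
    ← Word.bead_bead_comm (j := i + 1 + 1) (i := i + 1) (by omega) (by simp; omega),
    Word.bead_bead_P (by simp; omega), Word.bead_P (i := i) (by omega) (by simp; omega),
    Word.bead_mul_right_left (by simp; omega), ← Word.braid hi]

/-- The sum of the values of `Λ` at all resolutions of a tangle diagram on top of `X`. -/
noncomputable def resolutionSum (e e' : ι → A) (Λ : Word k A m → M) (X : Word k A m)
    (w : List (Layer TangGen)) : M :=
  ((resolutions k e e' w).map fun v => Λ (X.app v)).sum

variable {e e' : ι → A} {Λ : Word k A m → M} {X : Word k A m}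

theorem resolutionSum_nil : resolutionSum e e' Λ X [] = Λ X := by
  simp [resolutionSum, resolutions, Word.app_nil]

theorem resolutionSum_cup (i : ℕ) (w : List (Layer TangGen)) :
    resolutionSum e e' Λ X ((i, .cup) :: w) = resolutionSum e e' Λ (X.cup i) w := by
  simp only [resolutionSum, resolutions, Multiset.map_map, Function.comp_def, Word.cup,
    Word.app_app]
  rfl

theorem resolutionSum_cap (i : ℕ) (w : List (Layer TangGen)) :
    resolutionSum e e' Λ X ((i, .cap) :: w) = resolutionSum e e' Λ (X.cap i) w := by
  simp only [resolutionSum, resolutions, Multiset.map_map, Function.comp_def, Word.cap,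
    Word.app_app]
  rfl

theorem resolutionSum_R (i : ℕ) (w : List (Layer TangGen)) :
    resolutionSum e e' Λ X ((i, .R) :: w) =
      ∑ x, resolutionSum e e' Λ (((X.P i).bead i (e x)).bead (i + 1) (e' x)) w := by
  simp only [resolutionSum, resolutions, Multiset.map_map, Multiset.map_bind, Multiset.sum_bind,
    Function.comp_def, Word.P, Word.bead, Word.app_app]
  rfl

theorem resolutionSum_L (i : ℕ) (w : List (Layer TangGen)) :
    resolutionSum e e' Λ X ((i, .L) :: w) =
      ∑ x, resolutionSum e e' Λ (((X.bead i (antip k (e x))).bead (i + 1) (e' x)).P i) w := by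
  simp only [resolutionSum, resolutions, Multiset.map_map, Multiset.map_bind, Multiset.sum_bind,
    Function.comp_def, Word.P, Word.bead, Word.app_app]
  rfl

/-- Everything above a move is absorbed into the functional; `BeadLinear.resolutionSum` shows that
linearity in the beads is kept. -/
theorem resolutionSum_append (u v : List (Layer TangGen)) (X : Word k A m) :
    resolutionSum e e' Λ X (u ++ v) =
      resolutionSum e e' (fun Y => resolutionSum e e' Λ Y v) X u := by
  induction u generalizing X with
  | nil => rw [resolutionSum_nil]; rfl
  | cons l u ih =>
    obtain ⟨i, g⟩ := l
    cases g <;> simp only [List.cons_append, resolutionSum_cup, resolutionSum_cap, resolutionSum_R,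
      resolutionSum_L, ih]

theorem resolutions_singleton_shift (e e' : ι → A) (i : ℕ) (g : TangGen) :
    resolutions k e e' [(i, g)] =
      (resolutions k e e' [(0, g)]).map (List.map fun l => (i + l.1, l.2)) := by
  cases g <;> simp [resolutions, Multiset.map_bind, Nat.add_comm]

theorem resolutions_singleton_fits (e e' : ι → A) {g : TangGen} {v : List (Layer (CatGen A))}
    (hv : v ∈ resolutions k e e' [(0, g)]) : Fits (inn g) v ∧ wout (inn g) v = out g := by
  cases g <;> simp [resolutions] at hv
  · subst hv; simp [Fits, wout, inn, out]
  · subst hv; simp [Fits, wout, inn, out]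
  · obtain ⟨x, rfl⟩ := hv; simp [Fits, wout, inn, out]
  · obtain ⟨x, rfl⟩ := hv; simp [Fits, wout, inn, out]

/-- The resolutions of the two pieces are independent: the order of summation is interchanged and
the blocks are exchanged term by term. -/
theorem resolutionSum_exchange {i j : ℕ} {g h : TangGen}
    (hx : i + inn g + j + inn h ≤ X.wd) :
    resolutionSum e e' Λ X [(i, g), (i + out g + j, h)] =
      resolutionSum e e' Λ X [(i + inn g + j, h), (i, g)] := by
  rw [← List.singleton_append, resolutionSum_append,
    ← List.singleton_append (l := [(i, g)]), resolutionSum_append]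
  unfold resolutionSum
  rw [Multiset.sum_map_sum_map]
  rw [resolutions_singleton_shift e e' i, resolutions_singleton_shift e e' (i + out g + j),
    resolutions_singleton_shift e e' (i + inn g + j)]
  simp only [Multiset.map_map, Function.comp_def]
  refine congrArg _ (Multiset.map_congr rfl fun v hv => congrArg _
    (Multiset.map_congr rfl fun u hu => congrArg Λ ?_))
  obtain ⟨hu1, hu2⟩ := resolutions_singleton_fits e e' hu
  obtain ⟨hv1, hv2⟩ := resolutions_singleton_fits e e' hv
  have h1 := Word.exchange_blocks (x := X) (i := i) (p := inn g) (u := u)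
    (v := v.map fun l => (j + l.1, l.2)) (by omega) hu1
    ((fits_shift j _ hv1).mono (by omega))
  simp only [List.map_map, Function.comp_def, hu2, ← Nat.add_assoc] at h1
  rw [Word.app_app, Word.app_app]
  exact h1

variable [Module k M]

/-- A function on words that is linear in every bead. -/
def BeadLinear (Λ : Word k A m → M) : Prop :=
  ∀ (X : Word k A m) (i : ℕ) (w : List (Layer (CatGen A))), i < X.wd →
    IsLinearMap k fun a => Λ ((X.bead i a).app w)

/-- This is how identities in `A ⊗ A`, which need not hold term by term, are applied to sums over
resolutions. -/
theorem BeadLinear.exists_bilinear {Λ : Word k A m → M} (hΛ : BeadLinear Λ) {X : Word k A m}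
    {i j : ℕ} (hi : i < X.wd) (hj : j < X.wd) (w : List (Layer (CatGen A))) :
    ∃ β : A ⊗[k] A →ₗ[k] M, ∀ a b, β (a ⊗ₜ b) = Λ (((X.bead i a).bead j b).app w) := by
  have h1 : ∀ b, IsLinearMap k fun a => Λ (((X.bead i a).bead j b).app w) := fun b => by
    have := hΛ X i ([(j, .bead b)] ++ w) hi
    simpa only [Word.bead, Word.app_app, List.append_assoc] using this
  have h2 : ∀ a, IsLinearMap k fun b => Λ (((X.bead i a).bead j b).app w) := fun a =>
    hΛ _ j w (by simp; omega)
  exact ⟨TensorProduct.lift (LinearMap.mk₂ k (fun a b => Λ (((X.bead i a).bead j b).app w))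
    (fun a a' b => (h1 b).map_add a a') (fun c a b => (h1 b).map_smul c a)
    (fun a b b' => (h2 a).map_add b b') (fun c a b => (h2 a).map_smul c b)), fun a b => rfl⟩

theorem BeadLinear.exists_trilinear {Λ : Word k A m → M} (hΛ : BeadLinear Λ) {X : Word k A m}
    {i j l : ℕ} (hi : i < X.wd) (hj : j < X.wd) (hl : l < X.wd) :
    ∃ β : A ⊗[k] (A ⊗[k] A) →ₗ[k] M, ∀ a b c, β (a ⊗ₜ (b ⊗ₜ c)) =
      Λ (((X.bead i a).bead j b).bead l c) := by
  have h : ∀ a, ∃ β : A ⊗[k] A →ₗ[k] M, ∀ b c,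
      β (b ⊗ₜ c) = Λ (((X.bead i a).bead j b).bead l c) := fun a => by
    obtain ⟨β, hβ⟩ := hΛ.exists_bilinear (X := X.bead i a) (i := j) (j := l) (by simp; omega)
      (by simp; omega) []
    exact ⟨β, fun b c => by rw [hβ, Word.app_nil]⟩
  choose β hβ using h
  have h1 : ∀ b c, IsLinearMap k fun a => Λ (((X.bead i a).bead j b).bead l c) := fun b c => by
    have := hΛ X i ([(j, .bead b)] ++ [(l, .bead c)]) hi
    simpa only [Word.bead, Word.app_app, List.append_assoc] using this
  refine ⟨TensorProduct.lift
    { toFun := β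
      map_add' := fun a a' => TensorProduct.ext' fun b c => ?_
      map_smul' := fun r a => TensorProduct.ext' fun b c => ?_ }, fun a b c => ?_⟩
  · rw [LinearMap.add_apply, hβ, hβ, hβ]; exact (h1 b c).map_add a a'
  · rw [RingHom.id_apply, LinearMap.smul_apply, hβ, hβ]; exact (h1 b c).map_smul r a
  · exact hβ a b c

theorem BeadLinear.resolutionSum (hΛ : BeadLinear Λ) (e e' : ι → A) (w : List (Layer TangGen)) :
    BeadLinear fun X => resolutionSum e e' Λ X w := by
  intro X i v hi
  simp only [KnotOnString.resolutionSum, Word.app_app]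
  have h : ∀ u, IsLinearMap k fun a => Λ ((X.bead i a).app (v ++ u)) := fun u => hΛ X i _ hi
  constructor
  · intro a b
    rw [← Multiset.sum_map_add]
    exact congrArg _ (Multiset.map_congr rfl fun u _ => (h u).map_add a b)
  · intro c a
    rw [Multiset.smul_sum, Multiset.map_map]
    exact congrArg _ (Multiset.map_congr rfl fun u _ => (h u).map_smul c a)

/-- The regular isotopy moves do not change the sums over all resolutions. -/
theorem TangMove.resolutionSum_eq {ρ : (A ⊗[k] A)ˣ} (hρ : IsQuasitriangular k ρ)
    (he : (ρ : A ⊗[k] A) = ∑ x, e x ⊗ₜ[k] e' x) (hΛ : BeadLinear Λ)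
    {x y : List (Layer TangGen)} (h : TangMove x y) (hx : Fits X.wd x) :
    resolutionSum e e' Λ X x = resolutionSum e e' Λ X y := by
  have hi := hρ.inv_eq he
  cases h with
  | exchange i j g h =>
    refine resolutionSum_exchange ?_
    have h1 := hx.1
    have h2 := hx.2.1
    omega
  | zigzag_left i =>
    have h0 : i < X.wd := by simp [Fits, inn, out] at hx; omega
    rw [resolutionSum_cup, resolutionSum_cap, Word.zigzag_left h0]
  | zigzag_right i =>
    have h0 : i < X.wd := by simp [Fits, inn, out] at hx; omega
    rw [resolutionSum_cup, resolutionSum_cap, Word.zigzag_right h0]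
  | RL i =>
    have h0 : i + 2 ≤ X.wd := by simp [Fits, inn, out] at hx; omega
    obtain ⟨β, hβ⟩ := hΛ.exists_bilinear (X := X.P i) (i := i) (j := i + 1) (by simp; omega)
      (by simp; omega) [(i, .P)]
    -- The beads of `R` and `L` lie between the two flat crossings and multiply to `ρ ρ⁻¹`.
    have h1 : β ((ρ : A ⊗[k] A) * ((ρ⁻¹ : (A ⊗[k] A)ˣ) : A ⊗[k] A)) = Λ X := by
      rw [Units.mul_inv, Algebra.TensorProduct.one_def, hβ, Word.bead_one (by simp; omega),
        Word.bead_one (by simp; omega)]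
      exact congrArg Λ (Word.P_P h0)
    rw [hi, he, Finset.sum_mul_sum, map_sum] at h1
    simp only [resolutionSum_R, resolutionSum_L, resolutionSum_nil]
    rw [← h1]
    refine Finset.sum_congr rfl fun x _ => ?_
    rw [map_sum]
    refine Finset.sum_congr rfl fun y _ => ?_
    rw [Algebra.TensorProduct.tmul_mul_tmul, hβ]
    refine congrArg Λ ?_
    rw [Word.bead_mul_right_left (by simp; omega)]
    rfl
  | LR i =>
    have h0 : i + 2 ≤ X.wd := by simp [Fits, inn, out] at hx; omega
    obtain ⟨β, hβ⟩ := hΛ.exists_bilinear (X := X) (i := i) (j := i + 1) (by omega)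
      (by omega) []
    have h1 : β (((ρ⁻¹ : (A ⊗[k] A)ˣ) : A ⊗[k] A) * (ρ : A ⊗[k] A)) = Λ X := by
      rw [Units.inv_mul, Algebra.TensorProduct.one_def, hβ, Word.bead_one (by simp; omega),
        Word.bead_one (by omega), Word.app_nil]
    rw [hi, he, Finset.sum_mul_sum, map_sum] at h1
    simp only [resolutionSum_R, resolutionSum_L, resolutionSum_nil]
    rw [← h1]
    refine Finset.sum_congr rfl fun x _ => ?_
    rw [map_sum]
    refine Finset.sum_congr rfl fun y _ => ?_
    rw [Algebra.TensorProduct.tmul_mul_tmul, hβ, Word.app_nil, Word.P_P (by simp; omega),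
      Word.bead_mul_right_left h0]
  | braid i =>
    have h0 : i + 3 ≤ X.wd := by simp [Fits, inn, out] at hx; omega
    obtain ⟨β, hβ⟩ := hΛ.exists_trilinear (X := ((X.P i).P (i + 1)).P i) (i := i) (j := i + 1)
      (l := i + 2) (by simp; omega) (by simp; omega) (by simp; omega)
    have hl : leg23 k (ρ : A ⊗[k] A) * leg13 k (ρ : A ⊗[k] A) * leg12 k (ρ : A ⊗[k] A) =
        ∑ x, ∑ y, ∑ z, (e y * e z) ⊗ₜ[k] ((e x * e' z) ⊗ₜ[k] (e' x * e' y)) := by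
      rw [he]
      simp only [leg12, leg13, leg23, map_sum, Algebra.TensorProduct.map_tmul,
        Algebra.TensorProduct.includeLeft_apply, Algebra.TensorProduct.includeRight_apply,
        AlgHom.id_apply]
      rw [Finset.sum_mul_sum, Finset.sum_mul]
      simp only [Finset.sum_mul_sum, Algebra.TensorProduct.tmul_mul_tmul, one_mul, mul_one]
    have hr : leg12 k (ρ : A ⊗[k] A) * (leg13 k (ρ : A ⊗[k] A) * leg23 k (ρ : A ⊗[k] A)) =
        ∑ x, ∑ y, ∑ z, (e x * e y) ⊗ₜ[k] ((e' x * e z) ⊗ₜ[k] (e' y * e' z)) := by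
      rw [he, ← mul_assoc]
      simp only [leg12, leg13, leg23, map_sum, Algebra.TensorProduct.map_tmul,
        Algebra.TensorProduct.includeLeft_apply, Algebra.TensorProduct.includeRight_apply,
        AlgHom.id_apply]
      rw [Finset.sum_mul_sum, Finset.sum_mul]
      simp only [Finset.sum_mul_sum, Algebra.TensorProduct.tmul_mul_tmul, one_mul, mul_one]
    have h1 := congrArg β hρ.yangBaxter.symm
    rw [hl, hr] at h1
    simp only [map_sum, hβ] at h1
    simp only [resolutionSum_R, resolutionSum_nil]
    simpa only [Word.braid_slide_left h0, Word.braid_slide_right h0] using h1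
  | cap_over i =>
    have h0 : i + 3 ≤ X.wd := by simp [Fits, inn, out] at hx; omega
    -- Sliding `e'` over the maximum leaves antipodes on both factors on the side of `L`, so `(s ⊗
    -- s) ρ = ρ` is needed.
    obtain ⟨β, hβ⟩ := hΛ.exists_bilinear (X := X) (i := i + 1) (j := i) (by omega) (by omega)
      [(i + 1, .P), (i, .cap)]
    have h1 := congrArg β (hρ.antipode_antipode he)
    simp only [map_sum, hβ] at h1
    simp only [resolutionSum_R, resolutionSum_L, resolutionSum_cap, resolutionSum_nil]
    refine Eq.trans (Finset.sum_congr rfl fun x _ => congrArg Λ ?_) (h1.symm.trans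
      (Finset.sum_congr rfl fun x _ => congrArg Λ ?_))
    · rw [← Word.bead_bead_P (by omega), Word.cap_switchback (by simp; omega),
        Word.bead_bead_comm (by omega) (by omega)]
      simp [Word.cap, Word.P, Word.app_app]
    · rw [Word.bead_succ_P (i := i + 1) (by simp; omega), Word.cap_bead (by simp; omega),
        ← Word.bead_P (i := i) (by omega) (by simp; omega)]
      simp [Word.cap, Word.P, Word.app_app]
  | cap_under i =>
    have h0 : i + 3 ≤ X.wd := by simp [Fits, inn, out] at hx; omega
    simp only [resolutionSum_R, resolutionSum_L, resolutionSum_cap, resolutionSum_nil]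
    -- Here `e` slides over the maximum and acquires exactly the antipode that `L` puts on it; the
    -- terms agree one by one.
    refine Finset.sum_congr rfl fun x _ => congrArg Λ ?_
    rw [Word.cap_switchback (by simp; omega),
      Word.bead_bead_comm (j := i + 1 + 1) (i := i + 1) (by omega) (by simp; omega),
      Word.cap_bead (by simp; omega),
      ← Word.bead_bead_comm (j := i + 1 + 1) (i := i) (by omega) (by simp; omega),
      ← Word.bead_P (by omega) (by omega), ← Word.bead_P_self (by simp; omega)]
  | cup_over i =>
    have h0 : i < X.wd := by simp [Fits, inn, out] at hx; omega
    obtain ⟨β, hβ⟩ := hΛ.exists_bilinear (X := (X.cup i).P (i + 1)) (i := i + 1) (j := i + 1 + 1)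
      (by simp; omega) (by simp; omega) []
    have h1 := congrArg β (hρ.antipode_antipode he)
    simp only [map_sum, hβ, Word.app_nil] at h1
    simp only [resolutionSum_R, resolutionSum_L, resolutionSum_cup, resolutionSum_nil]
    refine Eq.trans (Finset.sum_congr rfl fun x _ => congrArg Λ ?_) h1
    rw [Word.bead_bead_P (by simp; omega), Word.cup_switchback h0,
      ← Word.bead_P (i := i) (by omega) (by simp; omega), Word.cup_bead (by omega),
      Word.bead_P_self (by simp; omega),
      Word.bead_bead_comm (i := i + 1) (by omega) (by simp; omega)]
  | cup_under i =>
    have h0 : i < X.wd := by simp [Fits, inn, out] at hx; omega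
    simp only [resolutionSum_R, resolutionSum_L, resolutionSum_cup, resolutionSum_nil]
    refine Finset.sum_congr rfl fun x _ => congrArg Λ ?_
    rw [Word.cup_switchback h0, ← Word.cup_bead (by omega), Word.bead_succ_P (by simp; omega),
      Word.bead_P (i := i) (by omega) (by simp; omega)]

end Functor

/-! ### From words and resolutions to morphisms of `Cat(A)` -/

section ToHom

variable {k A ι : Type*} [CommRing k] [Ring A] [HopfAlgebra k A] [Fintype ι]

open Classical in
/-- The morphism of `Cat(A)` given by a list of layers, or zero if it is not a diagram with `m`
bottom ends and `n` top ends. -/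
noncomputable def layersHom (k : Type*) {A : Type*} [CommRing k] [Ring A] [HopfAlgebra k A]
    (m n : ℕ) (w : List (Layer (CatGen A))) : CatHom k A m n :=
  if h : Fits m w ∧ wout m w = n then
    CatHom.of k (Diagram.exists_layers w m n h.1 h.2).choose
  else 0

theorem layersHom_layers {m n : ℕ} (D : BeadDiagram A m n) :
    layersHom k m n D.layers = CatHom.of k D := by
  rw [layersHom, dif_pos D.fits_layers]
  exact congrArg _ (Diagram.layers_injective _ _
    (Diagram.exists_layers D.layers m n D.fits_layers.1 D.fits_layers.2).choose_spec)

/-- The morphism of `Cat(A)` given by a word. -/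
noncomputable def Word.toHom (m n : ℕ) : Word k A m → CatHom k A m n :=
  Quot.lift (layersHom k m n) fun x y h => by
    by_cases hx : Fits m x ∧ wout m x = n
    · have hy : Fits m y ∧ wout m y = n := by rwa [← h.fits_iff, ← h.wout_eq]
      obtain ⟨D, rfl⟩ := Diagram.exists_layers x m n hx.1 hx.2
      obtain ⟨E, rfl⟩ := Diagram.exists_layers y m n hy.1 hy.2
      obtain ⟨u, v, a, b, hm, -, h1, h2⟩ := h
      rw [layersHom_layers, layersHom_layers]
      exact CatHom.rel k (.move _ _ ⟨u, v, a, b, hm, h1, h2⟩)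
    · have hy : ¬ (Fits m y ∧ wout m y = n) := by rwa [← h.fits_iff, ← h.wout_eq]
      rw [layersHom, layersHom, dif_neg hx, dif_neg hy]

theorem Word.toHom_layers {m n : ℕ} (D : BeadDiagram A m n) :
    Word.toHom m n (Word.mk k m D.layers) = CatHom.of k D :=
  layersHom_layers D

theorem beadLinear_toHom (m n : ℕ) : BeadLinear (Word.toHom (k := k) (A := A) m n) := by
  intro X i w hi
  induction X using Quot.ind with
  | mk u =>
    show IsLinearMap k fun a => layersHom k m n (u ++ [(i, .bead a)] ++ w)
    by_cases h : Fits m (u ++ [(i, CatGen.bead (0 : A))] ++ w) ∧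
      wout m (u ++ [(i, CatGen.bead (0 : A))] ++ w) = n
    · have hD : ∀ a : A, ∃ D : BeadDiagram A m n, D.layers = u ++ [(i, .bead a)] ++ w := fun a =>
        Diagram.exists_layers _ m n ((fits_bead_congr a).1 h).1 ((fits_bead_congr a).1 h).2
      choose D hD using hD
      simp only [← hD, layersHom_layers]
      constructor
      · intro a b
        have := CatHom.rel k (CatRel.add (k := k) (D (a + b)) (D a) (D b) u w i a b (hD _) (hD _)
          (hD _))
        rwa [map_add] at this
      · intro c a
        have := CatHom.rel k (CatRel.smul (k := k) (D (c • a)) (D a) u w i c a (hD _) (hD _))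
        rwa [map_smul] at this
    · have h0 : ∀ a : A, layersHom k m n (u ++ [(i, .bead a)] ++ w) = 0 := fun a => by
        rw [layersHom, dif_neg fun ha => h ((fits_bead_congr 0).1 ha)]
      simp only [h0]
      exact ⟨fun _ _ => (add_zero _).symm, fun _ _ => (smul_zero _).symm⟩

theorem CatHom.comp_sum {m n p : ℕ} (f : CatHom k A m n) (g : ι → CatHom k A n p) :
    CatHom.comp k f (∑ x, g x) = ∑ x, CatHom.comp k f (g x) :=
  map_sum (CatHom.compₗ k m n p f) g _

theorem CatHom.sum_comp {m n p : ℕ} (f : ι → CatHom k A m n) (g : CatHom k A n p) :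
    CatHom.comp k (∑ x, f x) g = ∑ x, CatHom.comp k (f x) g :=
  map_sum ((CatHom.compₗ k m n p).flip g) f _

theorem CatHom.tensorBead_sum {m : ℕ} (i j : ℕ) (hm : m = i + 2 + j) (f f' : ι → A) :
    CatHom.tensorBead k i j hm (∑ x, f x ⊗ₜ[k] f' x) =
      ∑ x, CatHom.of k (.cons (m' := m) i (1 + j) (.bead (f x)) (by simp; omega) (by simp; omega)
        (.cons (m' := m) (i + 1) j (.bead (f' x)) (by simp; omega) (by simp; omega) (.nil m))) := by
  rw [map_sum]
  exact Finset.sum_congr rfl fun x _ => CatHom.of_comp_of k _ _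

/-- The pieces that have already been resolved are accumulated in `D`, which makes the induction
over `T` work. -/
theorem comp_tangF {ρ : (A ⊗[k] A)ˣ} {e e' : ι → A} (hρ : IsQuasitriangular k ρ)
    (he : (ρ : A ⊗[k] A) = ∑ x, e x ⊗ₜ[k] e' x) {m m' n : ℕ} (D : BeadDiagram A m m')
    (T : TangDiagram m' n) : CatHom.comp k (CatHom.of k D) (tangF k ρ T) =
      resolutionSum e e' (Word.toHom m n) (Word.mk k m D.layers) T.layers := by
  have hi := hρ.inv_eq he
  induction T with
  | nil p =>
    exact (CatHom.comp_id k _).trans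
      ((Word.toHom_layers D).symm.trans resolutionSum_nil.symm)
  | cons i j g hm hm' T ih =>
    rw [tangF, ← CatHom.assoc]
    cases g with
    | cup =>
      rw [tangGenF, CatHom.gen, CatHom.of_comp_of, ih]
      simp only [Diagram.layers_append, Diagram.layers, resolutionSum_cup]
      rfl
    | cap =>
      rw [tangGenF, CatHom.gen, CatHom.of_comp_of, ih]
      simp only [Diagram.layers_append, Diagram.layers, resolutionSum_cap]
      rfl
    | R =>
      rw [tangGenF, CatHom.gen, he, CatHom.tensorBead_sum, CatHom.comp_sum, CatHom.comp_sum,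
        CatHom.sum_comp, Diagram.layers, resolutionSum_R]
      refine Finset.sum_congr rfl fun x _ => ?_
      rw [CatHom.of_comp_of, CatHom.of_comp_of, ih]
      refine congrArg (fun Y => resolutionSum e e' _ Y _) ?_
      simp only [Diagram.layers_append, Diagram.layers, Word.bead, Word.P, Word.app_app,
        Word.mk_app, List.cons_append, List.append_assoc, List.nil_append]
    | L =>
      rw [tangGenF, CatHom.gen, hi, CatHom.tensorBead_sum, CatHom.sum_comp, CatHom.comp_sum,
        CatHom.sum_comp, Diagram.layers, resolutionSum_L]
      refine Finset.sum_congr rfl fun x _ => ?_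
      rw [CatHom.of_comp_of, CatHom.of_comp_of, ih]
      refine congrArg (fun Y => resolutionSum e e' _ Y _) ?_
      simp only [Diagram.layers_append, Diagram.layers, Word.bead, Word.P, Word.app_app,
        Word.mk_app, List.cons_append, List.append_assoc, List.nil_append]

/-- `F(T)` is the sum of all resolutions of `T`. -/
theorem tangF_eq_resolutionSum {ρ : (A ⊗[k] A)ˣ} {e e' : ι → A} (hρ : IsQuasitriangular k ρ)
    (he : (ρ : A ⊗[k] A) = ∑ x, e x ⊗ₜ[k] e' x) {m n : ℕ} (T : TangDiagram m n) :
    tangF k ρ T = resolutionSum e e' (Word.toHom m n) (Word.mk k m []) T.layers := by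
  rw [← CatHom.id_comp k (tangF k ρ T)]
  exact comp_tangF hρ he (.nil m) T

/-- What lies below the move is resolved into the word, and what lies above it into the functional.
-/
theorem TangMove.resolutionSum_append_eq {M : Type*} [AddCommGroup M] [Module k M]
    {ρ : (A ⊗[k] A)ˣ} {e e' : ι → A}
    (hρ : IsQuasitriangular k ρ) (he : (ρ : A ⊗[k] A) = ∑ x, e x ⊗ₜ[k] e' x) {m : ℕ}
    {Λ : Word k A m → M} (hΛ : BeadLinear Λ) {X : Word k A m} {x y u v : List (Layer TangGen)}
    (h : TangMove x y) (hx : Fits X.wd (u ++ x ++ v)) :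
    resolutionSum e e' Λ X (u ++ x ++ v) = resolutionSum e e' Λ X (u ++ y ++ v) := by
  induction u generalizing X with
  | nil =>
    rw [List.nil_append, List.nil_append, resolutionSum_append, resolutionSum_append]
    exact h.resolutionSum_eq hρ he (hΛ.resolutionSum e e' v) ((fits_append _ _ _).1 hx).1
  | cons l u ih =>
    obtain ⟨i, g⟩ := l
    obtain ⟨h1, h2⟩ := hx
    have h3 : ∀ Y : Word k A m, Y.wd = X.wd - inn g + out g →
        resolutionSum e e' Λ Y (u ++ x ++ v) = resolutionSum e e' Λ Y (u ++ y ++ v) := fun Y hY =>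
      ih (by rwa [hY])
    cases g <;> simp only [List.cons_append, resolutionSum_cup, resolutionSum_cap, resolutionSum_R,
      resolutionSum_L]
    · exact h3 _ (Word.wd_app _ _)
    · exact h3 _ (Word.wd_app _ _)
    · refine Finset.sum_congr rfl fun x _ => h3 _ ?_
      simp only [inn, out] at h1 ⊢
      simp
    · refine Finset.sum_congr rfl fun x _ => h3 _ ?_
      simp only [inn, out] at h1 ⊢
      simp
      omega

/-- `F` is invariant under regular isotopy. -/
theorem RegularIsotopic.tangF_eq {ρ : (A ⊗[k] A)ˣ} {e e' : ι → A} (hρ : IsQuasitriangular k ρ)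
    (he : (ρ : A ⊗[k] A) = ∑ x, e x ⊗ₜ[k] e' x) {m n : ℕ} {T T' : TangDiagram m n}
    (h : RegularIsotopic T T') : tangF k ρ T = tangF k ρ T' := by
  induction h with
  | rel T T' h =>
    obtain ⟨u, v, x, y, hm, h1, h2⟩ := h
    rw [tangF_eq_resolutionSum hρ he, tangF_eq_resolutionSum hρ he, h1, h2]
    exact hm.resolutionSum_append_eq hρ he (beadLinear_toHom m n) (h1 ▸ T.fits_layers.1)
  | refl T => rfl
  | symm _ _ _ ih => exact ih.symm
  | trans _ _ _ _ _ ih₁ ih₂ => exact ih₁.trans ih₂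

end ToHom

/-! ### The flat diagram of a tangle diagram -/

section Flat

variable {A : Type*}

/-- The immersed curve underlying an elementary tangle. -/
def TangGen.flat (A : Type*) : TangGen → CatGen A
  | .cup => .cup
  | .cap => .cap
  | .R => .P
  | .L => .P

/-- The immersed curves underlying a tangle diagram. -/
def flatLayers (A : Type*) (w : List (Layer TangGen)) : List (Layer (CatGen A)) :=
  w.map fun l => (l.1, l.2.flat A)

theorem TangGen.inn_flat (g : TangGen) : inn (g.flat A) = inn g := by cases g <;> rfl

theorem TangGen.out_flat (g : TangGen) : out (g.flat A) = out g := by cases g <;> rfl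

theorem flatten_eq_flatLayers (w : List (Layer TangGen)) : flatten w = flatLayers Empty w := by
  induction w with
  | nil => rfl
  | cons l w ih =>
    obtain ⟨i, g⟩ := l
    cases g <;> simp only [flatten, ih] <;> rfl

theorem mapBeads_flatLayers {B : Type*} (f : A → B) (w : List (Layer TangGen)) :
    mapBeads f (flatLayers A w) = flatLayers B w := by
  rw [mapBeads, flatLayers, List.map_map]
  refine List.map_congr_left fun l _ => ?_
  obtain ⟨i, g⟩ := l
  cases g <;> rfl

theorem wout_flatLayers (n : ℕ) (w : List (Layer TangGen)) :
    wout n (flatLayers A w) = wout n w := by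
  induction w generalizing n with
  | nil => rfl
  | cons l w ih =>
    simp only [flatLayers, List.map_cons, wout, TangGen.inn_flat, TangGen.out_flat]
    exact ih _

theorem fits_flatLayers (n : ℕ) (w : List (Layer TangGen)) :
    Fits n (flatLayers A w) ↔ Fits n w := by
  induction w generalizing n with
  | nil => rfl
  | cons l w ih =>
    simp only [flatLayers, List.map_cons, Fits, TangGen.inn_flat, TangGen.out_flat]
    exact and_congr_right fun _ => ih _

theorem widths_getElem? {G : Type*} [Signature G] (n h : ℕ) (w : List (Layer G))
    (hh : h ≤ w.length) : (widths n w)[h]? = some (wout n (w.take h)) := by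
  induction w generalizing n h with
  | nil => obtain rfl : h = 0 := by simpa using hh
           rfl
  | cons l w ih =>
    cases h with
    | zero => rfl
    | succ h => exact ih _ h (by simpa using hh)

theorem SingleStranded.rigid_flatLayers {T : TangDiagram 1 1} (h : SingleStranded T) (A : Type*) :
    Rigid (flatLayers A T.layers) := by
  have h1 : Visits (flatLayers Empty T.layers) := by
    intro n p hn hp
    rw [flatLayers, List.length_map] at hn
    rw [flatLayers, ← List.map_take] at hp
    obtain ⟨t, ht⟩ := h n _ p (widths_getElem? 1 n T.layers hn)
      (by rwa [← wout_flatLayers (A := Empty)])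
    rw [flatten_eq_flatLayers] at ht
    exact ⟨t, ht⟩
  have h2 := h1.mapBeads (Empty.elim : Empty → A)
  rw [mapBeads_flatLayers] at h2
  exact h2.rigid ((fits_flatLayers 1 _).2 T.fits_layers.1)

theorem whitneyDegree_eq (A : Type*) (T : TangDiagram 1 1) :
    whitneyDegree T = halfTurns (strandEvents (flatLayers A T.layers)) / 2 := by
  rw [whitneyDegree, flatten_eq_flatLayers, ← mapBeads_flatLayers (Empty.elim : Empty → A),
    strandEvents_mapBeads, halfTurns_map]

/-- The diagram without its beads. -/
def dropBeads : List (Layer (CatGen A)) → List (Layer (CatGen A))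
  | [] => []
  | (_, .bead _) :: w => dropBeads w
  | (i, .cup) :: w => (i, .cup) :: dropBeads w
  | (i, .cap) :: w => (i, .cap) :: dropBeads w
  | (i, .P) :: w => (i, .P) :: dropBeads w

/-- Beads affect neither the components nor the turns of the curve. They are deleted one at a time,
with `u` as the part already treated. -/
theorem dropBeads_spec (u w : List (Layer (CatGen A))) (hw : Fits 1 (u ++ w)) :
    (Rigid (u ++ w) ↔ Rigid (u ++ dropBeads w)) ∧
      halfTurns (strandEvents (u ++ w)) = halfTurns (strandEvents (u ++ dropBeads w)) := by
  induction w generalizing u with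
  | nil => exact ⟨Iff.rfl, rfl⟩
  | cons l w ih =>
    obtain ⟨i, g⟩ := l
    have e : u ++ (i, g) :: w = u ++ [(i, g)] ++ w := by simp
    rw [e] at hw ⊢
    cases g with
    | bead a =>
      have hw' : Fits 1 (u ++ [] ++ w) := by
        rw [fits_append, fits_append, wout_append] at hw ⊢
        exact ⟨⟨hw.1.1, trivial⟩, by
          have := hw.1.2.1
          have h2 := hw.2
          simp only [wout, inn_bead, out_bead] at this h2 ⊢
          rwa [Nat.sub_add_cancel (by omega)] at h2⟩
      have h1 := rigid_replace_iff (u := u) (v := w) (colorEquiv_bead i a)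
      have h2 := (bead_simulates i a).strandEvents halfTurns_congruence (by simp) hw hw'
      rw [List.append_nil] at h1 h2 hw'
      obtain ⟨h3, h4⟩ := ih u hw'
      exact ⟨h1.trans h3, h2.trans h4⟩
    | cup =>
      rw [dropBeads, List.append_cons u _ (dropBeads w)]
      exact ih _ hw
    | cap =>
      rw [dropBeads, List.append_cons u _ (dropBeads w)]
      exact ih _ hw
    | P =>
      rw [dropBeads, List.append_cons u _ (dropBeads w)]
      exact ih _ hw

variable {k ι : Type*} [CommRing k] [Ring A] [HopfAlgebra k A] [Fintype ι]

/-- The flat shadow of a regular isotopy consists of moves of `Cat(A)`, so the invariants of curves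
apply to it directly. -/
theorem TangMove.catMove {x y : List (Layer TangGen)} (h : TangMove x y) :
    CatMove k (flatLayers A x) (flatLayers A y) := by
  cases h with
  | exchange i j g h =>
    have := CatMove.exchange (k := k) i j (g.flat A) (h.flat A)
    rwa [TangGen.inn_flat, TangGen.out_flat] at this
  | zigzag_left i => exact .zigzag_left i
  | zigzag_right i => exact .zigzag_right i
  | RL i => exact .P_sq i
  | LR i => exact .P_sq i
  | braid i => exact .P_braid i
  | cap_over i => exact .cap_switchback i
  | cap_under i => exact .cap_switchback i
  | cup_over i => exact .cup_switchback i
  | cup_under i => exact .cup_switchback i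

/-- The number of components and the Whitney degree are invariant under regular isotopy. -/
theorem RegularIsotopic.flatLayers_spec (hs : Function.Bijective (antip k (A := A)))
    {T T' : TangDiagram 1 1} (h : RegularIsotopic T T') :
    (Rigid (flatLayers A T.layers) ↔ Rigid (flatLayers A T'.layers)) ∧
      halfTurns (strandEvents (flatLayers A T.layers)) =
        halfTurns (strandEvents (flatLayers A T'.layers)) := by
  induction h with
  | rel T T' h =>
    obtain ⟨u, v, x, y, hm, h1, h2⟩ := h
    have hf : Fits 1 (flatLayers A T.layers) :=
      (fits_flatLayers 1 _).2 T.fits_layers.1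
    have hstep : WordStep k 1 (flatLayers A T.layers)
        (flatLayers A T'.layers) := by
      rw [h1, flatLayers, List.map_append, List.map_append] at hf
      rw [fits_append, fits_append] at hf
      exact ⟨_, _, _, _, hm.catMove, hf.1.2, by
        rw [h1, flatLayers, List.map_append, List.map_append]; rfl, by
        rw [h2, flatLayers, List.map_append, List.map_append]; rfl⟩
    exact ⟨hstep.rigid_iff, (hstep.sameEvents hs hf).1⟩
  | refl T => exact ⟨Iff.rfl, rfl⟩
  | symm _ _ _ ih => exact ⟨ih.1.symm, ih.2.symm⟩
  | trans _ _ _ _ _ ih₁ ih₂ => exact ⟨ih₁.1.trans ih₂.1, ih₁.2.trans ih₂.2⟩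

/-! ### Resolutions -/

theorem dropBeads_of_mem_resolutions {e e' : ι → A} {w : List (Layer TangGen)}
    {v : List (Layer (CatGen A))} (hv : v ∈ resolutions k e e' w) :
    dropBeads v = flatLayers A w := by
  induction w generalizing v with
  | nil =>
    obtain rfl : v = [] := by simpa [resolutions] using hv
    rfl
  | cons l w ih =>
    obtain ⟨i, g⟩ := l
    cases g <;> simp only [resolutions, Multiset.mem_map, Multiset.mem_bind] at hv
    · obtain ⟨v, hv, rfl⟩ := hv; simp only [dropBeads, ih hv]; rfl
    · obtain ⟨v, hv, rfl⟩ := hv; simp only [dropBeads, ih hv]; rfl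
    · obtain ⟨x, -, v, hv, rfl⟩ := hv; simp only [dropBeads, ih hv]; rfl
    · obtain ⟨x, -, v, hv, rfl⟩ := hv; simp only [dropBeads, ih hv]; rfl

theorem fits_of_mem_resolutions {e e' : ι → A} {n : ℕ} {w : List (Layer TangGen)}
    {v : List (Layer (CatGen A))} (hw : Fits n w) (hv : v ∈ resolutions k e e' w) :
    Fits n v ∧ wout n v = wout n w := by
  induction w generalizing v n with
  | nil =>
    obtain rfl : v = [] := by simpa [resolutions] using hv
    exact ⟨trivial, rfl⟩
  | cons l w ih =>
    obtain ⟨i, g⟩ := l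
    obtain ⟨h1, h2⟩ := hw
    cases g <;> simp only [resolutions, Multiset.mem_map, Multiset.mem_bind] at hv
    · obtain ⟨v, hv, rfl⟩ := hv
      exact ⟨⟨h1, (ih h2 hv).1⟩, (ih h2 hv).2⟩
    · obtain ⟨v, hv, rfl⟩ := hv
      exact ⟨⟨h1, (ih h2 hv).1⟩, (ih h2 hv).2⟩
    · obtain ⟨x, -, v, hv, rfl⟩ := hv
      simp only [inn, out] at h1 h2
      have h3 : n - 2 + 2 - 1 + 1 - 1 + 1 = n - 2 + 2 := by omega
      simp only [Fits, wout, inn, out, h3]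
      exact ⟨⟨h1, by omega, by omega, (ih h2 hv).1⟩, (ih h2 hv).2⟩
    · obtain ⟨x, -, v, hv, rfl⟩ := hv
      simp only [inn, out] at h1 h2
      have h3 : n - 1 + 1 - 1 + 1 - 2 + 2 = n - 2 + 2 := by omega
      simp only [Fits, wout, inn, out, h3]
      exact ⟨⟨by omega, by omega, by omega, (ih h2 hv).1⟩, (ih h2 hv).2⟩

/-! ### The value of `F` on a single strand -/

theorem CatHom.npow_of (D : BeadDiagram A 1 1) (n : ℕ) : ∃ E : BeadDiagram A 1 1,
    CatHom.npow k (CatHom.of k D) n = CatHom.of k E ∧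
      E.layers = (List.replicate n D.layers).flatten := by
  induction n with
  | zero => exact ⟨.nil 1, rfl, rfl⟩
  | succ n ih =>
    obtain ⟨E, h1, h2⟩ := ih
    refine ⟨E.append D, ?_, ?_⟩
    · rw [CatHom.npow, h1, CatHom.of_comp_of]
    · rw [Diagram.layers_append, h2, List.replicate_succ', List.flatten_append]; simp

theorem exists_curlPow_eq (n : ℤ) : ∃ E : BeadDiagram A 1 1,
    curlPow k A n = CatHom.of k E ∧ E.layers = curlLayers A n := by
  cases n with
  | ofNat n => exact CatHom.npow_of _ n
  | negSucc n => exact CatHom.npow_of _ (n + 1)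

theorem layersHom_bead_curlLayers (a : A) (n : ℤ) :
    layersHom k 1 1 ((0, .bead a) :: curlLayers A n) =
      CatHom.comp k (bead k a) (curlPow k A n) := by
  obtain ⟨E, h1, h2⟩ := exists_curlPow_eq (k := k) (A := A) n
  rw [h1, ← h2]
  exact (layersHom_layers (.cons 0 0 (.bead a) rfl rfl E)).trans
    (CatHom.of_comp_of k (.cons 0 0 (.bead a) rfl rfl (.nil 1)) E).symm

theorem tangF_eq_sum {ρ : (A ⊗[k] A)ˣ} {e e' : ι → A} (hρ : IsQuasitriangular k ρ)
    (he : (ρ : A ⊗[k] A) = ∑ x, e x ⊗ₜ[k] e' x) {m n : ℕ} (T : TangDiagram m n) :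
    tangF k ρ T = ((resolutions k e e' T.layers).map (layersHom k m n)).sum :=
  tangF_eq_resolutionSum hρ he T

/-- All resolutions have the same underlying curve as `T`. -/
theorem resolution_spec {e e' : ι → A} {T : TangDiagram 1 1}
    (hT : Rigid (flatLayers A T.layers)) {v : List (Layer (CatGen A))}
    (hv : v ∈ resolutions k e e' T.layers) :
    Fits 1 v ∧ wout 1 v = 1 ∧ Rigid v ∧ halfTurns (strandEvents v) / 2 = whitneyDegree T := by
  obtain ⟨h1, h2⟩ := fits_of_mem_resolutions T.fits_layers.1 hv
  obtain ⟨h3, h4⟩ := dropBeads_spec [] v h1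
  rw [List.nil_append, List.nil_append, dropBeads_of_mem_resolutions hv] at h3 h4
  exact ⟨h1, h2.trans T.fits_layers.2, h3.2 hT, by rw [whitneyDegree_eq A, h4]⟩

/-- Each resolution has a normal form with the same power of `G`, so the sum can be taken inside the
bead. -/
theorem tangF_eq_bead_curlPow {ρ : (A ⊗[k] A)ˣ} {e e' : ι → A} (hρ : IsQuasitriangular k ρ)
    (he : (ρ : A ⊗[k] A) = ∑ x, e x ⊗ₜ[k] e' x) {T : TangDiagram 1 1}
    (hT : Rigid (flatLayers A T.layers)) :
    tangF k ρ T = CatHom.comp k (bead k (concentratedElement k e e' T))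
      (curlPow k A (whitneyDegree T)) := by
  let f : A →ₗ[k] CatHom k A 1 1 :=
    (CatHom.compₗ k 1 1 1).flip (curlPow k A (whitneyDegree T)) ∘ₗ CatHom.beadₗ k 0 0 rfl
  have hf : ∀ a, CatHom.comp k (bead k a) (curlPow k A (whitneyDegree T)) = f a := fun _ => rfl
  rw [tangF_eq_sum hρ he, hf, concentratedElement, map_multiset_sum, Multiset.map_map]
  refine congrArg _ (Multiset.map_congr rfl fun v hv => ?_)
  obtain ⟨h1, h2, h3, h4⟩ := resolution_spec hT hv
  have h5 := congrArg (Word.toHom 1 1)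
    (Word.mk_eq_bead_curl (k := k) (hρ.bijective_antipode he) h1 h2 h3)
  rw [h4] at h5
  exact h5.trans (layersHom_bead_curlLayers _ _)

theorem CatHom.element_layersHom (hs : Function.Bijective (antip k (A := A)))
    {w : List (Layer (CatGen A))} (hw : Fits 1 w) (hw' : wout 1 w = 1) (hr : Rigid w) :
    CatHom.element hs (layersHom k 1 1 w) = concentrate k 0 (strandEvents w) := by
  obtain ⟨D, rfl⟩ := Diagram.exists_layers w 1 1 hw hw'
  rw [layersHom_layers, CatHom.element_of, strandElement, if_pos hr]

theorem CatHom.element_bead_curlPow (hs : Function.Bijective (antip k (A := A))) (a : A) (n : ℤ) :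
    CatHom.element hs (CatHom.comp k (bead k a) (curlPow k A n)) = a := by
  obtain ⟨h1, h2, -, h4⟩ := bead_curlLayers_spec (k := k) a n
  rw [← layersHom_bead_curlLayers,
    CatHom.element_layersHom hs h1 h2 (rigid_bead_curlLayers 0 a n), h4]

end Flat

end KnotOnString

/-! ### The main theorem -/

theorem mainTheorem3 {k A ι : Type*} [CommRing k] [Ring A] [HopfAlgebra k A] [Fintype ι]
    (ρ : (A ⊗[k] A)ˣ) (hρ : KnotOnString.IsQuasitriangular k ρ)
    (e e' : ι → A) (he : (ρ : A ⊗[k] A) = ∑ x, e x ⊗ₜ[k] e' x) :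
    -- `F` is well defined on tangles up to regular isotopy
    (∀ {m n : ℕ} (T T' : KnotOnString.TangDiagram m n), KnotOnString.RegularIsotopic T T' →
      KnotOnString.tangF k ρ T = KnotOnString.tangF k ρ T') ∧
    ∀ T : KnotOnString.TangDiagram 1 1, KnotOnString.SingleStranded T →
      -- `F(T) = w[T] G^{d(T)}`
      KnotOnString.tangF k ρ T =
        KnotOnString.CatHom.comp k
          (KnotOnString.bead k (KnotOnString.concentratedElement k e e' T))
          (KnotOnString.curlPow k A (KnotOnString.whitneyDegree T)) ∧
      -- the algebra element in such an expression is determined by the morphism `F(T)`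
      (∀ (a : A) (n : ℤ), KnotOnString.tangF k ρ T =
          KnotOnString.CatHom.comp k (KnotOnString.bead k a) (KnotOnString.curlPow k A n) →
        a = KnotOnString.concentratedElement k e e' T) ∧
      -- `w[T]` and `d(T)` are regular isotopy invariants
      ∀ T' : KnotOnString.TangDiagram 1 1, KnotOnString.RegularIsotopic T T' →
        KnotOnString.concentratedElement k e e' T' = KnotOnString.concentratedElement k e e' T ∧
        KnotOnString.whitneyDegree T' = KnotOnString.whitneyDegree T := by
  have hs := hρ.bijective_antipode he
  -- A linear map on morphisms recovers `w[T]` from `F(T)`; both uniqueness and invariance of `w[T]`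
  -- follow.
  have key : ∀ {T : KnotOnString.TangDiagram 1 1},
      KnotOnString.Rigid (KnotOnString.flatLayers A T.layers) →
      KnotOnString.CatHom.element hs (KnotOnString.tangF k ρ T) =
        KnotOnString.concentratedElement k e e' T := fun hT => by
    rw [KnotOnString.tangF_eq_bead_curlPow hρ he hT, KnotOnString.CatHom.element_bead_curlPow]
  refine ⟨fun T T' h => h.tangF_eq hρ he, fun T hT => ?_⟩
  have hr := hT.rigid_flatLayers A
  refine ⟨KnotOnString.tangF_eq_bead_curlPow hρ he hr, fun a n h => ?_, fun T' h => ?_⟩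
  · rw [← key hr, h, KnotOnString.CatHom.element_bead_curlPow]
  -- Rigidity passes to `T'`, so `key` applies to both tangles. The degree is compared on the flat
  -- curves, since the morphism need not determine it: for `A = 0` all endomorphisms of `V` vanish.
  · obtain ⟨h1, h2⟩ := h.flatLayers_spec hs
    exact ⟨by rw [← key (h1.1 hr), ← key hr, h.tangF_eq hρ he],
      by rw [KnotOnString.whitneyDegree_eq A, KnotOnString.whitneyDegree_eq A, h2]⟩
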